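/- Let $n\ge 0$ and let $(W_n,S)$ be a Coxeter system of type $B_n$, $S=\{s_0,\dots,s_{n-1}\}$, with $m_{s_0s_1}=4$, $m_{s_is_{i+1}}=3$ for $i\ge 1$, and $m_{s_is_j}=2$ for $|i-j|>1$. *The category $\mathcal{AD}(W_n,S)$.* For a finitary subset $I\subset S$ (i.e. $W_I$ finite) let $w_I$ be the longest element of $W_I$. An $(I,J)$-coset is an element $p$ of $W_I\backslash W/W_J$; write $\overline p$ and $\underline p$ for its longest and shortest elements. Let $*$ be the product of the Coxeter monoid (generators $S$, braid relations, $s*s=s$), whose elements are identified with those of $W$ through reduced words. For an $(I,J)$-coset $p$ and a $(J,K)$-coset $q$ put $p*q=W_I(\overline p*\overline q)W_K$; this composition is reduced if $(\overline p w_J^{-1}).\overline q=\overline p*\overline q=\overline p.(w_J^{-1}\overline q)$, where $x.y$ denotes a product $xy$ with $\ell(xy)=\ell(x)+\ell(y)$. The nilCoxeter algebroid $\mathcal D(W,S)$ is the $\mathbb Z$-linear category whose objects are the finitary subsets of $S$ and in which $\mathrm{Hom}(J,I)$ is the free $\mathbb Z$-module on symbols $\partial_p$, $p$ an $(I,J)$-coset,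 with $\partial_p\circ\partial_q=\partial_{p*q}$ if $p*q$ is reduced and $\partial_p\circ\partial_q=0$ otherwise. An $(I,J)$-coset $p$ is core if $I\cap\underline pJ\underline p^{-1}=I$ and $\underline p^{-1}I\underline p\cap J=J$. It is atomic if it is core and, for some finitary $M=I\sqcup\{s\}=J\sqcup\{t\}$ with $s,t\in S$, it has the reduced expression $[I,M,J]$, i.e. it is the reduced composition of the $(I,M)$-coset and the $(M,J)$-coset of the identity. Let $\mathcal{AD}(W,S)$ be the $\mathbb Z$-linear subcategory of $\mathcal D(W,S)$, with the same objects, generated by the $\partial_p$ with $p$ atomic. *The category $\mathcal{NC}_B(n)$.* The labeled nilCoxeter algebroid of type $B$ is the $\mathbb Z$-linear category presented as follows. Its objects are the sequences $(n_0,n_1,\dots,n_k)$ of positive integers with $\sum_c n_c=n+1$. Such a sequence is identified with the subset $J\subset S$ such that $s_j\in J$ if and only if $j$ and $j+1$ lie in the same block when $\{0,\dots,n\}$ is cut into consecutive blocks of sizes $n_0,\dots,n_k$. The generating morphisms are $\partial_i^J$ for $0\le i\le k-1$: $\partial_0^J$ is an endomorphism of $J$, and for $i>0$, $\partial_i^J$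 goes from $J=(n_0,\dots,n_i,n_{i+1},\dots,n_k)$ to $(n_0,\dots,n_{i+1},n_i,\dots,n_k)$. The relations are, for every $J$ and whenever the indices are in range (superscripts that are determined being omitted), $$\partial_0\partial_1\partial_0\partial_1^J=\partial_1\partial_0\partial_1\partial_0^J,\qquad \partial_i\partial_{i+1}\partial_i^J=\partial_{i+1}\partial_i\partial_{i+1}^J\ (1\le i\le k-2),$$ $$\partial_i\partial_j^J=\partial_j\partial_i^J\ (|i-j|>1),\qquad \partial_i\partial_i^J=0\ (0\le i\le k-1).$$ *Claim.* For $J\subset S$ write $S\setminus J=\{s_{d_0},\dots,s_{d_{k-1}}\}$ with $d_0<\dots<d_{k-1}$, and for $s=s_{d_i}$ let $\mathtt a_i^J$ be the atomic coset with reduced expression $[(J\cup\{s\})\setminus\{t\},\,J\cup\{s\},\,J]$, where $t=w_{J\cup\{s\}}\,s\,w_{J\cup\{s\}}$. Then there is an isomorphism of $\mathbb Z$-linear categories $$\psi\colon \mathcal{NC}_B(n)\xrightarrow{\ \sim\ }\mathcal{AD}(W_n,S)$$ which sends each sequence to the subset of $S$ that it is identified with, and sends $\partial_i^J\mapsto\partial_{\mathtt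 a_i^J}$. -/

import Mathlib

namespace CoxeterB

open CoxeterSystem List

section Coxeter

variable {B W : Type*} [Group W] {M : CoxeterMatrix B} (cs : CoxeterSystem M W)

/-! ### Inversions -/

open Classical in
/-- The involution `(t, ε) ↦ (s t s, ε + [t = s])` of `W × ℤ/2`, for `s` simple. -/
noncomputable def invFlip (i : B) : Function.End (W × ZMod 2) := fun p =>
  (cs.simple i * p.1 * cs.simple i, p.2 + if p.1 = cs.simple i then 1 else 0)

open Classical in
lemma invFlip_prod (ω : List B) (t : W) (ε : ZMod 2) :
    ((ω.reverse.map (invFlip cs)).prod) (t, ε) =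
      ((cs.wordProd ω)⁻¹ * t * cs.wordProd ω, ε + ((cs.leftInvSeq ω).count t : ℕ)) := by
  induction ω generalizing t ε with
  | nil =>
    have h0 : (1 : Function.End (W × ZMod 2)) (t, ε) = (t, ε) := rfl
    simp [h0]
  | cons i ω ih =>
    have h1 : ∀ (f g : Function.End (W × ZMod 2)) (x), (f * g) x = f (g x) := fun _ _ _ => rfl
    simp only [reverse_cons, map_append, map_cons, map_nil, prod_append, prod_cons, prod_nil,
      mul_one, h1]
    rw [invFlip, ih]
    have h2 : ∀ l : List W, (l.map (MulAut.conj (cs.simple i))).count t =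
        l.count (cs.simple i * t * cs.simple i) := by
      intro l
      have := count_map_of_injective l (MulAut.conj (cs.simple i))
        (MulEquiv.injective _) (cs.simple i * t * cs.simple i)
      rw [← this]
      congr 1
      simp [MulAut.conj_apply, mul_assoc]
    ext
    · simp [wordProd_cons, mul_assoc]
    · simp only [leftInvSeq, count_cons, h2]
      by_cases h : t = cs.simple i
      · subst h; simp; ring
      · simp [h, Ne.symm h]

lemma alternatingWord_two_mul_map_prod {N : Type*} [Monoid N] (f : B → N) (i j : B) (m : ℕ) :
    (((alternatingWord i j (2 * m)).reverse).map f).prod = (f j * f i) ^ m := by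
  induction m with
  | zero => simp [alternatingWord]
  | succ m ih =>
    rw [show 2 * (m + 1) = 2 * m + 1 + 1 by ring, alternatingWord_succ, alternatingWord_succ]
    simp only [concat_eq_append, reverse_append, reverse_cons, reverse_nil, nil_append,
      map_append, map_cons, map_nil, prod_append, prod_cons, prod_nil, mul_one, ih]
    rw [pow_succ', mul_assoc]

open Classical in
lemma invFlip_isLiftable : M.IsLiftable (invFlip cs) := by
  intro j i
  funext ⟨t, ε⟩
  rw [← alternatingWord_two_mul_map_prod, invFlip_prod]
  have hw : cs.wordProd (alternatingWord i j (2 * M j i)) = 1 := by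
    rw [prod_alternatingWord_eq_mul_pow]
    simp [M.symmetric j i]
  have hc : (((cs.leftInvSeq (alternatingWord i j (2 * M j i))).count t : ℕ) : ZMod 2) = 0 := by
    set m := M j i with hm
    set l := cs.leftInvSeq (alternatingWord i j (2 * m)) with hl
    have hlen : l.length = 2 * m := by simp [hl]
    have hper : ∀ k, (h : k < m) → l[k]'(by omega) = l[m + k]'(by omega) := by
      intro k h
      simp only [hl]
      rw [getElem_leftInvSeq_alternatingWord _ _ _ _ _ (by omega),
        getElem_leftInvSeq_alternatingWord _ _ _ _ _ (by omega),
        prod_alternatingWord_eq_mul_pow, prod_alternatingWord_eq_mul_pow]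
      have e1 : (2 * k + 1) / 2 = k := by omega
      have e2 : (2 * (m + k) + 1) / 2 = m + k := by omega
      have o1 : ¬ Even (2 * k + 1) := by simp
      have o2 : ¬ Even (2 * (m + k) + 1) := by simp
      rw [e1, e2, if_neg o1, if_neg o2, pow_add, hm, simple_mul_simple_pow, one_mul]
    have : l = l.take m ++ l.take m := by
      conv_lhs => rw [← take_append_drop m l]
      congr 1
      apply List.ext_getElem
      · simp [hlen]; omega
      · intro k h1 h2
        simp only [length_take, hlen] at h2
        simp only [getElem_drop, getElem_take]
        exact (hper k (by omega)).symm
    rw [this, count_append]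
    push_cast
    exact CharTwo.add_self_eq_zero _
  simp only [hw, hc, inv_one, one_mul, mul_one, add_zero]
  rfl


/-- The action of `W` on `W × ℤ/2` given by the involutions `invFlip`. -/
noncomputable def invFlipHom : W →* Function.End (W × ZMod 2) :=
  cs.lift ⟨invFlip cs, invFlip_isLiftable cs⟩

/-- The parity of the number of occurrences of `t` in the left inversion sequence of any word
for `w`. -/
noncomputable def invParity (w t : W) : ZMod 2 := (invFlipHom cs w⁻¹ (t, 0)).2

open Classical in
lemma invFlipHom_wordProd (ω : List B) (t : W) (ε : ZMod 2) :
    invFlipHom cs (cs.wordProd ω)⁻¹ (t, ε) = ((cs.wordProd ω)⁻¹ * t * cs.wordProd ω,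
      ε + ((cs.leftInvSeq ω).count t : ℕ)) := by
  rw [← invFlip_prod, ← wordProd_reverse, wordProd, map_list_prod, List.map_map]
  have : ⇑(invFlipHom cs) ∘ cs.simple = invFlip cs := by
    funext i
    simp only [Function.comp, invFlipHom]
    exact cs.lift_apply_simple (invFlip_isLiftable cs) i
  rw [this]

open Classical in
lemma invParity_wordProd (ω : List B) (t : W) :
    invParity cs (cs.wordProd ω) t = ((cs.leftInvSeq ω).count t : ℕ) := by
  rw [invParity, invFlipHom_wordProd]; simp

lemma invFlipHom_inv (w t : W) (ε : ZMod 2) :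
    invFlipHom cs w⁻¹ (t, ε) = (w⁻¹ * t * w, ε + invParity cs w t) := by
  classical
  obtain ⟨ω, rfl⟩ := cs.wordProd_surjective w
  rw [invFlipHom_wordProd, invParity_wordProd]

lemma invParity_mul (x y t : W) :
    invParity cs (x * y) t = invParity cs x t + invParity cs y (x⁻¹ * t * x) := by
  have h1 : ∀ (f g : Function.End (W × ZMod 2)) (z), (f * g) z = f (g z) := fun _ _ _ => rfl
  rw [invParity, mul_inv_rev, map_mul, h1, invFlipHom_inv, invFlipHom_inv, zero_add]

lemma invParity_one (t : W) : invParity cs 1 t = 0 := by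
  classical
  have := invParity_wordProd cs [] t
  simpa using this

lemma invParity_simple (i : B) (t : W) [Decidable (t = cs.simple i)] :
    invParity cs (cs.simple i) t = if t = cs.simple i then 1 else 0 := by
  classical
  have := invParity_wordProd cs [i] t
  simp only [wordProd_singleton, leftInvSeq_singleton] at this
  rw [this]
  by_cases h : t = cs.simple i
  · simp [h]
  · rw [if_neg h, count_eq_zero_of_not_mem (by simpa using h)]; simp

lemma invParity_self {t : W} (ht : cs.IsReflection t) : invParity cs t t = 1 := by
  classical
  obtain ⟨w, i, rfl⟩ := ht
  have h := invParity_mul cs w w⁻¹ (w * cs.simple i * w⁻¹)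
  rw [mul_inv_cancel, invParity_one] at h
  rw [invParity_mul, invParity_mul, invParity_simple]
  have e1 : w⁻¹ * (w * cs.simple i * w⁻¹) * w = cs.simple i := by group
  have e2 : (w * cs.simple i)⁻¹ * (w * cs.simple i * w⁻¹) * (w * cs.simple i) = cs.simple i := by
    group
  rw [e1] at h
  rw [e1, e2, if_pos rfl, add_right_comm, ← h, zero_add]

lemma length_lt_of_invParity {w t : W} (h : invParity cs w t = 1) :
    cs.length (t * w) < cs.length w := by
  classical
  obtain ⟨ω, hω, rfl⟩ := cs.exists_isReduced w
  rw [invParity_wordProd] at h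
  have hm : t ∈ cs.leftInvSeq ω := by
    by_contra hc
    rw [count_eq_zero_of_not_mem hc] at h
    simp at h
  exact (cs.isLeftInversion_of_mem_leftInvSeq hω hm).2

/-- Strong exchange: the left inversions are detected by `invParity`. -/
lemma length_lt_iff {w t : W} (ht : cs.IsReflection t) :
    cs.length (t * w) < cs.length w ↔ invParity cs w t = 1 := by
  refine ⟨fun h => ?_, length_lt_of_invParity cs⟩
  by_contra hc
  have h0 : invParity cs w t = 0 := by
    generalize invParity cs w t = a at hc
    revert hc; decide +revert
  have : invParity cs (t * w) t = 1 := by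
    rw [invParity_mul, invParity_self cs ht]
    have : t⁻¹ * t * t = t := by group
    rw [this, h0, add_zero]
  have := length_lt_of_invParity cs this
  rw [← mul_assoc, ht.mul_self, one_mul] at this
  omega

lemma length_mul_simple_lt_iff {x t : W} (i : B) (ht : cs.IsReflection t)
    (hne : t * x ≠ x * cs.simple i) :
    cs.length (t * (x * cs.simple i)) < cs.length (x * cs.simple i) ↔
      cs.length (t * x) < cs.length x := by
  classical
  rw [length_lt_iff cs ht, length_lt_iff cs ht, invParity_mul, invParity_simple, if_neg, add_zero]
  intro h
  apply hne
  rw [← h]; group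

/-! ### The Bruhat order -/

/-- The Bruhat order: `x ≤ y` if `y` is obtained from `x` by successive multiplications by
reflections, each of which increases the length. -/
def Bruhat : W → W → Prop :=
  Relation.ReflTransGen fun x y => ∃ t, cs.IsReflection t ∧ y = t * x ∧ cs.length x < cs.length y

variable {cs}

lemma Bruhat.trans {x y z : W} (h : Bruhat cs x y) (h' : Bruhat cs y z) : Bruhat cs x z :=
  Relation.ReflTransGen.trans h h'

lemma Bruhat.length_le {x y : W} (h : Bruhat cs x y) : cs.length x ≤ cs.length y := by
  induction h with
  | refl => rfl
  | tail _ h ih => obtain ⟨t, _, _, h⟩ := h; omega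

lemma Bruhat.eq_of_length {x y : W} (h : Bruhat cs x y) (hl : cs.length y ≤ cs.length x) :
    x = y := by
  induction h with
  | refl => rfl
  | tail h' h ih =>
    obtain ⟨t, _, _, h⟩ := h
    have := Bruhat.length_le h'
    omega

lemma Bruhat.antisymm {x y : W} (h : Bruhat cs x y) (h' : Bruhat cs y x) : x = y :=
  h.eq_of_length h'.length_le

lemma Bruhat.inv {x y : W} (h : Bruhat cs x y) : Bruhat cs x⁻¹ y⁻¹ := by
  induction h with
  | refl => exact .refl
  | @tail y z _ h ih =>
    obtain ⟨t, ht, rfl, h⟩ := h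
    refine ih.tail ⟨y⁻¹ * t * y⁻¹⁻¹, ht.conj _, ?_, by rwa [cs.length_inv, cs.length_inv]⟩
    rw [mul_inv_rev, ht.inv]; group

lemma bruhat_mul_simple {x : W} {i : B} (h : cs.length x < cs.length (x * cs.simple i)) :
    Bruhat cs x (x * cs.simple i) :=
  .single ⟨x * cs.simple i * x⁻¹, ⟨x, i, rfl⟩, by group, h⟩

lemma mul_simple_bruhat {x : W} {i : B} (h : cs.length (x * cs.simple i) < cs.length x) :
    Bruhat cs (x * cs.simple i) x := by
  have := bruhat_mul_simple (cs := cs) (x := x * cs.simple i) (i := i) (by simpa using h)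
  simpa using this

/-- A step of the Bruhat order is preserved by right multiplication by `s`, unless `s` swaps its
ends. -/
lemma bruhat_step {x t : W} (i : B) (ht : cs.IsReflection t)
    (h : cs.length x < cs.length (t * x)) :
    x * cs.simple i = t * x ∨ Bruhat cs (x * cs.simple i) (t * x * cs.simple i) := by
  by_cases hne : t * x = x * cs.simple i
  · exact .inl hne.symm
  · right
    refine .single ⟨t, ht, by group, ?_⟩
    have := length_mul_simple_lt_iff cs i ht hne
    have h2 := ht.length_mul_right_ne (x * cs.simple i)
    rw [mul_assoc]
    omega

/-- The lifting property. -/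
lemma Bruhat.mul_simple {x y : W} (h : Bruhat cs x y) {i : B}
    (hi : cs.length (y * cs.simple i) < cs.length y) : Bruhat cs (x * cs.simple i) y := by
  induction h using Relation.ReflTransGen.head_induction_on with
  | refl => exact mul_simple_bruhat hi
  | head h' h ih =>
    obtain ⟨t, ht, rfl, hl⟩ := h'
    rcases bruhat_step i ht hl with h1 | h1
    · rw [h1]; exact h
    · exact h1.trans ih

lemma Bruhat.simple_mul {x y : W} (h : Bruhat cs x y) {i : B}
    (hi : cs.length (cs.simple i * y) < cs.length y) : Bruhat cs (cs.simple i * x) y := by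
  have := (h.inv.mul_simple (i := i) (by
    rw [← cs.length_inv, ← cs.length_inv (y⁻¹)]; simpa using hi)).inv
  simpa only [mul_inv_rev, inv_inv, inv_simple] using this

lemma Bruhat.le_or {x y : W} (h : Bruhat cs x y) {i : B}
    (hi : cs.length (y * cs.simple i) < cs.length y) :
    Bruhat cs x (y * cs.simple i) ∨ Bruhat cs (x * cs.simple i) (y * cs.simple i) := by
  induction h with
  | refl => exact .inr .refl
  | @tail y z h h' ih =>
    obtain ⟨t, ht, rfl, hl⟩ := h'
    rcases bruhat_step i ht hl with h1 | h1
    · left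
      rw [← h1, simple_mul_simple_cancel_right]; exact h
    · rcases cs.length_mul_simple y i with h2 | h2
      · exact .inl ((h.trans (bruhat_mul_simple (by omega))).trans h1)
      · rcases ih (by omega) with h3 | h3
        · exact .inl (h3.trans h1)
        · exact .inr (h3.trans h1)


/-! ### The star product -/

variable (cs)

open Classical in
/-- Right multiplication by a simple reflection in the Coxeter monoid: `x * s` is `xs` if
`xs > x`, and `x` otherwise. -/
noncomputable def starSimple (x : W) (i : B) : W :=
  if cs.IsRightDescent x i then x else x * cs.simple i

/-- The product `x * y` of the Coxeter monoid (generated by `S` with the braid relations and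
`s * s = s`), whose elements are identified with those of `W` through reduced words; it is computed
letter by letter along a reduced word of `y` (see `starMul_wordProd` for the independence of the
word). -/
noncomputable def starMul (x y : W) : W :=
  (cs.exists_isReduced y).choose.foldl (starSimple cs) x

variable {cs}

lemma bruhat_starSimple (x : W) (i : B) : Bruhat cs x (starSimple cs x i) := by
  rw [starSimple]; split_ifs with h
  · exact .refl
  · exact bruhat_mul_simple (by rw [CoxeterSystem.not_isRightDescent_iff] at h; omega)

lemma bruhat_starSimple_of_bruhat {x y : W} (h : Bruhat cs x y) (i : B) :
    Bruhat cs (x * cs.simple i) (starSimple cs y i) := by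
  rw [starSimple]; split_ifs with hy
  · exact h.mul_simple hy
  · rw [CoxeterSystem.not_isRightDescent_iff] at hy
    exact (h.trans (bruhat_mul_simple (by omega))).mul_simple (by simp; omega)

/-- Along any reduced word of `y`, the star product of `x` and `y` is the largest of the elements
`xu` with `u ≤ y`. -/
lemma foldl_starSimple (x : W) (ω : List B) (hω : cs.IsReduced ω) :
    (∃ u, Bruhat cs u (cs.wordProd ω) ∧ ω.foldl (starSimple cs) x = x * u) ∧
      ∀ u, Bruhat cs u (cs.wordProd ω) → Bruhat cs (x * u) (ω.foldl (starSimple cs) x) := by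
  induction ω using List.reverseRecOn with
  | nil =>
    refine ⟨⟨1, .refl, by simp⟩, fun u hu => ?_⟩
    have : u = 1 := hu.eq_of_length (by simp)
    subst this; simp only [mul_one, foldl_nil]; exact .refl
  | append_singleton ω i ih =>
    have hω' : cs.IsReduced ω := by simpa using hω.take ω.length
    obtain ⟨⟨v, hv, hxv⟩, hmax⟩ := ih hω'
    have hl : cs.length (cs.wordProd ω * cs.simple i) = cs.length (cs.wordProd ω) + 1 := by
      have := hω.eq
      rw [wordProd_append, wordProd_singleton] at this
      rw [this, hω'.eq]; simp
    have hl' : cs.length (cs.wordProd ω) < cs.length (cs.wordProd ω * cs.simple i) := by omega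
    rw [wordProd_append, wordProd_singleton, foldl_append]
    simp only [foldl_cons, foldl_nil]
    constructor
    · rw [starSimple]; split_ifs with h
      · exact ⟨v, hv.trans (bruhat_mul_simple hl'), hxv⟩
      · exact ⟨v * cs.simple i, (hv.trans (bruhat_mul_simple hl')).mul_simple (by simpa using hl'),
          by rw [hxv, mul_assoc]⟩
    · intro u hu
      rcases hu.le_or (i := i) (by simpa using hl') with h | h
      · rw [simple_mul_simple_cancel_right] at h
        exact (hmax u h).trans (bruhat_starSimple _ _)
      · rw [simple_mul_simple_cancel_right] at h
        have := bruhat_starSimple_of_bruhat (hmax _ h) i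
        rwa [← mul_assoc, simple_mul_simple_cancel_right] at this

lemma star_max (x y : W) :
    (∃ u, Bruhat cs u y ∧ starMul cs x y = x * u) ∧
      ∀ u, Bruhat cs u y → Bruhat cs (x * u) (starMul cs x y) := by
  have h := (cs.exists_isReduced y).choose_spec
  have := foldl_starSimple x _ h.1
  rwa [← h.2] at this

lemma star_eq_of {x y u : W} (hu : Bruhat cs u y)
    (h : ∀ v, Bruhat cs v y → Bruhat cs (x * v) (x * u)) : starMul cs x y = x * u := by
  obtain ⟨⟨v, hv, he⟩, h2⟩ := star_max (cs := cs) x y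
  exact Bruhat.antisymm (he ▸ h v hv) (h2 u hu)

/-- The star product does not depend on the reduced word. -/
lemma starMul_wordProd (x : W) (ω : List B) (hω : cs.IsReduced ω) :
    starMul cs x (cs.wordProd ω) = ω.foldl (starSimple cs) x := by
  obtain ⟨⟨u, hu, he⟩, h⟩ := foldl_starSimple x ω hω
  rw [he] at h ⊢
  exact star_eq_of hu h

lemma star_eq_mul {x y : W} (h : cs.length (x * y) = cs.length x + cs.length y) :
    starMul cs x y = x * y := by
  obtain ⟨ω, hω, rfl⟩ := cs.exists_isReduced y
  rw [starMul_wordProd x ω hω]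
  rw [hω.eq] at h
  induction ω using List.reverseRecOn with
  | nil => simp
  | append_singleton ω i ih =>
    have hω' : cs.IsReduced ω := by simpa using hω.take ω.length
    rw [wordProd_append, wordProd_singleton, ← mul_assoc] at h ⊢
    have h1 := cs.length_mul_simple (x * cs.wordProd ω) i
    have h2 := cs.length_mul_le x (cs.wordProd ω)
    have h3 := hω'.eq
    simp only [length_append, length_cons, length_nil] at h
    have h4 := ih hω' (by omega)
    rw [foldl_append, h4]
    simp only [foldl_cons, foldl_nil, starSimple]
    rw [if_neg]
    rw [CoxeterSystem.not_isRightDescent_iff]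
    omega

/-! ### Parabolic subgroups and double cosets -/

variable (cs)

/-- The standard parabolic subgroup `W_I`. -/
def parabolic (I : Set B) : Subgroup W := Subgroup.closure (cs.simple '' I)

/-- The finitary subsets `I` of `S`, i.e. those for which `W_I` is finite. -/
@[ext]
structure Finitary where
  carrier : Set B
  finite : Finite (parabolic cs carrier)

variable {cs}

/-- The parabolic subgroup `W_I` of a finitary subset `I`. -/
abbrev Finitary.group (I : Finitary cs) : Subgroup W := parabolic cs I.carrier

lemma Finitary.exists_longest (I : Finitary cs) :
    ∃ w ∈ I.group, ∀ u ∈ I.group, cs.length u ≤ cs.length w :=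
  have := I.finite
  Set.exists_max_image (I.group : Set W) cs.length (Set.toFinite _) ⟨1, one_mem _⟩

/-- The longest element `w_I` of `W_I`. -/
noncomputable def Finitary.longest (I : Finitary cs) : W := I.exists_longest.choose

/-- The set `W_I \ W / W_J` of `(I, J)`-cosets. -/
abbrev Coset (I J : Finitary cs) : Type _ :=
  DoubleCoset.Quotient (I.group : Set W) (J.group : Set W)

/-- The `(I, J)`-coset `W_I w W_J`. -/
abbrev coset (I J : Finitary cs) (w : W) : Coset I J := DoubleCoset.mk I.group J.group w

variable {I J K L : Finitary cs}

/-- The subset `W_I w W_J` of `W` underlying an `(I, J)`-coset. -/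
def Coset.toSet (p : Coset I J) : Set W := {w | coset I J w = p}

lemma coset_eq {x y : W} :
    coset I J x = coset I J y ↔ ∃ a ∈ I.group, ∃ b ∈ J.group, y = a * x * b :=
  DoubleCoset.eq _ _ _ _

lemma Coset.nonempty (p : Coset I J) : p.toSet.Nonempty := ⟨Quotient.out p, Quotient.out_eq p⟩

lemma Coset.finite (p : Coset I J) : p.toSet.Finite := by
  have := I.finite
  have := J.finite
  obtain ⟨w, rfl⟩ := p.nonempty
  refine (Set.finite_range fun x : I.group × J.group => (x.1 : W) * w * x.2).subset ?_
  intro x hx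
  obtain ⟨a, ha, b, hb, rfl⟩ := coset_eq.1 (Eq.symm hx)
  exact ⟨(⟨a, ha⟩, ⟨b, hb⟩), rfl⟩

lemma Coset.exists_max (p : Coset I J) :
    ∃ w ∈ p.toSet, ∀ u ∈ p.toSet, cs.length u ≤ cs.length w :=
  Set.exists_max_image _ _ p.finite p.nonempty

lemma Coset.exists_min (p : Coset I J) :
    ∃ w ∈ p.toSet, ∀ u ∈ p.toSet, cs.length w ≤ cs.length u :=
  Set.exists_min_image _ _ p.finite p.nonempty

/-- The maximal (longest) element of a double coset. -/
noncomputable def Coset.max (p : Coset I J) : W := p.exists_max.choose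

/-- The minimal (shortest) element of a double coset. -/
noncomputable def Coset.min (p : Coset I J) : W := p.exists_min.choose

/-- The composition `p * q` of double cosets in the singular Coxeter monoid. -/
noncomputable def Coset.star (p : Coset I J) (q : Coset J K) : Coset I K :=
  coset I K (starMul cs p.max q.max)

/-- The composition `p * q` is reduced:
`(p̄ w_J⁻¹) . q̄ = p̄ * q̄ = p̄ . (w_J⁻¹ q̄)`, where the dots stand for the additivity of lengths. -/
def Coset.IsReduced (p : Coset I J) (q : Coset J K) : Prop :=
  (cs.length ((p.max * J.longest⁻¹) * q.max) =
      cs.length (p.max * J.longest⁻¹) + cs.length q.max ∧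
    (p.max * J.longest⁻¹) * q.max = starMul cs p.max q.max) ∧
  (cs.length (p.max * (J.longest⁻¹ * q.max)) =
      cs.length p.max + cs.length (J.longest⁻¹ * q.max) ∧
    starMul cs p.max q.max = p.max * (J.longest⁻¹ * q.max))

lemma Finitary.longest_mem (I : Finitary cs) : I.longest ∈ I.group := I.exists_longest.choose_spec.1

lemma Coset.max_mem (p : Coset I J) : coset I J p.max = p := p.exists_max.choose_spec.1

lemma Coset.length_le_max (p : Coset I J) {w : W} (h : coset I J w = p) :
    cs.length w ≤ cs.length p.max := p.exists_max.choose_spec.2 w h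

lemma simple_mem {i : B} (hi : i ∈ I.carrier) : cs.simple i ∈ I.group :=
  Subgroup.subset_closure ⟨i, hi, rfl⟩

variable (I J) in
/-- All elements of `I` are left descents and all elements of `J` are right descents of `z`. -/
def FullDescents (z : W) : Prop :=
  (∀ i ∈ I.carrier, cs.length (cs.simple i * z) < cs.length z) ∧
    ∀ j ∈ J.carrier, cs.length (z * cs.simple j) < cs.length z

lemma Coset.fullDescents_max (p : Coset I J) : FullDescents I J p.max := by
  constructor
  · intro i hi
    have h : coset I J (cs.simple i * p.max) = p := by
      rw [← p.max_mem.trans rfl, p.max_mem, eq_comm]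
      exact p.max_mem.symm.trans (coset_eq.2 ⟨_, simple_mem hi, 1, one_mem _, by simp⟩)
    have := p.length_le_max h
    have := cs.length_simple_mul_ne p.max i
    omega
  · intro i hi
    have h : coset I J (p.max * cs.simple i) = p := by
      rw [eq_comm]
      exact p.max_mem.symm.trans (coset_eq.2 ⟨1, one_mem _, _, simple_mem hi, by simp⟩)
    have := p.length_le_max h
    have := cs.length_mul_simple_ne p.max i
    omega

lemma FullDescents.bruhat {z : W} (hz : FullDescents I J z) {a b x : W} (ha : a ∈ I.group)
    (hb : b ∈ J.group) (hx : Bruhat cs x z) : Bruhat cs (a * x * b) z := by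
  have h1 : Bruhat cs (a * x) z := by
    refine Subgroup.closure_induction_left (p := fun a _ => Bruhat cs (a * x) z) (by simpa)
      ?_ ?_ ha
    · rintro _ ⟨i, hi, rfl⟩ y _ hy
      rw [mul_assoc]; exact hy.simple_mul (hz.1 i hi)
    · rintro _ ⟨i, hi, rfl⟩ y _ hy
      rw [mul_assoc, inv_simple]; exact hy.simple_mul (hz.1 i hi)
  refine Subgroup.closure_induction_right (p := fun b _ => Bruhat cs (a * x * b) z) (by simpa)
      ?_ ?_ hb
  · rintro y _ _ ⟨i, hi, rfl⟩ hy
    rw [← mul_assoc]; exact hy.mul_simple (hz.2 i hi)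
  · rintro y _ _ ⟨i, hi, rfl⟩ hy
    rw [← mul_assoc, inv_simple]; exact hy.mul_simple (hz.2 i hi)

lemma FullDescents.max_eq {z : W} (hz : FullDescents I J z) : (coset I J z).max = z := by
  obtain ⟨a, ha, b, hb, h⟩ := coset_eq.1 (coset I J z).max_mem.symm
  refine Bruhat.eq_of_length ?_ ((coset I J z).length_le_max rfl)
  rw [h]
  exact hz.bruhat ha hb .refl

/-- If `y` has all elements of `J` as left descents, then `y = u . (u⁻¹ y)` for all `u ∈ W_J`. -/
lemma length_inv_mul_add {y : W} (hy : ∀ j ∈ J.carrier, cs.length (cs.simple j * y) < cs.length y)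
    {u : W} (hu : u ∈ J.group) : cs.length (u⁻¹ * y) + cs.length u = cs.length y := by
  classical
  have key : ∀ v ∈ J.group, ∀ j ∈ J.carrier, cs.length (v⁻¹ * y) + cs.length v = cs.length y →
      cs.length ((v * cs.simple j)⁻¹ * y) + cs.length (v * cs.simple j) = cs.length y := by
    intro v hv j hj ih
    set t := v * cs.simple j * v⁻¹ with ht
    have htr : cs.IsReflection t := ⟨v, j, rfl⟩
    have hty : invParity cs y t = 1 := by
      rw [← length_lt_iff cs htr]
      have h1 : Bruhat cs (t * y * 1) y := by
        refine FullDescents.bruhat (I := J) (J := ⟨∅, ?_⟩) ⟨hy, by simp⟩ ?_ (one_mem _) .refl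
        · simp only [parabolic, Set.image_empty, Subgroup.closure_empty]; infer_instance
        · exact mul_mem (mul_mem hv (simple_mem hj)) (inv_mem hv)
      have h2 := h1.length_le
      rw [mul_one] at h2
      have := htr.length_mul_right_ne y
      omega
    have e1 : invParity cs (v⁻¹ * y) (cs.simple j) = invParity cs v⁻¹ (cs.simple j) + 1 := by
      rw [invParity_mul, ← hty, ht, inv_inv]
    have e2 := length_lt_iff cs (w := v⁻¹ * y) (cs.isReflection_simple j)
    have e3 := length_lt_iff cs (w := v⁻¹) (cs.isReflection_simple j)
    have e4 : cs.length (v * cs.simple j) = cs.length (cs.simple j * v⁻¹) := by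
      rw [← cs.length_inv]; simp
    have e5 : (v * cs.simple j)⁻¹ * y = cs.simple j * (v⁻¹ * y) := by
      simp [mul_assoc]
    have e6 := cs.length_inv v
    have e7 := cs.length_simple_mul (v⁻¹) j
    have e8 := cs.length_simple_mul (v⁻¹ * y) j
    rw [e4, e5]
    rw [e1] at e2
    generalize invParity cs v⁻¹ (cs.simple j) = a at e2 e3
    have : a + 1 = 1 ↔ ¬ a = 1 := by clear e2 e3; revert a; decide
    rw [this, ← e3] at e2
    omega
  refine Subgroup.closure_induction_right
    (p := fun u _ => cs.length (u⁻¹ * y) + cs.length u = cs.length y) (by simp) ?_ ?_ hu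
  · rintro v hv _ ⟨j, hj, rfl⟩ ih
    exact key v hv j hj ih
  · rintro v hv _ ⟨j, hj, rfl⟩ ih
    rw [inv_simple]
    exact key v hv j hj ih

lemma length_mul_inv_add {y : W} (hy : ∀ j ∈ J.carrier, cs.length (y * cs.simple j) < cs.length y)
    {u : W} (hu : u ∈ J.group) : cs.length (y * u⁻¹) + cs.length u = cs.length y := by
  have := length_inv_mul_add (J := J) (y := y⁻¹) (cs := cs) (fun j hj => by
    have := hy j hj
    rw [← cs.length_inv, ← cs.length_inv y⁻¹]; simpa using this) (inv_mem hu)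
  rw [← cs.length_inv, cs.length_inv u, cs.length_inv y] at this
  simpa using this

lemma Coset.length_longest_inv_mul_max (q : Coset J K) :
    cs.length (J.longest⁻¹ * q.max) + cs.length J.longest = cs.length q.max :=
  length_inv_mul_add q.fullDescents_max.1 J.longest_mem

lemma Coset.length_max_mul_longest_inv (p : Coset I J) :
    cs.length (p.max * J.longest⁻¹) + cs.length J.longest = cs.length p.max :=
  length_mul_inv_add p.fullDescents_max.2 J.longest_mem

/-- The composition is reduced as soon as the lengths add up. -/
lemma Coset.isReduced_iff (p : Coset I J) (q : Coset J K) :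
    p.IsReduced q ↔ cs.length (p.max * J.longest⁻¹ * q.max) + cs.length J.longest =
      cs.length p.max + cs.length q.max := by
  have h1 := q.length_longest_inv_mul_max
  have h2 := p.length_max_mul_longest_inv
  constructor
  · rintro ⟨⟨h, _⟩, _⟩
    omega
  · intro h
    have h3 : starMul cs p.max q.max = p.max * (J.longest⁻¹ * q.max) := by
      refine star_eq_of ?_ ?_
      · have := q.fullDescents_max.bruhat (inv_mem J.longest_mem) (one_mem _) .refl
        simpa using this
      · intro v hv
        have h4 : Bruhat cs (J.longest * v) q.max := by
          have := q.fullDescents_max.bruhat J.longest_mem (one_mem _) hv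
          simpa using this
        have h5 : cs.length (p.max * J.longest⁻¹ * q.max) =
          cs.length (p.max * J.longest⁻¹) + cs.length q.max := by omega
        have h6 := (star_max (cs := cs) (p.max * J.longest⁻¹) q.max).2 _ h4
        rw [star_eq_mul h5] at h6
        simpa [mul_assoc] using h6
    refine ⟨⟨by omega, by rw [h3, mul_assoc]⟩, ?_, h3⟩
    rw [← mul_assoc]
    omega

lemma Coset.max_star {p : Coset I J} {q : Coset J K} (h : p.IsReduced q) :
    (p.star q).max = p.max * J.longest⁻¹ * q.max := by
  rw [Coset.star, ← h.1.2]
  have h0 := h.1.1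
  have h0' := h.2.1
  apply FullDescents.max_eq
  constructor
  · intro i hi
    have h1 := p.fullDescents_max.1 i hi
    have h2 := cs.length_mul_le (cs.simple i * p.max) (J.longest⁻¹ * q.max)
    have e : cs.simple i * p.max * (J.longest⁻¹ * q.max) =
      cs.simple i * (p.max * J.longest⁻¹ * q.max) := by group
    have e' : p.max * J.longest⁻¹ * q.max = p.max * (J.longest⁻¹ * q.max) := by group
    rw [e] at h2
    rw [← e'] at h0'
    omega
  · intro i hi
    have h1 := q.fullDescents_max.2 i hi
    have h2 := cs.length_mul_le (p.max * J.longest⁻¹) (q.max * cs.simple i)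
    rw [← mul_assoc] at h2
    omega

lemma Coset.length_max_star {p : Coset I J} {q : Coset J K} (h : p.IsReduced q) :
    cs.length (p.star q).max + cs.length J.longest = cs.length p.max + cs.length q.max := by
  rw [Coset.max_star h, (Coset.isReduced_iff p q).1 h]

lemma Coset.star_eq {p : Coset I J} {q : Coset J K} (h : p.IsReduced q) :
    p.star q = coset I K (p.max * J.longest⁻¹ * q.max) := by
  rw [← Coset.max_star h, Coset.max_mem]

lemma Coset.isReduced_assoc (p : Coset I J) (q : Coset J K) (r : Coset K L) :
    (p.IsReduced q ∧ (p.star q).IsReduced r) ↔ (q.IsReduced r ∧ p.IsReduced (q.star r)) := by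
  have hp := p.length_max_mul_longest_inv
  have hr := r.length_longest_inv_mul_max
  constructor
  · rintro ⟨h1, h2⟩
    have h3 := (Coset.isReduced_iff _ _).1 h1
    have h4 := (Coset.isReduced_iff _ _).1 h2
    rw [Coset.max_star h1] at h4
    have h5 : q.IsReduced r := by
      rw [Coset.isReduced_iff]
      have a := cs.length_mul_le (p.max * J.longest⁻¹) (q.max * K.longest⁻¹ * r.max)
      have b := cs.length_mul_le q.max (K.longest⁻¹ * r.max)
      simp only [← mul_assoc] at a b h4
      omega
    refine ⟨h5, ?_⟩
    have h6 := (Coset.isReduced_iff _ _).1 h5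
    rw [Coset.isReduced_iff, Coset.max_star h5]
    simp only [← mul_assoc] at h4 h6 ⊢
    omega
  · rintro ⟨h1, h2⟩
    have h3 := (Coset.isReduced_iff _ _).1 h1
    have h4 := (Coset.isReduced_iff _ _).1 h2
    rw [Coset.max_star h1] at h4
    have h5 : p.IsReduced q := by
      rw [Coset.isReduced_iff]
      have a := cs.length_mul_le (p.max * J.longest⁻¹ * q.max) (K.longest⁻¹ * r.max)
      have b := cs.length_mul_le (p.max * J.longest⁻¹) q.max
      simp only [← mul_assoc] at a b h4
      omega
    refine ⟨h5, ?_⟩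
    have h6 := (Coset.isReduced_iff _ _).1 h5
    rw [Coset.isReduced_iff, Coset.max_star h5]
    simp only [← mul_assoc] at h4 h6 ⊢
    omega

lemma Coset.star_assoc {p : Coset I J} {q : Coset J K} {r : Coset K L} (h1 : p.IsReduced q)
    (h2 : (p.star q).IsReduced r) : (p.star q).star r = p.star (q.star r) := by
  obtain ⟨h3, h4⟩ := (Coset.isReduced_assoc p q r).1 ⟨h1, h2⟩
  rw [Coset.star_eq h2, Coset.star_eq h4, Coset.max_star h1, Coset.max_star h3]
  simp only [mul_assoc]

variable (I) in
/-- The identity coset `W_I`. -/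
abbrev Coset.id : Coset I I := coset I I 1

lemma Coset.max_id : (Coset.id I).max = I.longest := by
  have h1 : coset I I I.longest = Coset.id I :=
    (coset_eq.2 ⟨I.longest, I.longest_mem, 1, one_mem _, by simp⟩).symm
  rw [← h1]
  have : ∀ i ∈ I.carrier, ∀ a b : W, a ∈ I.group → b ∈ I.group →
    cs.length (a * I.longest * b) ≤ cs.length I.longest := fun i _ a b ha hb =>
      I.exists_longest.choose_spec.2 _ (mul_mem (mul_mem ha I.longest_mem) hb)
  apply FullDescents.max_eq
  constructor
  · intro i hi
    have a := this i hi _ _ (simple_mem hi) (one_mem _)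
    rw [mul_one] at a
    have := cs.length_simple_mul_ne I.longest i
    omega
  · intro i hi
    have a := this i hi _ _ (one_mem _) (simple_mem hi)
    rw [one_mul] at a
    have := cs.length_mul_simple_ne I.longest i
    omega

lemma Coset.id_isReduced (q : Coset J K) : (Coset.id J).IsReduced q := by
  rw [Coset.isReduced_iff, Coset.max_id]; simp [add_comm]

lemma Coset.isReduced_id (p : Coset I J) : p.IsReduced (Coset.id J) := by
  rw [Coset.isReduced_iff, Coset.max_id]; simp

lemma Coset.id_star (q : Coset J K) : (Coset.id J).star q = q := by
  rw [Coset.star_eq q.id_isReduced, Coset.max_id]; simpa using q.max_mem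

lemma Coset.star_id (p : Coset I J) : p.star (Coset.id J) = p := by
  rw [Coset.star_eq p.isReduced_id, Coset.max_id]; simpa using p.max_mem


/-- The left redundancy `I ∩ p̲ J p̲⁻¹` of an `(I, J)`-coset, where `p̲` is its minimal element. -/
def Coset.leftRed (p : Coset I J) : Set B :=
  {i | i ∈ I.carrier ∧ ∃ j ∈ J.carrier, cs.simple i = p.min * cs.simple j * p.min⁻¹}

/-- The right redundancy `p̲⁻¹ I p̲ ∩ J` of an `(I, J)`-coset. -/
def Coset.rightRed (p : Coset I J) : Set B :=
  {j | j ∈ J.carrier ∧ ∃ i ∈ I.carrier, cs.simple j = p.min⁻¹ * cs.simple i * p.min}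

/-- Core cosets. -/
def Coset.IsCore (p : Coset I J) : Prop := p.leftRed = I.carrier ∧ p.rightRed = J.carrier

/-- `[I, M, J]`, where `I ⊆ M ⊇ J`, is a reduced expression for `p`: the cosets `[I, M]` and
`[M, J]` of the identity have a reduced composition, equal to `p`. -/
def Coset.HasReducedExpr (p : Coset I J) (M : Finitary cs) : Prop :=
  (I.carrier ⊆ M.carrier ∧ J.carrier ⊆ M.carrier) ∧
    (coset I M 1).IsReduced (coset M J 1) ∧ (coset I M 1).star (coset M J 1) = p

/-- Atomic cosets: core cosets with a reduced expression of the form `[I + s - t]`, that is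
`[I, M, J]` with `M = I ∪ {s} = J ∪ {t}`, `s ∉ I` and `t ∉ J`. -/
def Coset.IsAtomic (p : Coset I J) : Prop :=
  p.IsCore ∧ ∃ (s t : B) (M : Finitary cs), s ∉ I.carrier ∧ t ∉ J.carrier ∧
    M.carrier = insert s I.carrier ∧ M.carrier = insert t J.carrier ∧ p.HasReducedExpr M

end Coxeter

/-! ### The nilCoxeter algebroid and its atomic subcategory -/

section Algebroid

open CategoryTheory

variable {B W : Type*} [Group W] {M : CoxeterMatrix B} (cs : CoxeterSystem M W)

/-- The objects of the nilCoxeter algebroid `D(W, S)`: the finitary subsets of `S`. -/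
def NilD := Finitary cs

variable {cs}

section

variable {I J K L : Finitary cs}

open Classical in
/-- The product of two basis elements: `∂_p ∘ ∂_q = ∂_{p * q}` if `p * q` is reduced, and
`∂_p ∘ ∂_q = 0` otherwise. -/
noncomputable def basisMul (p : Coset I J) (q : Coset J K) : Coset I K →₀ ℤ :=
  if p.IsReduced q then Finsupp.single (p.star q) 1 else 0

variable (I J K) in
/-- The bilinear extension of `basisMul`. -/
noncomputable def mulLin :
    (Coset I J →₀ ℤ) →ₗ[ℤ] (Coset J K →₀ ℤ) →ₗ[ℤ] (Coset I K →₀ ℤ) :=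
  Finsupp.linearCombination ℤ fun p => Finsupp.linearCombination ℤ fun q => basisMul p q

lemma mulLin_single (p : Coset I J) (q : Coset J K) (a b : ℤ) :
    mulLin I J K (Finsupp.single p a) (Finsupp.single q b) = (a * b) • basisMul p q := by
  simp [mulLin, mul_smul]

lemma mulLin_assoc (f : Coset I J →₀ ℤ) (g : Coset J K →₀ ℤ) (h : Coset K L →₀ ℤ) :
    mulLin I K L (mulLin I J K f g) h = mulLin I J L f (mulLin J K L g h) := by
  induction f using Finsupp.induction_linear with
  | zero => simp
  | add f f' hf hf' => simp only [map_add, LinearMap.add_apply, hf, hf']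
  | single p a =>
  induction g using Finsupp.induction_linear with
  | zero => simp
  | add f f' hf hf' => simp only [map_add, LinearMap.add_apply, hf, hf']
  | single q b =>
  induction h using Finsupp.induction_linear with
  | zero => simp
  | add f f' hf hf' => simp only [map_add, hf, hf']
  | single r c =>
    rw [mulLin_single, mulLin_single, map_smul, LinearMap.smul_apply, map_smul]
    have key : mulLin I K L (basisMul p q) (Finsupp.single r 1) =
        mulLin I J L (Finsupp.single p 1) (basisMul q r) := by
      have h0 := Coset.isReduced_assoc p q r
      by_cases h1 : p.IsReduced q <;> by_cases h2 : q.IsReduced r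
      · simp only [basisMul, if_pos h1, if_pos h2, mulLin_single]
        by_cases h3 : (p.star q).IsReduced r
        · rw [if_pos h3, if_pos (h0.1 ⟨h1, h3⟩).2, Coset.star_assoc h1 h3]
        · rw [if_neg h3, if_neg (fun h => h3 (h0.2 ⟨h2, h⟩).2)]
      · simp only [basisMul, if_pos h1, if_neg h2, map_zero]
        rw [mulLin_single, basisMul, if_neg, smul_zero]
        exact fun h => h2 (h0.1 ⟨h1, h⟩).1
      · simp only [basisMul, if_neg h1, if_pos h2, map_zero, LinearMap.zero_apply]
        rw [mulLin_single, basisMul, if_neg, smul_zero]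
        exact fun h => h1 (h0.2 ⟨h2, h⟩).1
      · simp only [basisMul, if_neg h1, if_neg h2, map_zero, LinearMap.zero_apply]
    have e1 : (Finsupp.single r c : Coset K L →₀ ℤ) = c • Finsupp.single r 1 := by simp
    have e2 : (Finsupp.single p a : Coset I J →₀ ℤ) = a • Finsupp.single p 1 := by simp
    rw [e1, e2, map_smul, key, map_smul, LinearMap.smul_apply, smul_smul, smul_smul]
    congr 1
    ring

lemma id_mulLin (f : Coset I J →₀ ℤ) :
    mulLin I I J (Finsupp.single (Coset.id I) 1) f = f := by
  induction f using Finsupp.induction_linear with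
  | zero => simp
  | add f f' hf hf' => simp only [map_add, hf, hf']
  | single p a =>
    rw [mulLin_single, basisMul, if_pos p.id_isReduced, p.id_star]
    simp

lemma mulLin_id (f : Coset I J →₀ ℤ) :
    mulLin I J J f (Finsupp.single (Coset.id J) 1) = f := by
  induction f using Finsupp.induction_linear with
  | zero => simp
  | add f f' hf hf' => simp only [map_add, LinearMap.add_apply, hf, hf']
  | single p a =>
    rw [mulLin_single, basisMul, if_pos p.isReduced_id, p.star_id]
    simp

end

/-- The nilCoxeter algebroid `D(W, S)`. The morphisms from `J` to `I` form the free `ℤ`-module on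
the `(I, J)`-cosets; `f ≫ g` is the composition `g ∘ f`. -/
noncomputable instance : Category (NilD cs) where
  Hom J I := Coset (cs := cs) I J →₀ ℤ
  id I := Finsupp.single (Coset.id I) 1
  comp {K J I} f g := mulLin I J K g f
  id_comp _ := mulLin_id _
  comp_id _ := id_mulLin _
  assoc f g h := (mulLin_assoc h g f).symm

noncomputable instance : Preadditive (NilD cs) where
  homGroup J I := inferInstanceAs (AddCommGroup (Coset (cs := cs) I J →₀ ℤ))
  add_comp K J I f f' g := ((mulLin (cs := cs) I J K g).map_add f f' :)
  comp_add K J I f g g' := (LinearMap.congr_fun ((mulLin (cs := cs) I J K).map_add g g') f :)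

/-- The basis morphism `∂_p : J ⟶ I` of an `(I, J)`-coset `p`. -/
noncomputable def NilD.basis {I J : Finitary cs} (p : Coset I J) :
    (show NilD cs from J) ⟶ (show NilD cs from I) :=
  (Finsupp.single p 1 : Coset I J →₀ ℤ)

/-- The morphisms of the (non-full) `ℤ`-linear subcategory of `D(W, S)` generated by `∂_p` for
atomic cosets `p`. -/
inductive InAD : ∀ {J I : NilD cs}, (J ⟶ I) → Prop
  | atomic {I J : Finitary cs} (p : Coset I J) (hp : p.IsAtomic) : InAD (NilD.basis p)
  | id (I : NilD cs) : InAD (𝟙 I)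
  | comp {K J I : NilD cs} (f : K ⟶ J) (g : J ⟶ I) (hf : InAD f) (hg : InAD g) : InAD (f ≫ g)
  | zero (J I : NilD cs) : InAD (0 : J ⟶ I)
  | add {J I : NilD cs} (f g : J ⟶ I) (hf : InAD f) (hg : InAD g) : InAD (f + g)
  | neg {J I : NilD cs} (f : J ⟶ I) (hf : InAD f) : InAD (-f)

/-- The morphisms from `J` to `I` in the atomic subcategory. -/
def adHom (J I : NilD cs) : AddSubgroup (J ⟶ I) where
  carrier := {f | InAD f}
  zero_mem' := .zero _ _
  add_mem' hf hg := .add _ _ hf hg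
  neg_mem' hf := .neg _ hf

variable (cs) in
/-- The objects of the atomic subcategory `AD(W, S)` of `D(W, S)`: all finitary subsets of `S`. -/
@[ext]
structure AD where
  subset : Finitary cs

/-- The atomic subcategory `AD(W, S)` of `D(W, S)`. -/
noncomputable instance : Category (AD cs) where
  Hom J I := adHom (cs := cs) J.subset I.subset
  id I := ⟨𝟙 (show NilD cs from I.subset), .id _⟩
  comp f g := ⟨f.1 ≫ g.1, .comp _ _ f.2 g.2⟩
  id_comp f := Subtype.ext (Category.id_comp f.1)
  comp_id f := Subtype.ext (Category.comp_id f.1)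
  assoc f g h := Subtype.ext (Category.assoc f.1 g.1 h.1)

noncomputable instance : Preadditive (AD cs) where
  homGroup J I := inferInstanceAs (AddCommGroup (adHom (cs := cs) J.subset I.subset))
  add_comp _ _ _ f f' g := Subtype.ext (Preadditive.add_comp _ _ _ f.1 f'.1 g.1)
  comp_add _ _ _ f g g' := Subtype.ext (Preadditive.comp_add _ _ _ f.1 g.1 g'.1)

/-- The morphism `∂_p` of `AD(W, S)`, for an atomic coset `p`. -/
noncomputable def AD.ofAtomic {J I : AD cs} (p : Coset I.subset J.subset) (hp : p.IsAtomic) :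
    J ⟶ I :=
  (⟨NilD.basis p, .atomic p hp⟩ : adHom (cs := cs) J.subset I.subset)

end Algebroid

/-! ### The labeled nilCoxeter algebroid of type `B` -/

section TypeB

open CategoryTheory

/-- The Coxeter matrix of type `B_n` with the simple reflections `s_0, …, s_{n-1}` numbered such
that `m_{s_0 s_1} = 4` (Mathlib puts the bond of order `4` at the other end of the diagram). -/
abbrev typeB (n : ℕ) : CoxeterMatrix (Fin n) := (CoxeterMatrix.B n).reindex Fin.revPerm

lemma typeB_apply (n : ℕ) (i j : Fin n) : typeB n i j =
    if i = j then 1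
    else if ((i : ℕ) = 0 ∧ (j : ℕ) = 1) ∨ ((i : ℕ) = 1 ∧ (j : ℕ) = 0) then 4
    else if (i : ℕ) + 1 = j ∨ (j : ℕ) + 1 = i then 3 else 2 := by
  obtain ⟨i, hi⟩ := i
  obtain ⟨j, hj⟩ := j
  simp only [CoxeterMatrix.reindex_apply, CoxeterMatrix.B, Matrix.of_apply, Fin.revPerm_symm,
    Fin.revPerm_apply, Fin.rev_inj, Fin.val_rev, Fin.mk.injEq]
  repeat' split_ifs
  all_goals first | rfl | omega

/-- Exchange the entries number `i` and `i + 1` (counted from `0`) of a list. -/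
def swapAdj : ℕ → List ℕ → List ℕ
  | 0, a :: b :: l => b :: a :: l
  | i + 1, a :: l => a :: swapAdj i l
  | _, l => l

lemma swapAdj_perm (i : ℕ) (l : List ℕ) : (swapAdj i l).Perm l := by
  induction l generalizing i with
  | nil => cases i <;> simp [swapAdj]
  | cons a l ih =>
    cases i with
    | zero =>
      cases l with
      | nil => simp [swapAdj]
      | cons b l => exact List.Perm.swap _ _ _
    | succ i => exact (ih i).cons a

/-- The sequences `(n_0, n_1, …, n_k)` of positive integers with sum `n + 1`. -/
@[ext]
structure LabelSeq (n : ℕ) where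
  seq : Composition (n + 1)

variable {n : ℕ}

/-- The target of the generator `∂_i`: the sequence itself for `i = 0`, and the sequence with `n_i`
and `n_{i+1}` exchanged for `i > 0`. -/
def LabelSeq.act (i : ℕ) (c : LabelSeq n) : LabelSeq n :=
  if i = 0 then c else
    ⟨{ blocks := swapAdj i c.seq.blocks
       blocks_pos := fun h => c.seq.blocks_pos ((swapAdj_perm _ _).mem_iff.1 h)
       blocks_sum := (swapAdj_perm _ _).sum_eq.trans c.seq.blocks_sum }⟩

/-- The parabolic subset `J ⊆ S` of a sequence `(n_0, …, n_k)`: cut `{0, …, n}` into consecutive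
blocks of sizes `n_0, …, n_k`; then `s_j ∈ J` if and only if `j` and `j + 1` are in the same
block. -/
def LabelSeq.parabolicSubset (c : LabelSeq n) : Set (Fin n) :=
  {j | c.seq.index j.castSucc = c.seq.index j.succ}

/-- The generating arrows `∂_i^J`, for `0 ≤ i ≤ k - 1`, where `k + 1` is the length of the
sequence `J`. -/
instance : Quiver (LabelSeq n) where
  Hom c d := {i : ℕ // i + 1 < c.seq.length ∧ d = c.act i}

/-- The free `ℤ`-linear category on the generating arrows. -/
abbrev FreeCat (n : ℕ) := Free ℤ (Paths (LabelSeq n))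

/-- A generating arrow as a morphism of the free `ℤ`-linear category. -/
noncomputable def FreeCat.gen {c d : LabelSeq n} (e : c ⟶ d) :
    (show FreeCat n from c) ⟶ (show FreeCat n from d) :=
  (Free.embedding ℤ (Paths (LabelSeq n))).map ((Paths.of (LabelSeq n)).map e)

/-- The index `i` of a generating arrow `∂_i`. -/
def LabelSeq.idx {c d : LabelSeq n} (e : c ⟶ d) : ℕ := e.1

open FreeCat LabelSeq in
/-- The congruence on the free `ℤ`-linear category generated by the defining relations of the
labeled nilCoxeter algebroid of type `B`. In a composition `e₁ ≫ e₂` the arrow `e₁` is applied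
first. -/
inductive NilRel : HomRel (FreeCat n)
  /-- `∂_0 ∂_1 ∂_0 ∂_1 = ∂_1 ∂_0 ∂_1 ∂_0` -/
  | four {a b₁ b₂ b₃ c₁ c₂ c₃ d : LabelSeq n}
      (e₁ : a ⟶ b₁) (e₂ : b₁ ⟶ b₂) (e₃ : b₂ ⟶ b₃) (e₄ : b₃ ⟶ d)
      (f₁ : a ⟶ c₁) (f₂ : c₁ ⟶ c₂) (f₃ : c₂ ⟶ c₃) (f₄ : c₃ ⟶ d)
      (he : idx e₁ = 1 ∧ idx e₂ = 0 ∧ idx e₃ = 1 ∧ idx e₄ = 0)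
      (hf : idx f₁ = 0 ∧ idx f₂ = 1 ∧ idx f₃ = 0 ∧ idx f₄ = 1) :
      NilRel (gen e₁ ≫ gen e₂ ≫ gen e₃ ≫ gen e₄) (gen f₁ ≫ gen f₂ ≫ gen f₃ ≫ gen f₄)
  /-- `∂_i ∂_{i+1} ∂_i = ∂_{i+1} ∂_i ∂_{i+1}` for `i ≥ 1` -/
  | braid {a b₁ b₂ c₁ c₂ d : LabelSeq n} (i : ℕ) (hi : 1 ≤ i)
      (e₁ : a ⟶ b₁) (e₂ : b₁ ⟶ b₂) (e₃ : b₂ ⟶ d) (f₁ : a ⟶ c₁) (f₂ : c₁ ⟶ c₂) (f₃ : c₂ ⟶ d)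
      (he : idx e₁ = i ∧ idx e₂ = i + 1 ∧ idx e₃ = i)
      (hf : idx f₁ = i + 1 ∧ idx f₂ = i ∧ idx f₃ = i + 1) :
      NilRel (gen e₁ ≫ gen e₂ ≫ gen e₃) (gen f₁ ≫ gen f₂ ≫ gen f₃)
  /-- `∂_i ∂_j = ∂_j ∂_i` for `|i - j| > 1` -/
  | comm {a b c d : LabelSeq n} (i j : ℕ) (hij : i + 1 < j ∨ j + 1 < i)
      (e₁ : a ⟶ b) (e₂ : b ⟶ d) (f₁ : a ⟶ c) (f₂ : c ⟶ d)
      (he : idx e₁ = j ∧ idx e₂ = i) (hf : idx f₁ = i ∧ idx f₂ = j) :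
      NilRel (gen e₁ ≫ gen e₂) (gen f₁ ≫ gen f₂)
  /-- `∂_i ∂_i = 0` -/
  | nil {a b c : LabelSeq n} (e₁ : a ⟶ b) (e₂ : b ⟶ c) (h : idx e₁ = idx e₂) :
      NilRel (gen e₁ ≫ gen e₂) 0
  | refl {X Y : FreeCat n} (f : X ⟶ Y) : NilRel f f
  | symm {X Y : FreeCat n} (f g : X ⟶ Y) (h : NilRel f g) : NilRel g f
  | trans {X Y : FreeCat n} (f g h : X ⟶ Y) (h₁ : NilRel f g) (h₂ : NilRel g h) : NilRel f h
  | comp_left {X Y Z : FreeCat n} (f : X ⟶ Y) (g g' : Y ⟶ Z) (h : NilRel g g') :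
      NilRel (f ≫ g) (f ≫ g')
  | comp_right {X Y Z : FreeCat n} (f f' : X ⟶ Y) (g : Y ⟶ Z) (h : NilRel f f') :
      NilRel (f ≫ g) (f' ≫ g)
  | add {X Y : FreeCat n} (f f' g g' : X ⟶ Y) (h₁ : NilRel f f') (h₂ : NilRel g g') :
      NilRel (f + g) (f' + g')

instance : Congruence (NilRel (n := n)) where
  equivalence := ⟨.refl, fun h => .symm _ _ h, fun h h' => .trans _ _ _ h h'⟩
  comp_left f _ _ h := .comp_left f _ _ h
  comp_right g h := .comp_right _ _ g h

/-- The labeled nilCoxeter algebroid of type `B`: the `ℤ`-linear category presented by the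
generating arrows and the relations above. -/
abbrev NilCoxB (n : ℕ) := CategoryTheory.Quotient (NilRel (n := n))

noncomputable instance : Preadditive (NilCoxB n) :=
  Quotient.preadditive _ fun _ _ _ _ _ _ h h' => .add _ _ _ _ h h'

/-- A sequence as an object of the labeled nilCoxeter algebroid. -/
def NilCoxB.of (c : LabelSeq n) : NilCoxB n := ⟨c⟩

/-- The generator `∂_i^J`, for `J` the sequence `c`. -/
noncomputable def NilCoxB.gen (c : LabelSeq n) (i : ℕ) (hi : i + 1 < c.seq.length) :
    NilCoxB.of c ⟶ NilCoxB.of (c.act i) :=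
  (Quotient.functor NilRel).map (FreeCat.gen (show c ⟶ c.act i from ⟨i, hi, rfl⟩))

variable {W : Type*} [Group W] {cs : CoxeterSystem (typeB n) W}

/-- The `(I, J)`-coset `p` is the atomic coset `a_i^J`: if `s` is the element number `i` of `S ∖ J`
(counted from `0` in increasing order), `M = J ∪ {s}` and `t = w_M s w_M`, then `I = M ∖ {t}`, and
`p` is atomic with the reduced expression `[I, M, J]`. -/
def IsAtomicAt {I J : Finitary cs} (i : ℕ) (p : Coset I J) : Prop :=
  p.IsAtomic ∧ ∃ (s t : Fin n) (M : Finitary cs),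
    s ∉ J.carrier ∧ {j | j ∉ J.carrier ∧ j < s}.ncard = i ∧
    M.carrier = insert s J.carrier ∧ cs.simple t = M.longest * cs.simple s * M.longest ∧
    I.carrier = M.carrier \ {t} ∧ p.HasReducedExpr M

end TypeB
end CoxeterB

open CategoryTheory CoxeterB

namespace CoxeterB

section CoreElements

variable {B W : Type*} [Group W] {M : CoxeterMatrix B} {cs : CoxeterSystem M W}

/-! ### Parabolic subgroups and minimal coset representatives -/

/-! The proof replaces core cosets by group elements. A coset is core exactly when its shortest
element `w` has no right descent in `J` and conjugates `J` bijectively onto `I`. Then `w w_J = w_I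
w` is the longest element of the coset, so `w` determines the coset and conversely. The composition
of two core cosets is reduced if and only if the lengths of their elements add
(`IsCoreElt.isReduced_coset_iff`). Core elements form a groupoid under multiplication, and the
atomic ones are `w_M w_J` with `M = J ∪ {s}`. The atomic category is therefore a nilCoxeter version
of this groupoid, and the claim says that the groupoid behaves like a Coxeter system of type `B_k`.

The relations hold because of an explicit model. `W` acts faithfully on `ℤ` by signed permutations,
and descents can be read off this action (`descent_iff`). With `{0, …, n}` cut into blocks, the
atomic element of index `i > 0` exchanges two adjacent blocks by translations, and that of index `0`
translates block `1` onto its opposite. The commutation, braid and four-term relations become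
identities between piecewise translations (`blockSwap_comm`, `blockNeg_comm`, `blockSwap_braid`,
`block_four`). Both sides are also checked to be reduced, which is what makes them agree after
linearization. Two equal consecutive indices give mutually inverse elements, hence a non-reduced
composition.

There are no further relations because Matsumoto's theorem holds for paths
(`pathMor_eq_of_pathElt_eq`). A core element with a right descent outside `J` splits off the
corresponding atomic element with additive lengths (`IsCoreElt.exists_atomic`), so every core
element has a reduced path. If two reduced paths of one element end in different arrows, the element
has two descents and is divisible by the longest core element of a rank-two parabolic subgroup
(`IsCoreElt.exists_of_two_descents`), whose two words are related by a defining relation. Induction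
on length finishes. The same factorization rewrites any non-reduced path so that an arrow meets its
inverse, so its morphism is zero (`pathMor_eq_zero`). Hence morphisms of reduced paths, one for each
core element, span the presented category. They are sent to distinct basis elements, which gives
faithfulness. Fullness holds since every atomic coset is the image of some arrow. -/

lemma simple_mem_parabolic {A : Set B} {i : B} (hi : i ∈ A) : cs.simple i ∈ parabolic cs A :=
  Subgroup.subset_closure ⟨i, hi, rfl⟩

lemma parabolic_mono {A A' : Set B} (h : A ⊆ A') : parabolic cs A ≤ parabolic cs A' :=
  Subgroup.closure_mono (Set.image_mono h)

/-- No element of `A` is a right descent of `w`. -/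
def NoDescent (cs : CoxeterSystem M W) (A : Set B) (w : W) : Prop :=
  ∀ j ∈ A, cs.length w < cs.length (w * cs.simple j)

lemma length_mul_simple_lt_or (w : W) (j : B) :
    cs.length (w * cs.simple j) < cs.length w ∨ cs.length w < cs.length (w * cs.simple j) := by
  have := cs.length_mul_simple_ne w j
  omega

lemma length_mul_simple_mul_lt {w : W} {j : B}
    (h : cs.length (w * cs.simple j) < cs.length w) (u : W) :
    cs.length (u * w * cs.simple j) < cs.length u + cs.length w := by
  have := cs.length_mul_le u (w * cs.simple j)
  rw [← mul_assoc] at this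
  omega

section Finite

variable [Finite W]

variable (cs) in
/-- For a finite Coxeter group, every subset of `S` is finitary. -/
def fin (A : Set B) : Finitary cs := ⟨A, inferInstance⟩

variable (cs) in
/-- The longest element of `W_A`. -/
noncomputable def wl (A : Set B) : W := (fin cs A).longest

lemma wl_mem (A : Set B) : wl cs A ∈ parabolic cs A := (fin cs A).longest_mem

lemma length_le_wl {A : Set B} {u : W} (hu : u ∈ parabolic cs A) :
    cs.length u ≤ cs.length (wl cs A) :=
  (fin cs A).exists_longest.choose_spec.2 u hu

lemma wl_mul_simple_lt {A : Set B} {j : B} (hj : j ∈ A) :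
    cs.length (wl cs A * cs.simple j) < cs.length (wl cs A) := by
  have := length_le_wl (mul_mem (wl_mem (cs := cs) A) (simple_mem_parabolic hj))
  have := cs.length_mul_simple_ne (wl cs A) j
  omega

lemma simple_mul_wl_lt {A : Set B} {j : B} (hj : j ∈ A) :
    cs.length (cs.simple j * wl cs A) < cs.length (wl cs A) := by
  have := length_le_wl (mul_mem (simple_mem_parabolic hj) (wl_mem (cs := cs) A))
  have := cs.length_simple_mul_ne (wl cs A) j
  omega

/-- If all elements of `A` are right descents of `y`, then `y = (y u⁻¹) . u` for `u ∈ W_A`. -/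
lemma length_mul_inv_add_of_descents {A : Set B} {y : W}
    (hy : ∀ j ∈ A, cs.length (y * cs.simple j) < cs.length y) {u : W} (hu : u ∈ parabolic cs A) :
    cs.length (y * u⁻¹) + cs.length u = cs.length y :=
  length_mul_inv_add (J := fin cs A) hy hu

lemma length_inv_mul_add_of_descents {A : Set B} {y : W}
    (hy : ∀ j ∈ A, cs.length (cs.simple j * y) < cs.length y) {u : W} (hu : u ∈ parabolic cs A) :
    cs.length (u⁻¹ * y) + cs.length u = cs.length y :=
  length_inv_mul_add (J := fin cs A) hy hu

/-- Having all of `A` as right descents makes `w_A` a right factor of `u` with additive lengths, and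
maximality of `w_A` leaves no length for the other factor. -/
lemma eq_wl {A : Set B} {u : W} (hu : u ∈ parabolic cs A)
    (h : ∀ j ∈ A, cs.length (u * cs.simple j) < cs.length u) : u = wl cs A := by
  have h1 := length_mul_inv_add_of_descents h (wl_mem A)
  have h2 := length_le_wl hu
  have h3 : cs.length (u * (wl cs A)⁻¹) = 0 := by omega
  rw [cs.length_eq_zero_iff] at h3
  exact mul_inv_eq_one.1 h3

lemma wl_inv (A : Set B) : (wl cs A)⁻¹ = wl cs A := by
  refine eq_wl (inv_mem (wl_mem A)) fun j hj => ?_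
  have := simple_mul_wl_lt (cs := cs) hj
  rw [← cs.length_inv] at this
  simpa using this

lemma wl_mul_wl (A : Set B) : wl cs A * wl cs A = 1 := by
  nth_rw 1 [← wl_inv]; simp

lemma wl_mul_wl_mul (A : Set B) (x : W) : wl cs A * (wl cs A * x) = x := by
  rw [← mul_assoc, wl_mul_wl, one_mul]

lemma length_wl_mul {A : Set B} {u : W} (hu : u ∈ parabolic cs A) :
    cs.length (wl cs A * u) + cs.length u = cs.length (wl cs A) := by
  have := length_mul_inv_add_of_descents (cs := cs) (fun j (hj : j ∈ A) => wl_mul_simple_lt hj)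
    (inv_mem hu)
  simpa using this

/-- If no element of `A` is a right descent of `w`, then the length is additive on `w W_A`. -/
lemma NoDescent.length_mul {A : Set B} {w : W} (hw : NoDescent cs A w) {u : W}
    (hu : u ∈ parabolic cs A) : cs.length (w * u) = cs.length w + cs.length u := by
  -- At a longest element `w u₀` of `w W_A` all of `A` are descents, so lengths subtract when
  -- elements of `W_A` are stripped off on the right. Comparing `x = 1` with `x = s_j` turns the
  -- hypothesis on `w` into left descents of `u₀`, and stripping `u` off `u₀` on the left gives the
  -- result.
  obtain ⟨u₀, hu₀, hmax⟩ := Set.exists_max_image (parabolic cs A : Set W)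
    (fun u => cs.length (w * u)) (Set.toFinite _) ⟨1, one_mem _⟩
  have hy : ∀ j ∈ A, cs.length (w * u₀ * cs.simple j) < cs.length (w * u₀) := by
    intro j hj
    have h1 := hmax _ (mul_mem hu₀ (simple_mem_parabolic hj))
    have h2 := cs.length_mul_simple_ne (w * u₀) j
    simp only [← mul_assoc] at h1
    omega
  have key : ∀ x ∈ parabolic cs A, cs.length (w * x) + cs.length (x⁻¹ * u₀) =
      cs.length (w * u₀) := by
    intro x hx
    have := length_mul_inv_add_of_descents hy (mul_mem (inv_mem hx) hu₀)
    rwa [show w * u₀ * (x⁻¹ * u₀)⁻¹ = w * x by group] at this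
  have h0 := key 1 (one_mem _)
  have hd : ∀ j ∈ A, cs.length (cs.simple j * u₀) < cs.length u₀ := by
    intro j hj
    have h1 := key _ (simple_mem_parabolic hj)
    have h2 := hw j hj
    simp only [mul_one, inv_one, one_mul, CoxeterSystem.inv_simple] at h0 h1
    omega
  have h1 := length_inv_mul_add_of_descents hd hu
  have h2 := key u hu
  simp only [mul_one, inv_one, one_mul] at h0
  omega

lemma NoDescent.mul_simple {A : Set B} {w : W} (hw : NoDescent cs A w) {u : W}
    (hu : u ∈ parabolic cs A) {j : B} (hj : j ∈ A) :
    cs.length (w * u * cs.simple j) < cs.length (w * u) ↔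
      cs.length (u * cs.simple j) < cs.length u := by
  rw [mul_assoc, hw.length_mul hu, hw.length_mul (mul_mem hu (simple_mem_parabolic hj))]
  omega

lemma exists_noDescent_mul (A : Set B) (w : W) :
    ∃ v u, NoDescent cs A v ∧ u ∈ parabolic cs A ∧ w = v * u := by
  obtain ⟨u, hu, hmin⟩ := Set.exists_min_image (parabolic cs A : Set W)
    (fun u => cs.length (w * u)) (Set.toFinite _) ⟨1, one_mem _⟩
  refine ⟨w * u, u⁻¹, fun j hj => ?_, inv_mem hu, by group⟩
  have h1 := hmin _ (mul_mem hu (simple_mem_parabolic hj))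
  have h2 := cs.length_mul_simple_ne (w * u) j
  simp only [← mul_assoc] at h1
  omega

/-- A simple reflection in `W_A` belongs to `A`. -/
lemma mem_of_simple_mem (hinj : Function.Injective cs.simple) {A : Set B} {i : B}
    (h : cs.simple i ∈ parabolic cs A) : i ∈ A := by
  by_contra hi
  have h1 : NoDescent cs A (cs.simple i) := by
    intro j hj
    rcases length_mul_simple_lt_or (cs := cs) (cs.simple i) j with h | h
    · rw [cs.length_simple, Nat.lt_one_iff, cs.length_eq_zero_iff] at h
      have : cs.simple i = cs.simple j := by
        have := congrArg (· * cs.simple j) h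
        simpa using this
      exact absurd (hinj this ▸ hj) hi
    · exact h
  -- Additivity is applied to `s_i` times itself, a product of length `0` instead of `2`.
  have := h1.length_mul h
  rw [cs.simple_mul_simple_self, cs.length_simple, cs.length_one] at this
  omega

/-- Conjugation by the longest element of `W_A` permutes `A`. -/
lemma exists_wl_conj (hinj : Function.Injective cs.simple) {A : Set B} {j : B} (hj : j ∈ A) :
    ∃ i ∈ A, wl cs A * cs.simple j = cs.simple i * wl cs A := by
  have h1 : wl cs A * (cs.simple j * wl cs A) ∈ parabolic cs A :=
    mul_mem (wl_mem A) (mul_mem (simple_mem_parabolic hj) (wl_mem A))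
  -- Left multiplication by `w_A` turns length `ℓ` into `ℓ(w_A) - ℓ`, and `s_j w_A` is just one
  -- shorter than `w_A`.
  have h2 : cs.length (wl cs A * (cs.simple j * wl cs A)) = 1 := by
    have h3 := length_wl_mul (cs := cs) (mul_mem (simple_mem_parabolic hj) (wl_mem A))
    have h4 := cs.length_simple_mul (wl cs A) j
    have h5 := simple_mul_wl_lt (cs := cs) hj
    omega
  obtain ⟨i, hi⟩ := cs.length_eq_one_iff.1 h2
  refine ⟨i, mem_of_simple_mem hinj (hi ▸ h1), ?_⟩
  rw [← hi, mul_assoc, mul_assoc, wl_mul_wl, mul_one]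

end Finite

/-! ### Core elements -/

/-- `w` has no right descents in `J`, and conjugation by `w` is a bijection from `J` to `I`. -/
structure IsCoreElt (cs : CoxeterSystem M W) (I J : Set B) (w : W) : Prop where
  noDescent : NoDescent cs J w
  left : ∀ j ∈ J, ∃ i ∈ I, w * cs.simple j = cs.simple i * w
  right : ∀ i ∈ I, ∃ j ∈ J, w * cs.simple j = cs.simple i * w

lemma isCoreElt_one (J : Set B) : IsCoreElt cs J J 1 :=
  ⟨fun j _ => by simp, fun j hj => ⟨j, hj, by simp⟩, fun j hj => ⟨j, hj, by simp⟩⟩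

lemma length_mul_simple_lt_iff_invParity (w : W) {t : W} (ht : cs.IsReflection t) :
    cs.length (w * t) < cs.length w ↔ invParity cs w⁻¹ t = 1 := by
  rw [← length_lt_iff cs ht, ← cs.length_inv (w * t), ← cs.length_inv w, mul_inv_rev, ht.inv]

namespace IsCoreElt

variable {I J K : Set B} {w w' : W}

/-- Inversion parity is a cocycle. Since `w'` conjugates `s_k` to `s_j`, the parity of `s_k` for `w
w'` is the sum of that of `s_k` for `w'` and that of `s_j` for `w`, both zero. No additivity of
lengths is needed, so core elements form a groupoid. -/
lemma mul (h : IsCoreElt cs I J w) (h' : IsCoreElt cs J K w') : IsCoreElt cs I K (w * w') where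
  noDescent k hk := by
    obtain ⟨j, hj, e⟩ := h'.left k hk
    have h1 := h'.noDescent k hk
    have h2 := h.noDescent j hj
    have h3 := length_mul_simple_lt_iff_invParity w' (cs.isReflection_simple k)
    have h4 := length_mul_simple_lt_iff_invParity w (cs.isReflection_simple j)
    have h5 := length_mul_simple_lt_iff_invParity (w * w') (cs.isReflection_simple k)
    rw [mul_inv_rev, invParity_mul, inv_inv, e, mul_inv_cancel_right] at h5
    rcases length_mul_simple_lt_or (cs := cs) (w * w') k with h6 | h6
    · rw [h5] at h6
      generalize invParity cs w'⁻¹ (cs.simple k) = a at *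
      generalize invParity cs w⁻¹ (cs.simple j) = b at *
      have ha : a ≠ 1 := fun h => by have := h3.2 h; omega
      have hb : b ≠ 1 := fun h => by have := h4.2 h; omega
      have key : ∀ a b : ZMod 2, a + b = 1 → a ≠ 1 → b ≠ 1 → False := by decide
      exact (key a b h6 ha hb).elim
    · exact h6
  left k hk := by
    obtain ⟨j, hj, e⟩ := h'.left k hk
    obtain ⟨i, hi, e'⟩ := h.left j hj
    exact ⟨i, hi, by rw [mul_assoc, e, ← mul_assoc, e', mul_assoc]⟩
  right i hi := by
    obtain ⟨j, hj, e'⟩ := h.right i hi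
    obtain ⟨k, hk, e⟩ := h'.right j hj
    exact ⟨k, hk, by rw [mul_assoc, e, ← mul_assoc, e', mul_assoc]⟩

lemma noDescent_left (h : IsCoreElt cs I J w) {i : B} (hi : i ∈ I) :
    cs.length w < cs.length (cs.simple i * w) := by
  obtain ⟨j, hj, e⟩ := h.right i hi
  rw [← e]
  exact h.noDescent j hj

lemma inv_comm {i j : B} (e : w * cs.simple j = cs.simple i * w) :
    w⁻¹ * cs.simple i = cs.simple j * w⁻¹ := by
  rw [inv_mul_eq_iff_eq_mul, ← mul_assoc, e, mul_inv_cancel_right]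

lemma inv (h : IsCoreElt cs I J w) : IsCoreElt cs J I w⁻¹ where
  noDescent i hi := by
    have := h.noDescent_left hi
    rwa [← cs.length_inv w, ← cs.length_inv (_ * w), mul_inv_rev, cs.inv_simple] at this
  left i hi := by
    obtain ⟨j, hj, e⟩ := h.right i hi
    exact ⟨j, hj, inv_comm e⟩
  right j hj := by
    obtain ⟨i, hi, e⟩ := h.left j hj
    exact ⟨i, hi, inv_comm e⟩

lemma conj_mem (h : IsCoreElt cs I J w) {u : W} (hu : u ∈ parabolic cs J) :
    w * u * w⁻¹ ∈ parabolic cs I := by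
  refine Subgroup.closure_induction (p := fun u _ => w * u * w⁻¹ ∈ parabolic cs I) ?_ (by simp)
    ?_ ?_ hu
  · rintro _ ⟨j, hj, rfl⟩
    obtain ⟨i, hi, e⟩ := h.left j hj
    rw [e, mul_inv_cancel_right]
    exact simple_mem_parabolic hi
  · intro x y _ _ hx hy
    simpa [mul_assoc] using mul_mem hx hy
  · intro x _ hx
    simpa [mul_assoc] using inv_mem hx

/-- Conjugating `J` by `w` recovers the left set. This later shows that two paths with the same
target and the same element have the same source. -/
lemma left_unique (h : IsCoreElt cs I J w) {I' : Set B} (h' : IsCoreElt cs I' J w)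
    (hinj : Function.Injective cs.simple) : I = I' := by
  have key : ∀ {I I'}, IsCoreElt cs I J w → IsCoreElt cs I' J w → I ⊆ I' := by
    intro I I' h h' i hi
    obtain ⟨j, hj, e⟩ := h.right i hi
    obtain ⟨i', hi', e'⟩ := h'.left j hj
    rw [e] at e'
    exact hinj (mul_right_cancel e') ▸ hi'
  exact (key h h').antisymm (key h' h)

lemma eq_of_one (h : IsCoreElt cs I J 1) (hinj : Function.Injective cs.simple) : I = J :=
  h.left_unique (isCoreElt_one J) hinj

variable [Finite W]

/-- Conjugation by `w` preserves lengths on `W_J`: `w u` is a length-additive product both as `w .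
u` and as `(w u w⁻¹) . w`. Hence it carries the longest element to the longest element. -/
lemma mul_wl (h : IsCoreElt cs I J w) : w * wl cs J = wl cs I * w := by
  have hm := h.conj_mem (wl_mem J)
  have : w * wl cs J * w⁻¹ = wl cs I := by
    refine eq_wl hm fun i hi => ?_
    obtain ⟨j, hj, e⟩ := h.right i hi
    have e1 : w * wl cs J * w⁻¹ * cs.simple i = w * (wl cs J * cs.simple j) * w⁻¹ := by
      rw [mul_assoc (w * wl cs J), inv_comm e]; group
    have key : ∀ u ∈ parabolic cs J, cs.length (w * u * w⁻¹) = cs.length u := by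
      intro u hu
      have h1 := h.noDescent.length_mul hu
      have h2 := h.inv.noDescent.length_mul (inv_mem (h.conj_mem hu))
      rw [show w⁻¹ * (w * u * w⁻¹)⁻¹ = (w * u)⁻¹ by group, cs.length_inv, cs.length_inv,
        cs.length_inv] at h2
      omega
    rw [e1, key _ (wl_mem J), key _ (mul_mem (wl_mem J) (simple_mem_parabolic hj))]
    exact wl_mul_simple_lt hj
  rw [← this, inv_mul_cancel_right]

lemma length_mul_wl (h : IsCoreElt cs I J w) :
    cs.length (w * wl cs J) = cs.length w + cs.length (wl cs J) :=
  h.noDescent.length_mul (wl_mem J)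

lemma length_wl_eq (h : IsCoreElt cs I J w) : cs.length (wl cs I) = cs.length (wl cs J) := by
  have h1 := h.length_mul_wl
  have h2 := h.inv.length_mul_wl
  rw [← cs.length_inv, mul_inv_rev, inv_inv, wl_inv, ← h.mul_wl, cs.length_inv] at h2
  omega

/-- The product has two length-additive factorizations, `w . w_J` and `w_I . w`. The first shows the
descents in `J`, the second those inherited from `w`. -/
lemma mul_wl_descent (h : IsCoreElt cs I J w) {j : B}
    (hj : j ∈ J ∨ cs.length (w * cs.simple j) < cs.length w) :
    cs.length (w * wl cs J * cs.simple j) < cs.length (w * wl cs J) := by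
  rcases hj with hj | hj
  · exact (h.noDescent.mul_simple (wl_mem J) hj).2 (wl_mul_simple_lt hj)
  · have := length_mul_simple_mul_lt hj (wl cs I)
    have h1 := h.length_mul_wl
    have h2 := h.length_wl_eq
    rw [← h.mul_wl] at this
    omega

end IsCoreElt

/-! ### Cosets of core elements -/

section Cosets

variable {I J K : Finitary cs} {w w' : W}

lemma Coset.IsCore.isCoreElt_min {p : Coset I J} (h : p.IsCore) :
    IsCoreElt cs I.carrier J.carrier p.min := by
  have hm : coset I J p.min = p := p.exists_min.choose_spec.1
  refine ⟨fun j hj => ?_, fun j hj => ?_, fun i hi => ?_⟩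
  · have h1 : coset I J (p.min * cs.simple j) = p := by
      rw [← hm]
      refine Eq.symm ?_
      rw [hm]
      exact hm.symm.trans (coset_eq.2 ⟨1, one_mem _, _, simple_mem hj, by simp⟩)
    have h2 : cs.length p.min ≤ cs.length (p.min * cs.simple j) :=
      p.exists_min.choose_spec.2 _ h1
    have := cs.length_mul_simple_ne p.min j
    omega
  · rw [← h.2] at hj
    obtain ⟨_, i, hi, e⟩ := hj
    exact ⟨i, hi, by rw [e]; group⟩
  · rw [← h.1] at hi
    obtain ⟨_, j, hj, e⟩ := hi
    exact ⟨j, hj, by rw [e]; group⟩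

variable [Finite W]

lemma longest_eq_wl (I : Finitary cs) : I.longest = wl cs I.carrier := rfl

namespace IsCoreElt

/-- The candidate also equals `w_I w`, so it has all of `I` as left descents as well as all of `J`
as right descents, which characterizes the longest element. -/
lemma max_coset (h : IsCoreElt cs I.carrier J.carrier w) :
    (coset I J w).max = w * wl cs J.carrier := by
  have h1 : coset I J w = coset I J (w * wl cs J.carrier) :=
    coset_eq.2 ⟨1, one_mem _, _, wl_mem _, by simp⟩
  rw [h1]
  apply FullDescents.max_eq
  refine ⟨fun i hi => ?_, fun j hj => h.mul_wl_descent (.inl hj)⟩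
  have := h.inv.mul_wl_descent (.inl hi)
  rw [← cs.length_inv, ← cs.length_inv (_ * wl cs _)] at this
  simpa [mul_inv_rev, wl_inv, ← h.mul_wl] using this

lemma coset_injective (h : IsCoreElt cs I.carrier J.carrier w)
    (h' : IsCoreElt cs I.carrier J.carrier w') (e : coset I J w = coset I J w') : w = w' := by
  have := h.max_coset
  rw [e, h'.max_coset] at this
  exact (mul_right_cancel this).symm

/-- All longest elements are explicit: `w_J` cancels in the middle, and since `w w'` is again core,
the contributions of `w_J` and `w_K` are the same on both sides. Reducedness of cosets is thereby
reduced to the group. -/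
lemma isReduced_coset_iff (h : IsCoreElt cs I.carrier J.carrier w)
    (h' : IsCoreElt cs J.carrier K.carrier w') :
    (coset I J w).IsReduced (coset J K w') ↔
      cs.length (w * w') = cs.length w + cs.length w' := by
  rw [Coset.isReduced_iff, h.max_coset, h'.max_coset, longest_eq_wl, mul_inv_cancel_right,
    h.length_mul_wl, h'.length_mul_wl, ← mul_assoc, (h.mul h').length_mul_wl]
  omega

lemma star_coset (h : IsCoreElt cs I.carrier J.carrier w)
    (h' : IsCoreElt cs J.carrier K.carrier w')
    (hl : cs.length (w * w') = cs.length w + cs.length w') :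
    (coset I J w).star (coset J K w') = coset I K (w * w') := by
  rw [Coset.star_eq ((h.isReduced_coset_iff h').2 hl), h.max_coset, h'.max_coset, longest_eq_wl,
    mul_inv_cancel_right]
  exact (coset_eq.2 ⟨1, one_mem _, _, wl_mem _, by simp [mul_assoc]⟩).symm

/-- A factor from `W_I` can be moved across `w` into `W_J`, so the double coset is just `w W_J`,
where lengths are additive. -/
lemma min_coset (h : IsCoreElt cs I.carrier J.carrier w) : (coset I J w).min = w := by
  have hm : coset I J (coset I J w).min = coset I J w := (coset I J w).exists_min.choose_spec.1
  have hle : cs.length (coset I J w).min ≤ cs.length w :=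
    (coset I J w).exists_min.choose_spec.2 w rfl
  obtain ⟨a, ha, b, hb, e⟩ := coset_eq.1 hm.symm
  have e' : (coset I J w).min = w * (w⁻¹ * a * w * b) := by rw [e]; group
  have hu : w⁻¹ * a * w * b ∈ parabolic cs J.carrier := by
    have := h.inv.conj_mem ha
    rw [inv_inv] at this
    exact mul_mem this hb
  have hl := h.noDescent.length_mul hu
  rw [← e'] at hl
  have : cs.length (w⁻¹ * a * w * b) = 0 := by omega
  rw [cs.length_eq_zero_iff] at this
  rw [e', this, mul_one]

lemma isCore_coset (h : IsCoreElt cs I.carrier J.carrier w) : (coset I J w).IsCore := by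
  rw [Coset.IsCore, Coset.leftRed, Coset.rightRed, h.min_coset]
  constructor
  · ext i
    refine ⟨fun h => h.1, fun hi => ⟨hi, ?_⟩⟩
    obtain ⟨j, hj, e⟩ := h.right i hi
    exact ⟨j, hj, by rw [e, mul_inv_cancel_right]⟩
  · ext j
    refine ⟨fun h => h.1, fun hj => ⟨hj, ?_⟩⟩
    obtain ⟨i, hi, e⟩ := h.left j hj
    exact ⟨i, hi, by rw [mul_assoc, ← e, inv_mul_cancel_left]⟩

end IsCoreElt

lemma max_coset_one_of_subset {A A' : Finitary cs} (h : A.carrier ⊆ A'.carrier) :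
    (coset A A' (1 : W)).max = wl cs A'.carrier ∧ (coset A' A (1 : W)).max = wl cs A'.carrier := by
  constructor
  · rw [show coset A A' (1 : W) = coset A A' (wl cs A'.carrier) from
      coset_eq.2 ⟨1, one_mem _, _, wl_mem _, by simp⟩]
    exact FullDescents.max_eq ⟨fun i hi => simple_mul_wl_lt (h hi), fun i hi => wl_mul_simple_lt hi⟩
  · rw [show coset A' A (1 : W) = coset A' A (wl cs A'.carrier) from
      coset_eq.2 ⟨_, wl_mem _, 1, one_mem _, by simp⟩]
    exact FullDescents.max_eq ⟨fun i hi => simple_mul_wl_lt hi, fun i hi => wl_mul_simple_lt (h hi)⟩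

/-- Both cosets of the identity have longest element `w_M`, so their composition is automatically
reduced and is the coset of `w_M w_M⁻¹ w_M`. Only the inclusions and that coset carry information.
-/
lemma hasReducedExpr_iff {p : Coset I J} {A : Finitary cs} :
    p.HasReducedExpr A ↔ (I.carrier ⊆ A.carrier ∧ J.carrier ⊆ A.carrier) ∧
      p = coset I J (wl cs A.carrier) := by
  rw [Coset.HasReducedExpr]
  refine and_congr_right fun ⟨hI, hJ⟩ => ?_
  have h1 := (max_coset_one_of_subset hI).1
  have h2 := (max_coset_one_of_subset hJ).2
  have hr : (coset I A (1 : W)).IsReduced (coset A J 1) := by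
    rw [Coset.isReduced_iff, h1, h2, longest_eq_wl]; simp
  rw [Coset.star_eq hr, h1, h2, longest_eq_wl, mul_inv_cancel, one_mul]
  exact ⟨fun h => h.2.symm, fun h => ⟨hr, h.symm⟩⟩

end Cosets

/-! ### Atomic elements -/

section Atomic

variable [Finite W] {I J : Set B} {s t : B} {w : W}

lemma wl_simple_comm_symm {A : Set B} {i j : B} (e : wl cs A * cs.simple j = cs.simple i * wl cs A) :
    wl cs A * cs.simple i = cs.simple j * wl cs A := by
  have := IsCoreElt.inv_comm e
  rwa [wl_inv] at this

/-- The core element of the atomic coset with reduced expression `[I, M, J]`. -/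
lemma isCoreElt_atomic (hinj : Function.Injective cs.simple) (hs : s ∉ J)
    (ht : wl cs (insert s J) * cs.simple s = cs.simple t * wl cs (insert s J)) :
    IsCoreElt cs (insert s J \ {t}) J (wl cs (insert s J) * wl cs J) := by
  set A := insert s J with hA
  have hJA : J ⊆ A := Set.subset_insert _ _
  refine ⟨fun j hj => ?_, fun j hj => ?_, fun i hi => ?_⟩
  -- Multiplication by `w_A` on the left reverses lengths, so the descents of `w_J` become ascents
  -- of `w_A w_J`.
  · have h1 := length_wl_mul (parabolic_mono hJA (wl_mem (cs := cs) J))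
    have h2 := length_wl_mul (cs := cs) (mul_mem (parabolic_mono hJA (wl_mem (cs := cs) J))
      (simple_mem_parabolic (hJA hj)))
    have h3 := wl_mul_simple_lt (cs := cs) hj
    rw [mul_assoc]
    omega
  -- Conjugation by `w_J` permutes `J`, and conjugation by `w_A` then maps `J = A ∖ {s}` onto `A ∖
  -- {t}`.
  · obtain ⟨j', hj', e⟩ := exists_wl_conj hinj (cs := cs) hj
    obtain ⟨i, hi, e'⟩ := exists_wl_conj hinj (cs := cs) (hJA hj')
    refine ⟨i, ⟨hi, ?_⟩, by rw [mul_assoc, e, ← mul_assoc, e', mul_assoc]⟩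
    rintro rfl
    rw [← ht] at e'
    exact hs (hinj (mul_left_cancel e') ▸ hj')
  · obtain ⟨j, hj, e⟩ := exists_wl_conj hinj (cs := cs) hi.1
    have hj' : j ∈ J := by
      rcases hj with rfl | hj
      · exact absurd (hinj (mul_right_cancel ((wl_simple_comm_symm e).symm.trans ht)))
          hi.2
      · exact hj
    obtain ⟨j', hj', e'⟩ := exists_wl_conj hinj (cs := cs) hj'
    exact ⟨j', hj', by rw [mul_assoc, wl_simple_comm_symm e', ← mul_assoc, wl_simple_comm_symm e,
      mul_assoc]⟩

lemma atomic_mem : wl cs (insert s J) * wl cs J ∈ parabolic cs (insert s J) :=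
  mul_mem (wl_mem _) (parabolic_mono (Set.subset_insert _ _) (wl_mem _))

/-- The only right descent of an atomic element in its parabolic subgroup is `s`. -/
lemma atomic_descent (hinj : Function.Injective cs.simple) (hs : s ∉ J) :
    cs.length (wl cs (insert s J) * wl cs J * cs.simple s) <
      cs.length (wl cs (insert s J) * wl cs J) := by
  have hsA : s ∈ insert s J := Set.mem_insert _ _
  have hm := parabolic_mono (Set.subset_insert s J) (wl_mem (cs := cs) J)
  have h1 := length_wl_mul hm
  have h2 := length_wl_mul (cs := cs) (mul_mem hm (simple_mem_parabolic hsA))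
  rcases length_mul_simple_lt_or (cs := cs) (wl cs J) s with h | h
  -- If `s` were a descent of `w_J`, then `w_J` would be longest in `W_{J ∪ {s}}`. Write `s = v u`
  -- with `v` minimal modulo `W_J`; additivity on `v w_J` forces `v = 1`, hence `s ∈ W_J`, which is
  -- excluded.
  · exfalso
    have : wl cs J = wl cs (insert s J) := eq_wl hm fun j hj => by
      rcases hj with rfl | hj
      · exact h
      · exact wl_mul_simple_lt hj
    have h3 := wl_mul_simple_lt (cs := cs) hsA
    have h4 : cs.simple s ∈ parabolic cs J := by
      have h5 := length_inv_mul_add_of_descents (cs := cs) (A := insert s J)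
        (y := wl cs (insert s J)) (fun j hj => simple_mul_wl_lt hj) (simple_mem_parabolic hsA)
      obtain ⟨v, u, hv, hu, e⟩ := exists_noDescent_mul (cs := cs) J (cs.simple s)
      have h6 : v ∈ parabolic cs (insert s J) := by
        rw [show v = cs.simple s * u⁻¹ by rw [e]; group]
        exact mul_mem (simple_mem_parabolic hsA)
          (inv_mem (parabolic_mono (Set.subset_insert s J) hu))
      have h7 := hv.length_mul (wl_mem J)
      have h8 := length_le_wl (mul_mem h6 hm)
      rw [← this] at h8
      have h9 : cs.length v = 0 := by omega
      rw [cs.length_eq_zero_iff] at h9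
      rw [e, h9, one_mul]
      exact hu
    exact hs (mem_of_simple_mem hinj h4)
  · rw [mul_assoc]
    omega

/-- If `w` is a core element and `u` is its part in `W_A`, then `u` is a core element. -/
lemma IsCoreElt.exists_comm_of_mul (h : IsCoreElt cs I J w) (hinj : Function.Injective cs.simple)
    {A : Set B} (hJA : J ⊆ A) {v u : W} (hv : NoDescent cs A v) (hu : u ∈ parabolic cs A)
    (e : w = v * u) {j : B} (hj : j ∈ J) : ∃ k ∈ A, u * cs.simple j = cs.simple k * u := by
  obtain ⟨i, -, e1⟩ := h.left j hj
  set x := u * cs.simple j * u⁻¹ with hx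
  have hxA : x ∈ parabolic cs A :=
    mul_mem (mul_mem hu (simple_mem_parabolic (hJA hj))) (inv_mem hu)
  have e2 : v * x = cs.simple i * v := by
    have : v * u * cs.simple j = cs.simple i * (v * u) := by rw [← e, e1]
    rw [hx, ← mul_assoc, ← mul_assoc, this]; group
  -- From `v x = s_i v`, the length of `v . x` differs from that of `v` by exactly one, so the
  -- conjugate `x` is a simple reflection.
  have h1 := hv.length_mul hxA
  have h2 := cs.length_simple_mul v i
  rw [← e2] at h2
  have h3 : cs.length x = 1 := by omega
  obtain ⟨k, hk⟩ := cs.length_eq_one_iff.1 h3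
  refine ⟨k, mem_of_simple_mem hinj (hk ▸ hxA), ?_⟩
  rw [← hk, hx, inv_mul_cancel_right]

/-- An element of `W_A` all of whose descents in `A ∖ J` are present, and which conjugates `J` into
`A`, is `w_A w_J`. -/
lemma eq_wl_mul_wl {A : Set B} {u : W} (hu : u ∈ parabolic cs A) (hJA : J ⊆ A)
    (hd : NoDescent cs J u) (hc : ∀ j ∈ J, ∃ k ∈ A, u * cs.simple j = cs.simple k * u)
    (hA : ∀ j ∈ A, j ∉ J → cs.length (u * cs.simple j) < cs.length u) :
    u = wl cs A * wl cs J := by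
  -- The left set is taken to be the conjugate of `J` by `u`, whatever it is; only the right side
  -- matters for the descents of `u w_J`.
  have hcore : IsCoreElt cs {k | ∃ j ∈ J, u * cs.simple j = cs.simple k * u} J u := by
    refine ⟨hd, fun j hj => ?_, fun i hi => hi⟩
    obtain ⟨k, -, e⟩ := hc j hj
    exact ⟨k, ⟨j, hj, e⟩, e⟩
  have : u * wl cs J = wl cs A := by
    refine eq_wl (mul_mem hu (parabolic_mono hJA (wl_mem J))) fun j hj => hcore.mul_wl_descent ?_
    by_cases h : j ∈ J
    · exact .inl h
    · exact .inr (hA j hj h)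
  rw [← this, mul_assoc, wl_mul_wl, mul_one]

/-- A core element with a right descent `s` is a reduced product of a core element and the atomic
element of `s`. -/
lemma IsCoreElt.exists_atomic (h : IsCoreElt cs I J w) (hinj : Function.Injective cs.simple)
    (hsw : cs.length (w * cs.simple s) < cs.length w)
    (ht : wl cs (insert s J) * cs.simple s = cs.simple t * wl cs (insert s J)) :
    ∃ v, IsCoreElt cs I (insert s J \ {t}) v ∧ w = v * (wl cs (insert s J) * wl cs J) ∧
      cs.length w = cs.length v + cs.length (wl cs (insert s J) * wl cs J) := by
  have hs : s ∉ J := fun hs => by have := h.noDescent s hs; omega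
  have hJA : J ⊆ insert s J := Set.subset_insert _ _
  obtain ⟨v, u, hv, hu, e⟩ := exists_noDescent_mul (cs := cs) (insert s J) w
  have hd : ∀ j ∈ insert s J, (cs.length (w * cs.simple j) < cs.length w ↔
      cs.length (u * cs.simple j) < cs.length u) := by
    intro j hj
    rw [e]
    exact hv.mul_simple hu hj
  -- The factor `u` in `W_{J ∪ {s}}` has the same descents there as `w`: the reflection `s`, and
  -- nothing in `J`.
  have hu' : u = wl cs (insert s J) * wl cs J := by
    refine eq_wl_mul_wl hu hJA (fun j hj => ?_)
      (fun j hj => h.exists_comm_of_mul hinj hJA hv hu e hj) (fun j hj hj' => ?_)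
    · have h1 := hd j (hJA hj)
      have h2 := h.noDescent j hj
      rcases length_mul_simple_lt_or (cs := cs) u j with h3 | h3
      · have := h1.2 h3
        omega
      · exact h3
    · obtain rfl : j = s := hj.resolve_right hj'
      exact (hd _ (Set.mem_insert _ _)).1 hsw
  subst hu'
  refine ⟨v, ?_, e, by rw [e]; exact hv.length_mul hu⟩
  -- The remaining factor is core as the quotient of `w` by the atomic element, in the groupoid of
  -- core elements.
  have := h.mul (isCoreElt_atomic hinj hs ht).inv
  rwa [e, mul_inv_cancel_right] at this

/-- A core element with no right descent at `s` has a reduced product with elements of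
`W_{J ∪ {s}}`. -/
lemma IsCoreElt.length_mul_of_not_descent (h : IsCoreElt cs I J w)
    (hs : cs.length w < cs.length (w * cs.simple s)) {x : W}
    (hx : x ∈ parabolic cs (insert s J)) :
    cs.length (w * x) = cs.length w + cs.length x := by
  refine NoDescent.length_mul (A := insert s J) (fun j hj => ?_) hx
  rcases hj with rfl | hj
  · exact hs
  · exact h.noDescent j hj

/-- A core element with right descents `s` and `t` is divisible by any core element of
`W_{J ∪ {s, t}}` with right descents `s` and `t`. -/
lemma IsCoreElt.exists_of_two_descents (h : IsCoreElt cs I J w)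
    (hs : cs.length (w * cs.simple s) < cs.length w)
    (ht : cs.length (w * cs.simple t) < cs.length w) {I' : Set B} {x : W}
    (hx : IsCoreElt cs I' J x) (hxm : x ∈ parabolic cs (insert s (insert t J)))
    (hsx : cs.length (x * cs.simple s) < cs.length x)
    (htx : cs.length (x * cs.simple t) < cs.length x) :
    ∃ v, IsCoreElt cs I I' v ∧ w = v * x ∧ cs.length w = cs.length v + cs.length x := by
  set A := insert s (insert t J) with hA
  have hJA : J ⊆ A := (Set.subset_insert _ _).trans (Set.subset_insert _ _)
  -- Both `x w_J` and `w w_J` have all of `A` as right descents. The former is therefore `w_A` and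
  -- divides the latter with additive lengths; `w_J` is then cancelled.
  have h1 : x * wl cs J = wl cs A := by
    refine eq_wl (mul_mem hxm (parabolic_mono hJA (wl_mem J))) fun j hj => hx.mul_wl_descent ?_
    rcases hj with rfl | rfl | hj
    exacts [.inr hsx, .inr htx, .inl hj]
  have h2 : cs.length (w * wl cs J * (wl cs A)⁻¹) + cs.length (wl cs A) =
      cs.length (w * wl cs J) := by
    refine length_mul_inv_add_of_descents (fun j hj => h.mul_wl_descent ?_) (wl_mem A)
    rcases hj with rfl | rfl | hj
    exacts [.inr hs, .inr ht, .inl hj]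
  rw [← h1, hx.length_mul_wl, h.length_mul_wl, mul_inv_rev, mul_assoc w, mul_inv_cancel_left] at h2
  exact ⟨w * x⁻¹, h.mul hx.inv, by group, by omega⟩

end Atomic

/-- The data of an atomic coset. -/
lemma Coset.IsAtomic.exists_eq [Finite W] (hinj : Function.Injective cs.simple) {I J : Finitary cs}
    {p : Coset I J} (hp : p.IsAtomic) : ∃ s t : B, s ∉ J.carrier ∧
      wl cs (insert s J.carrier) * cs.simple s = cs.simple t * wl cs (insert s J.carrier) ∧
      I.carrier = insert s J.carrier \ {t} ∧ p = coset I J (wl cs (insert s J.carrier)) := by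
  obtain ⟨hc, t, s, A, ht, hs, hA, hA', he⟩ := hp
  obtain ⟨-, hpw⟩ := hasReducedExpr_iff.1 he
  have hm := hc.isCoreElt_min
  have hmax : p.max = wl cs A.carrier := by
    rw [hpw]
    refine FullDescents.max_eq ⟨fun i hi => simple_mul_wl_lt ?_, fun i hi => wl_mul_simple_lt ?_⟩
    · rw [hA]; exact .inr hi
    · rw [hA']; exact .inr hi
  have hmin : coset I J p.min = p := p.exists_min.choose_spec.1
  have h1 := hm.max_coset
  rw [hmin, hmax] at h1
  obtain ⟨t', ht', e⟩ := exists_wl_conj hinj (cs := cs) (Set.mem_insert s J.carrier)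
  rw [← hA'] at ht' e
  -- The definition of atomic does not say that `t = w_M s w_M`; this comes from coreness. If the
  -- conjugate `t'` of `s` were in `I`, it would come from an element of `J` through `w_M w_J`,
  -- hence from an element of `J` through `w_M`, which would have to be `s`.
  have htI : t' ∉ I.carrier := by
    intro hi
    obtain ⟨j, hj, e1⟩ := hm.right t' hi
    obtain ⟨j', hj', e2⟩ := exists_wl_conj hinj (cs := cs) hj
    have e3 := wl_simple_comm_symm e2
    have e4 : wl cs A.carrier * cs.simple j' = cs.simple t' * wl cs A.carrier := by
      rw [h1, mul_assoc, e3, ← mul_assoc, e1, mul_assoc]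
    rw [← e] at e4
    exact hs (hinj (mul_left_cancel e4) ▸ hj')
  obtain rfl : t' = t := by
    rw [hA] at ht'
    exact ht'.resolve_right htI
  refine ⟨s, t', hs, by rwa [← hA'], ?_, by rwa [← hA']⟩
  rw [← hA', hA, Set.insert_sdiff_self_of_notMem ht]

end CoreElements

end CoxeterB

namespace CoxeterB

section SignedPerm

/-! ### The action of type `B` on the integers -/

/-- The action of `s_i` on `ℤ`: `s_0` exchanges `1` and `-1`, and `s_i` exchanges `i` and `i + 1` as
well as `-i` and `-i - 1` for `i > 0`. -/
def sgnFun (i : ℕ) (x : ℤ) : ℤ :=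
  if i = 0 then (if x = 1 then -1 else if x = -1 then 1 else x)
  else if x = i then i + 1 else if x = i + 1 then i
  else if x = -i then -i - 1 else if x = -i - 1 then -i else x

lemma sgnFun_sgnFun (i : ℕ) (x : ℤ) : sgnFun i (sgnFun i x) = x := by
  unfold sgnFun; grind

lemma sgnFun_neg (i : ℕ) (x : ℤ) : sgnFun i (-x) = -sgnFun i x := by
  unfold sgnFun; grind

/-- The permutation `sgnFun i`. -/
def sgnPerm (i : ℕ) : Equiv.Perm ℤ := ⟨sgnFun i, sgnFun i, sgnFun_sgnFun i, sgnFun_sgnFun i⟩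

lemma sgnPerm_apply (i : ℕ) (x : ℤ) : sgnPerm i x = sgnFun i x := rfl

lemma sgnPerm_mul_self (i : ℕ) : sgnPerm i * sgnPerm i = 1 := by
  ext x; exact sgnFun_sgnFun i x

/-- The graph of the permutation as a disjunction of linear conditions on `x` and `y`, so that
identities between composites reduce to case splits and linear arithmetic. -/
lemma sgnFun_spec {i : ℕ} (hi : 0 < i) {x y : ℤ} (h : sgnFun i x = y) :
    (x = i ∧ y = i + 1) ∨ (x = i + 1 ∧ y = i) ∨ (x = -i ∧ y = -i - 1) ∨ (x = -i - 1 ∧ y = -i) ∨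
      (x ≠ i ∧ x ≠ i + 1 ∧ x ≠ -i ∧ x ≠ -i - 1 ∧ y = x) := by
  subst h
  rw [sgnFun, if_neg hi.ne']
  split_ifs <;> omega

lemma sgnFun_zero_spec {x y : ℤ} (h : sgnFun 0 x = y) :
    (x = 1 ∧ y = -1) ∨ (x = -1 ∧ y = 1) ∨ (x ≠ 1 ∧ x ≠ -1 ∧ y = x) := by
  subst h
  rw [sgnFun, if_pos rfl]
  split_ifs <;> omega

lemma sgnPerm_comm {i j : ℕ} (h : i + 1 < j) :
    sgnPerm i * sgnPerm j = sgnPerm j * sgnPerm i := by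
  ext x
  simp only [Equiv.Perm.mul_apply, sgnPerm_apply]
  generalize h1 : sgnFun j x = y
  generalize h2 : sgnFun i x = z
  generalize h3 : sgnFun i y = u
  generalize h4 : sgnFun j z = v
  have h1 := sgnFun_spec (by omega) h1
  have h4 := sgnFun_spec (by omega) h4
  rcases Nat.eq_zero_or_pos i with rfl | hi
  · have h2 := sgnFun_zero_spec h2
    have h3 := sgnFun_zero_spec h3
    rcases h1 with h1 | h1 | h1 | h1 | h1 <;> rcases h2 with h2 | h2 | h2 <;> omega
  · have h2 := sgnFun_spec hi h2
    have h3 := sgnFun_spec hi h3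
    rcases h1 with h1 | h1 | h1 | h1 | h1 <;> rcases h2 with h2 | h2 | h2 | h2 | h2 <;> omega

lemma sgnPerm_braid {i : ℕ} (h : 0 < i) : sgnPerm i * sgnPerm (i + 1) * sgnPerm i =
    sgnPerm (i + 1) * sgnPerm i * sgnPerm (i + 1) := by
  ext x
  simp only [Equiv.Perm.mul_apply, sgnPerm_apply]
  generalize h1 : sgnFun i x = y₁
  generalize h2 : sgnFun (i + 1) x = z₁
  generalize h3 : sgnFun (i + 1) y₁ = y₂
  generalize h4 : sgnFun i z₁ = z₂
  generalize h5 : sgnFun i y₂ = y₃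
  generalize h6 : sgnFun (i + 1) z₂ = z₃
  have h1 := sgnFun_spec (by omega) h1
  have h2 := sgnFun_spec (by omega) h2
  have h3 := sgnFun_spec (by omega) h3
  have h4 := sgnFun_spec (by omega) h4
  have h5 := sgnFun_spec (by omega) h5
  have h6 := sgnFun_spec (by omega) h6
  push_cast at *
  rcases h1 with h1 | h1 | h1 | h1 | h1 <;> rcases h2 with h2 | h2 | h2 | h2 | h2 <;>
    try (exfalso; omega)
  all_goals
    rcases h3 with h3 | h3 | h3 | h3 | h3 <;> try (exfalso; omega)
  all_goals
    rcases h4 with h4 | h4 | h4 | h4 | h4 <;> omega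

lemma sgnPerm_four : sgnPerm 0 * sgnPerm 1 * sgnPerm 0 * sgnPerm 1 =
    sgnPerm 1 * sgnPerm 0 * sgnPerm 1 * sgnPerm 0 := by
  ext x
  simp only [Equiv.Perm.mul_apply, sgnPerm_apply]
  have key : x = 1 ∨ x = -1 ∨ x = 2 ∨ x = -2 ∨ (x ≠ 1 ∧ x ≠ -1 ∧ x ≠ 2 ∧ x ≠ -2) := by omega
  rcases key with rfl | rfl | rfl | rfl | ⟨h1, h2, h3, h4⟩
  iterate 4 decide
  have e0 : sgnFun 0 x = x := by have := sgnFun_zero_spec (x := x) rfl; omega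
  have e1 : sgnFun 1 x = x := by have := sgnFun_spec Nat.one_pos (x := x) rfl; omega
  simp only [e0, e1]

lemma pow_eq_one_of_comm {G : Type*} [Group G] {a b : G} (ha : a * a = 1) (hb : b * b = 1) :
    (a * b = b * a → (a * b) ^ 2 = 1) ∧ (a * b * a = b * a * b → (a * b) ^ 3 = 1) ∧
      (a * b * a * b = b * a * b * a → (a * b) ^ 4 = 1) := by
  have ha' : a⁻¹ = a := inv_eq_of_mul_eq_one_right ha
  have hb' : b⁻¹ = b := inv_eq_of_mul_eq_one_right hb
  refine ⟨fun h => ?_, fun h => ?_, fun h => ?_⟩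
  · rw [sq]; nth_rw 1 [h]; rw [mul_assoc, ← mul_assoc a, ha, one_mul, hb]
  · rw [show (a * b) ^ 3 = (a * b * a) * (b * a * b) by simp only [pow_succ, pow_zero, one_mul, mul_assoc], ← h]
    rw [← mul_eq_one_iff_eq_inv.2 (show a * b * a = (a * b * a)⁻¹ by
      simp [mul_inv_rev, ha', hb', mul_assoc])]
  · rw [show (a * b) ^ 4 = (a * b * a * b) * (a * b * a * b) by
      simp only [pow_succ, pow_zero, one_mul, mul_assoc]]
    nth_rw 2 [h]
    rw [mul_eq_one_iff_eq_inv]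
    simp [mul_inv_rev, ha', hb', mul_assoc]

lemma sgnPerm_isLiftable (n : ℕ) : (typeB n).IsLiftable fun i => sgnPerm i := by
  intro i j
  have h := pow_eq_one_of_comm (sgnPerm_mul_self i) (sgnPerm_mul_self j)
  rw [typeB_apply]
  split_ifs with h1 h2 h3
  · subst h1; rw [pow_one, sgnPerm_mul_self]
  · apply h.2.2
    rcases h2 with h2 | h2
    · rw [h2.1, h2.2]; exact sgnPerm_four
    · rw [h2.1, h2.2]; exact sgnPerm_four.symm
  · apply h.2.1
    rcases h3 with h3 | h3
    · rw [← h3]; exact sgnPerm_braid (by omega)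
    · rw [← h3]; exact (sgnPerm_braid (by omega)).symm
  · apply h.1
    rcases Nat.lt_trichotomy (i : ℕ) j with h4 | h4 | h4
    · exact sgnPerm_comm (by omega)
    · exact absurd (Fin.ext h4) h1
    · exact (sgnPerm_comm (by omega)).symm

variable {n : ℕ} {W : Type*} [Group W] (cs : CoxeterSystem (typeB n) W)

/-- The action of the Coxeter group of type `B_n` on `ℤ` by signed permutations. -/
noncomputable def sgn : W →* Equiv.Perm ℤ := cs.lift ⟨fun i => sgnPerm i, sgnPerm_isLiftable n⟩

variable {cs}

lemma sgn_simple (i : Fin n) : sgn cs (cs.simple i) = sgnPerm i :=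
  cs.lift_apply_simple (sgnPerm_isLiftable n) i

lemma sgn_mul_simple (w : W) (i : Fin n) (x : ℤ) :
    sgn cs (w * cs.simple i) x = sgn cs w (sgnFun i x) := by
  rw [map_mul, sgn_simple]; rfl

lemma sgn_neg (w : W) (x : ℤ) : sgn cs w (-x) = -sgn cs w x := by
  induction w using cs.simple_induction_right generalizing x with
  | one => simp
  | mul_simple_right w i ih => rw [sgn_mul_simple, sgn_mul_simple, sgnFun_neg, ih]

lemma sgn_zero (w : W) : sgn cs w 0 = 0 := by
  have := sgn_neg (cs := cs) w 0
  simp only [neg_zero] at this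
  omega

lemma sgn_mul_apply (w w' : W) (x : ℤ) : sgn cs (w * w') x = sgn cs w (sgn cs w' x) := by
  rw [map_mul]; rfl

lemma sgn_of_gt (w : W) {x : ℤ} (hx : n < x) : sgn cs w x = x := by
  induction w using cs.simple_induction_right with
  | one => simp
  | mul_simple_right w i ih =>
    rw [sgn_mul_simple]
    have : sgnFun i x = x := by
      have := i.2
      unfold sgnFun; grind
    rw [this, ih]

lemma simple_comm {i j : Fin n} (h : (i : ℕ) + 1 < j ∨ (j : ℕ) + 1 < i) :
    cs.simple i * cs.simple j = cs.simple j * cs.simple i := by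
  have h1 := cs.simple_mul_simple_pow i j
  rw [typeB_apply, if_neg (by rintro rfl; omega), if_neg (by omega), if_neg (by omega), sq] at h1
  have := mul_eq_one_iff_eq_inv.1 h1
  simpa using this

lemma simple_braid {i j : Fin n} (hi : 0 < (i : ℕ)) (hj : 0 < (j : ℕ))
    (h : (i : ℕ) + 1 = j ∨ (j : ℕ) + 1 = i) :
    cs.simple i * cs.simple j * cs.simple i = cs.simple j * cs.simple i * cs.simple j := by
  have h1 := cs.simple_mul_simple_pow i j
  rw [typeB_apply, if_neg (by rintro rfl; omega), if_neg (by omega), if_pos h,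
    show (cs.simple i * cs.simple j) ^ 3 = (cs.simple i * cs.simple j * cs.simple i) *
      (cs.simple j * cs.simple i * cs.simple j) by
      simp only [pow_succ, pow_zero, one_mul, mul_assoc]] at h1
  have := mul_eq_one_iff_eq_inv.1 h1
  simpa [mul_assoc] using this

lemma simple_four {i j : Fin n} (h : (i : ℕ) = 0 ∧ (j : ℕ) = 1 ∨ (i : ℕ) = 1 ∧ (j : ℕ) = 0) :
    cs.simple i * cs.simple j * cs.simple i * cs.simple j =
      cs.simple j * cs.simple i * cs.simple j * cs.simple i := by
  have h1 := cs.simple_mul_simple_pow i j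
  rw [typeB_apply, if_neg (by rintro rfl; omega), if_pos h,
    show (cs.simple i * cs.simple j) ^ 4 = (cs.simple i * cs.simple j * cs.simple i * cs.simple j) *
      (cs.simple i * cs.simple j * cs.simple i * cs.simple j) by
      simp only [pow_succ, pow_zero, one_mul, mul_assoc]] at h1
  have := mul_eq_one_iff_eq_inv.1 h1
  simpa [mul_assoc] using this

lemma exists_eq_mul_simple {w : W} {j : Fin n} (h : cs.length (w * cs.simple j) < cs.length w) :
    ∃ v, w = v * cs.simple j ∧ cs.length w = cs.length v + 1 ∧
      cs.length v < cs.length (v * cs.simple j) := by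
  refine ⟨w * cs.simple j, by simp, ?_, by simpa⟩
  have := cs.length_mul_simple w j
  omega

lemma length_mul_simples_le (v : W) (i j k : Fin n) :
    cs.length (v * cs.simple i * cs.simple j * cs.simple k) ≤ cs.length v + 3 ∧
      cs.length (v * cs.simple i * cs.simple j) ≤ cs.length v + 2 := by
  have h1 := cs.length_mul_simple v i
  have h2 := cs.length_mul_simple (v * cs.simple i) j
  have h3 := cs.length_mul_simple (v * cs.simple i * cs.simple j) k
  omega

/-- If `i` is not a right descent of `w`, then `w` is increasing at `i`. -/
lemma sgn_lt_of_not_descent (w : W) (i : Fin n) (h : cs.length w < cs.length (w * cs.simple i)) :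
    sgn cs w i < sgn cs w (i + 1) := by
  induction hn : cs.length w using Nat.strong_induction_on generalizing w i with
  | _ m ih =>
  subst hn
  have ih' : ∀ v, cs.length v < cs.length w → ∀ i, cs.length v < cs.length (v * cs.simple i) →
    sgn cs v i < sgn cs v (i + 1) := fun v hv i hi => ih _ hv v i hi rfl
  clear ih
  by_cases hw : w = 1
  · subst hw; simp
  obtain ⟨j, hj⟩ := cs.exists_rightDescent_of_ne_one hw
  obtain ⟨v, rfl, hl, hv⟩ := exists_eq_mul_simple hj
  have hij : (i : ℕ) ≠ j := fun e => by
    obtain rfl := Fin.ext e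
    rw [cs.simple_mul_simple_cancel_right] at h
    omega
  have hvj := ih' v (by omega) j hv
  rw [sgn_mul_simple, sgn_mul_simple]
  by_cases hcomm : (i : ℕ) + 1 < j ∨ (j : ℕ) + 1 < i
  · have hvi : cs.length v < cs.length (v * cs.simple i) := by
      rcases length_mul_simple_lt_or (cs := cs) v i with h1 | h1
      · rw [mul_assoc, ← simple_comm hcomm, ← mul_assoc] at h
        have := cs.length_mul_simple (v * cs.simple i) j
        omega
      · exact h1
    have := ih' v (by omega) i hvi
    have e1 : sgnFun j i = i := by
      unfold sgnFun; grind
    have e2 : sgnFun j (i + 1) = i + 1 := by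
      unfold sgnFun; grind
    rwa [e1, e2]
  -- Letters of the dihedral subgroup of `s_i` and `s_j` are stripped alternately from the right.
  -- Each time, either the remaining element is increasing at the next index, which decides the
  -- inequality, or another letter comes off.
  have step : ∀ u : W, cs.length u + 1 ≤ cs.length (v * cs.simple j) → ∀ k : Fin n,
      sgn cs u k < sgn cs u (k + 1) ∨ ∃ u', u = u' * cs.simple k ∧
        cs.length u = cs.length u' + 1 ∧ sgn cs u' k < sgn cs u' (k + 1) := by
    intro u hu k
    rcases length_mul_simple_lt_or (cs := cs) u k with h1 | h1
    · obtain ⟨u', h2, h3, h4⟩ := exists_eq_mul_simple h1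
      exact .inr ⟨u', h2, h3, ih' u' (by omega) k h4⟩
    · exact .inl (ih' u (by omega) k h1)
  have s0 : sgnFun 0 1 = -1 ∧ sgnFun 0 2 = 2 ∧ sgnFun 1 0 = 0 ∧ sgnFun 1 1 = 2 ∧
    sgnFun 1 2 = 1 ∧ sgnFun 1 (-1) = -2 := by decide
  obtain ⟨s01, s02, s10, s11, s12, s13⟩ := s0
  rcases Nat.eq_zero_or_pos (i : ℕ) with hi | hi
  · have hj' : (j : ℕ) = 1 := by omega
    have e4 := simple_four (cs := cs) (.inl ⟨hi, hj'⟩)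
    rw [hj', Nat.cast_one, one_add_one_eq_two] at hvj
    rw [hi, hj']
    simp only [Nat.cast_zero, zero_add, s10, s11, sgn_zero]
    rcases step v (by omega) i with h1 | ⟨v2, rfl, h2, h3⟩
    · rw [hi, Nat.cast_zero, zero_add, sgn_zero] at h1
      omega
    simp only [sgn_mul_simple, hi, Nat.cast_zero, zero_add, s01, s02, sgn_zero] at h3 hvj ⊢
    rcases step v2 (by omega) j with h1 | ⟨v3, rfl, h4, h5⟩
    · rw [hj', Nat.cast_one, one_add_one_eq_two] at h1
      omega
    simp only [sgn_mul_simple, hj', Nat.cast_one, one_add_one_eq_two, s11, s12, s13] at h3 h5 hvj ⊢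
    rcases step v3 (by omega) i with h1 | ⟨v4, rfl, h6, h7⟩
    · rwa [hi, Nat.cast_zero, zero_add, sgn_zero] at h1
    -- With four alternating letters removed, the relation of order four shortens `w s_i` below `w`,
    -- contradicting that `i` is not a descent.
    exfalso
    have e5 : v4 * cs.simple i * cs.simple j * cs.simple i * cs.simple j * cs.simple i =
        v4 * cs.simple j * cs.simple i * cs.simple j := by
      rw [show v4 * cs.simple i * cs.simple j * cs.simple i * cs.simple j * cs.simple i =
        v4 * (cs.simple i * cs.simple j * cs.simple i * cs.simple j) * cs.simple i by
        simp only [mul_assoc], e4]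
      simp [mul_assoc]
    have := length_mul_simples_le (cs := cs) v4 j i j
    rw [e5] at h
    omega
  rcases Nat.eq_zero_or_pos (j : ℕ) with hj0 | hj0
  · have hi' : (i : ℕ) = 1 := by omega
    have e4 := simple_four (cs := cs) (.inr ⟨hi', hj0⟩)
    rw [hj0, Nat.cast_zero, zero_add, sgn_zero] at hvj
    rw [hi', hj0]
    simp only [Nat.cast_one, one_add_one_eq_two, s01, s02, sgn_neg]
    rcases step v (by omega) i with h1 | ⟨v2, rfl, h2, h3⟩
    · rw [hi', Nat.cast_one, one_add_one_eq_two] at h1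
      omega
    simp only [sgn_mul_simple, hi', Nat.cast_one, one_add_one_eq_two, s11, s12] at h3 hvj ⊢
    rcases step v2 (by omega) j with h1 | ⟨v3, rfl, h4, h5⟩
    · rw [hj0, Nat.cast_zero, zero_add, sgn_zero] at h1
      omega
    simp only [sgn_mul_simple, hj0, Nat.cast_zero, zero_add, s01, s02, sgn_neg, sgn_zero]
      at h3 h5 hvj ⊢
    rcases step v3 (by omega) i with h1 | ⟨v4, rfl, h6, h7⟩
    · rw [hi', Nat.cast_one, one_add_one_eq_two] at h1
      omega
    exfalso
    have e5 : v4 * cs.simple i * cs.simple j * cs.simple i * cs.simple j * cs.simple i =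
        v4 * cs.simple j * cs.simple i * cs.simple j := by
      rw [show v4 * cs.simple i * cs.simple j * cs.simple i * cs.simple j * cs.simple i =
        v4 * (cs.simple i * cs.simple j * cs.simple i * cs.simple j) * cs.simple i by
        simp only [mul_assoc], e4]
      simp [mul_assoc]
    have := length_mul_simples_le (cs := cs) v4 j i j
    rw [e5] at h
    omega
  have hadj : (i : ℕ) + 1 = j ∨ (j : ℕ) + 1 = i := by omega
  have e3 := simple_braid (cs := cs) hi hj0 hadj
  have t1 : ∀ k : ℕ, 0 < k → sgnFun k k = k + 1 ∧ sgnFun k (k + 1) = k := by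
    intro k hk; unfold sgnFun; grind
  have t2 : ∀ k : ℕ, 0 < k → sgnFun k (k + 1 + 1) = k + 1 + 1 ∧ sgnFun (k + 1) k = k := by
    intro k hk; unfold sgnFun; grind
  rcases step v (by omega) i with h1 | ⟨v2, rfl, h2, h3⟩
  · rcases hadj with ha | ha
    · rw [← ha] at hvj ⊢
      push_cast at hvj
      have := (t1 (i + 1) (by omega)).1
      push_cast at this
      rw [(t2 i hi).2, this]
      omega
    · rw [← ha] at h1 ⊢
      push_cast at h1 ⊢
      rw [(t1 j hj0).2, (t2 j hj0).1]
      omega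
  rcases step v2 (by omega) j with h1 | ⟨v3, rfl, h4, h5⟩
  · rw [sgn_mul_simple, sgn_mul_simple]
    rcases hadj with ha | ha
    · rw [← ha] at h1 ⊢
      push_cast at h1
      have := (t1 (i + 1) (by omega)).1
      push_cast at this
      rw [(t2 i hi).2, this, (t1 i hi).1, (t2 i hi).1]
      exact h1
    · rw [← ha]
      have := (t1 (j + 1) (by omega)).2
      push_cast at this ⊢
      rw [(t1 j hj0).2, (t2 j hj0).1, (t2 j hj0).2, this]
      exact h1
  exfalso
  have e5 : v3 * cs.simple j * cs.simple i * cs.simple j * cs.simple i =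
      v3 * cs.simple i * cs.simple j := by
    rw [show v3 * cs.simple j * cs.simple i * cs.simple j * cs.simple i =
      v3 * (cs.simple j * cs.simple i * cs.simple j) * cs.simple i by simp only [mul_assoc], ← e3]
    simp [mul_assoc]
  have := length_mul_simples_le (cs := cs) v3 i j j
  rw [e5] at h
  omega

/-- The right descents of `w` are its descents as a signed permutation. -/
lemma descent_iff (w : W) (i : Fin n) :
    cs.length (w * cs.simple i) < cs.length w ↔ sgn cs w (i + 1) < sgn cs w i := by
  rcases length_mul_simple_lt_or (cs := cs) w i with h | h
  · refine iff_of_true h ?_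
    obtain ⟨v, rfl, -, hv⟩ := exists_eq_mul_simple h
    have h1 := sgn_lt_of_not_descent v i hv
    have e1 : (sgnFun i i = i + 1 ∧ sgnFun i (i + 1) = i) ∨ ((i : ℕ) = 0) := by
      unfold sgnFun; grind
    rw [sgn_mul_simple, sgn_mul_simple]
    rcases e1 with ⟨e1, e2⟩ | e1
    · rwa [e1, e2]
    · rw [e1] at h1 ⊢
      have e2 : sgnFun 0 (0 + 1) = -1 := by decide
      have e3 : sgnFun 0 0 = 0 := by decide
      rw [Nat.cast_zero, zero_add, sgn_zero] at h1
      rw [Nat.cast_zero, e2, e3, sgn_neg, sgn_zero]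
      omega
  · exact iff_of_false (by omega) (by have := sgn_lt_of_not_descent w i h; omega)

lemma noDescent_iff (w : W) (i : Fin n) :
    cs.length w < cs.length (w * cs.simple i) ↔ sgn cs w i < sgn cs w (i + 1) := by
  have h1 := descent_iff (cs := cs) w i
  have h2 := cs.length_mul_simple_ne w i
  have h3 : sgn cs w i ≠ sgn cs w (i + 1) := fun e => by
    have := (sgn cs w).injective e; omega
  constructor <;> intro h
  · by_contra hc
    have := h1.2 (by omega)
    omega
  · by_contra hc
    have := h1.1 (by omega)
    omega

variable (cs) in
-- A nontrivial element has a right descent, whereas the identity permutation is increasing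
-- everywhere.
lemma sgn_injective : Function.Injective (sgn cs) := by
  rw [injective_iff_map_eq_one]
  intro w hw
  by_contra h
  obtain ⟨j, hj⟩ := cs.exists_rightDescent_of_ne_one h
  have := (descent_iff w j).1 hj
  rw [hw] at this
  simp only [Equiv.Perm.coe_one, id] at this
  omega

/-- A signed permutation of this kind is odd and fixes every `x > n`, so it preserves `[-n, n]` and
is determined by its restriction there. -/
lemma finite_typeB (cs : CoxeterSystem (typeB n) W) : Finite W := by
  have hb : ∀ (w : W) (x : ℤ), x ∈ Set.Icc (-n : ℤ) n → sgn cs w x ∈ Set.Icc (-n : ℤ) n := by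
    intro w x hx
    by_contra hc
    rw [Set.mem_Icc] at hx hc
    have h1 : ∀ y : ℤ, n < y → sgn cs w y = y := fun y => sgn_of_gt w
    rcases lt_or_ge (n : ℤ) (sgn cs w x) with h | h
    · have := (sgn cs w).injective (h1 _ h)
      omega
    · have h2 := h1 (-sgn cs w x) (by omega)
      rw [← sgn_neg] at h2
      have := (sgn cs w).injective h2
      rw [sgn_neg] at this
      omega
  have : Finite (Set.Icc (-n : ℤ) n) := (Set.finite_Icc _ _).to_subtype
  refine Finite.of_injective
    (fun w => (fun x : Set.Icc (-n : ℤ) n => (⟨sgn cs w x, hb w x x.2⟩ : Set.Icc (-n : ℤ) n))) ?_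
  intro w w' h
  apply sgn_injective cs
  have key : ∀ x : ℤ, 0 ≤ x → sgn cs w x = sgn cs w' x := by
    intro x hx
    rcases lt_or_ge (n : ℤ) x with h1 | h1
    · rw [sgn_of_gt w h1, sgn_of_gt w' h1]
    · have := congrFun h ⟨x, by omega, h1⟩
      simpa using this
  ext x
  rcases le_or_gt 0 x with hx | hx
  · exact key x hx
  · have := key (-x) (by omega)
    rw [sgn_neg, sgn_neg] at this
    omega

variable (cs) in
-- If `s_i = s_j`, then `j` is a descent of `s_i`; but as a signed permutation `s_i` is decreasing
-- only at position `i`.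
lemma simple_injective_typeB : Function.Injective cs.simple := by
  intro i j h
  have h2 : cs.length (cs.simple i * cs.simple j) < cs.length (cs.simple i) := by simp [h]
  have h2 := (descent_iff (cs.simple i) j).1 h2
  rw [sgn_simple] at h2
  by_contra hne
  have hne : (i : ℕ) ≠ j := fun e => hne (Fin.ext e)
  simp only [sgnPerm_apply] at h2
  have : sgnFun i j < sgnFun i (j + 1) := by
    rcases Nat.eq_zero_or_pos (i : ℕ) with hi | hi
    · rw [hi] at hne ⊢
      have h3 := sgnFun_zero_spec (x := j) rfl
      have h4 := sgnFun_zero_spec (x := j + 1) rfl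
      omega
    · have h3 := sgnFun_spec hi (x := j) rfl
      have h4 := sgnFun_spec hi (x := j + 1) rfl
      omega
  omega

end SignedPerm

end CoxeterB

namespace CoxeterB

section Blocks

/-! ### Longest elements of parabolic subgroups of type `B` -/

variable {n : ℕ} {W : Type*} [Group W] {cs : CoxeterSystem (typeB n) W}

/-- `[a, b]` is a union of blocks of `A`: neither `a - 1` nor `b` belongs to `A`. -/
def IsCut (A : Set (Fin n)) (a b : ℕ) : Prop := ∀ j ∈ A, (j : ℕ) + 1 ≠ a ∧ (j : ℕ) ≠ b

/-- `[a, b]` is a block of `A`. -/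
def IsBlock (A : Set (Fin n)) (a b : ℕ) : Prop :=
  b ≤ n ∧ IsCut A a b ∧ ∀ j : Fin n, a ≤ j → (j : ℕ) < b → j ∈ A

/-- No generator from `A` crosses an end of the interval. Positivity of `a` keeps the interval away
from its opposite. -/
lemma IsCut.sgn_mem {A : Set (Fin n)} {a b : ℕ} (h : IsCut A a b) (ha : 0 < a) {w : W}
    (hw : w ∈ parabolic cs A) {x : ℤ} (hx : a ≤ x ∧ x ≤ b) :
    a ≤ sgn cs w x ∧ sgn cs w x ≤ b := by
  induction hw using Subgroup.closure_induction_left with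
  | one => simpa
  | mul_left y hy z _ ih =>
    obtain ⟨j, hj, rfl⟩ := hy
    rw [sgn_mul_apply, sgn_simple, sgnPerm_apply]
    have := h j hj
    generalize sgn cs z x = y at *
    unfold sgnFun; grind
  | inv_mul_cancel y hy z _ ih =>
    obtain ⟨j, hj, rfl⟩ := hy
    rw [cs.inv_simple, sgn_mul_apply, sgn_simple, sgnPerm_apply]
    have := h j hj
    generalize sgn cs z x = y at *
    unfold sgnFun; grind

/-- The first block may contain `s_0`, which changes signs, so the invariant set has to be the
symmetric interval. -/
lemma IsCut.sgn_mem_zero {A : Set (Fin n)} {b : ℕ} (h : IsCut A 0 b) {w : W}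
    (hw : w ∈ parabolic cs A) {x : ℤ} (hx : -b ≤ x ∧ x ≤ b) :
    -b ≤ sgn cs w x ∧ sgn cs w x ≤ b := by
  induction hw using Subgroup.closure_induction_left with
  | one => simpa
  | mul_left y hy z _ ih =>
    obtain ⟨j, hj, rfl⟩ := hy
    rw [sgn_mul_apply, sgn_simple, sgnPerm_apply]
    have := h j hj
    generalize sgn cs z x = y at *
    unfold sgnFun; grind
  | inv_mul_cancel y hy z _ ih =>
    obtain ⟨j, hj, rfl⟩ := hy
    rw [cs.inv_simple, sgn_mul_apply, sgn_simple, sgnPerm_apply]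
    have := h j hj
    generalize sgn cs z x = y at *
    unfold sgnFun; grind

lemma add_sub_le_of_decreasing {f : ℤ → ℤ} {a b : ℤ} (h : ∀ x, a ≤ x → x < b → f (x + 1) < f x)
    {x y : ℤ} (hx : a ≤ x) (hxy : x ≤ y) (hy : y ≤ b) : f y + (y - x) ≤ f x := by
  induction y, hxy using Int.leInduction with
  | base => simp
  | succ y hy' ih =>
    have h1 := ih (by omega)
    have h2 := h y (by omega) (by omega)
    omega

variable [Finite W]

lemma IsBlock.wl_decreasing {A : Set (Fin n)} {a b : ℕ} (h : IsBlock A a b) {x : ℤ} (hx : a ≤ x)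
    (hxb : x < b) : sgn cs (wl cs A) (x + 1) < sgn cs (wl cs A) x := by
  lift x to ℕ using by omega
  have := h.1
  have := (descent_iff (wl cs A) ⟨x, by omega⟩).1
    (wl_mul_simple_lt (h.2.2 ⟨x, by omega⟩ (by simpa using hx) (by simpa using hxb)))
  simpa using this

/-- All positions inside the block are descents, so `w_A` is strictly decreasing there. A strictly
decreasing self-map of an integer interval is its reversal. -/
lemma IsBlock.sgn_wl {A : Set (Fin n)} {a b : ℕ} (h : IsBlock A a b) (ha : 0 < a) {x : ℤ}
    (hx : a ≤ x ∧ x ≤ b) : sgn cs (wl cs A) x = a + b - x := by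
  have h1 := add_sub_le_of_decreasing (fun x => h.wl_decreasing (cs := cs)) le_rfl hx.1 hx.2
  have h2 := add_sub_le_of_decreasing (fun x => h.wl_decreasing (cs := cs)) hx.1 hx.2 le_rfl
  have h3 := h.2.1.sgn_mem ha (wl_mem (cs := cs) A) (x := a) (by omega)
  have h4 := h.2.1.sgn_mem ha (wl_mem (cs := cs) A) (x := b) (by omega)
  omega

/-- On `[0, b]` the map decreases strictly from `0` and stays at least `-b`, which leaves only `-x`;
oddness gives the negative half. -/
lemma IsBlock.sgn_wl_zero {A : Set (Fin n)} {b : ℕ} (h : IsBlock A 0 b) {x : ℤ}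
    (hx : -b ≤ x ∧ x ≤ b) : sgn cs (wl cs A) x = - x := by
  have key : ∀ x : ℤ, 0 ≤ x → x ≤ b → sgn cs (wl cs A) x = - x := by
    intro x hx hx'
    have h1 := add_sub_le_of_decreasing (a := 0)
      (fun x hx => h.wl_decreasing (cs := cs) (by simpa using hx)) le_rfl hx hx'
    have h2 := add_sub_le_of_decreasing (a := 0)
      (fun x hx => h.wl_decreasing (cs := cs) (by simpa using hx)) hx hx' le_rfl
    have h4 := h.2.1.sgn_mem_zero (wl_mem (cs := cs) A) (x := b) (by omega)
    rw [sgn_zero] at h1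
    omega
  rcases le_or_gt 0 x with h0 | h0
  · exact key x h0 hx.2
  · have := key (-x) (by omega) (by omega)
    rw [sgn_neg] at this
    omega

end Blocks

end CoxeterB

namespace CoxeterB

section Labels

/-! ### Sequences and their parabolic subsets -/

lemma swapAdj_swapAdj (i : ℕ) (l : List ℕ) : swapAdj i (swapAdj i l) = l := by
  induction l generalizing i with
  | nil => cases i <;> rfl
  | cons a l ih =>
    cases i with
    | zero => cases l <;> rfl
    | succ i => simp [swapAdj, ih]

/-- Exchanging two neighbours affects a single partial sum. Its old and new values are placed
symmetrically between the neighbouring partial sums, whence the additive form without subtraction.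
-/
lemma sum_take_swapAdj {i : ℕ} {l : List ℕ} (hi : i + 1 < l.length) (m : ℕ) :
    (((swapAdj i l).take m).sum = (l.take m).sum ∨ m = i + 1) ∧
      ((swapAdj i l).take (i + 1)).sum + (l.take (i + 1)).sum =
        (l.take i).sum + (l.take (i + 2)).sum := by
  induction l generalizing i m with
  | nil => simp at hi
  | cons a l ih =>
    cases i with
    | zero =>
      cases l with
      | nil => simp at hi
      | cons b l =>
        simp only [swapAdj]
        refine ⟨?_, by simp; ring⟩
        rcases m with _ | _ | m
        · simp
        · simp
        · left
          simp only [List.take_succ_cons, List.sum_cons]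
          ring
    | succ i =>
      have hi' : i + 1 < l.length := by simpa using hi
      constructor
      · rcases m with _ | m
        · simp
        · have := (ih hi' m).1
          simp only [swapAdj, List.take_succ_cons, List.sum_cons]
          omega
      · have := (ih hi' 0).2
        simp only [swapAdj, List.take_succ_cons, List.sum_cons]
        omega

namespace LabelSeq

variable {n : ℕ}

/-- The sum of the first `m` entries of a sequence. -/
def start (c : LabelSeq n) (m : ℕ) : ℕ := c.seq.sizeUpTo m

/-- The number of entries of a sequence. -/
abbrev len (c : LabelSeq n) : ℕ := c.seq.length

variable (c : LabelSeq n)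

@[simp] lemma start_zero : c.start 0 = 0 := c.seq.sizeUpTo_zero

lemma start_len : c.start c.len = n + 1 := c.seq.sizeUpTo_length

lemma start_lt_succ {m : ℕ} (h : m < c.len) : c.start m < c.start (m + 1) :=
  c.seq.sizeUpTo_strict_mono h

lemma start_mono : Monotone c.start := c.seq.monotone_sizeUpTo

lemma start_lt {m m' : ℕ} (h : m < m') (h' : m < c.len) : c.start m < c.start m' :=
  (c.start_lt_succ h').trans_le (c.start_mono h)

lemma start_le (m : ℕ) : c.start m ≤ n + 1 := c.seq.sizeUpTo_le m

lemma start_pos {m : ℕ} (h : 0 < m) : 0 < c.start m := by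
  have := c.start_lt h (by rw [len, Composition.length_pos_iff]; omega)
  omega

/-- The element number `i` of `S ∖ J`, where `J` is the parabolic subset of the sequence. -/
def gap (i : ℕ) (hi : i + 1 < c.len) : Fin n := ⟨c.start (i + 1) - 1, by
  have := c.start_lt hi hi
  rw [c.start_len] at this
  have := c.start_pos (m := i + 1) (by omega)
  omega⟩

/-- The reflection `s_j` separates `j` from `j + 1`, so the reflection between blocks `i` and `i +
1` is numbered one less than the first position of block `i + 1`. This form avoids truncated
subtraction. -/
lemma gap_add_one (i : ℕ) (hi : i + 1 < c.len) : (c.gap i hi : ℕ) + 1 = c.start (i + 1) := by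
  have := c.start_pos (m := i + 1) (by omega)
  simp only [gap]
  omega

lemma gap_lt_gap {i j : ℕ} (hi : i + 1 < c.len) (hj : j + 1 < c.len) (h : i < j) :
    c.gap i hi < c.gap j hj := by
  have h1 := c.gap_add_one i hi
  have h2 := c.gap_add_one j hj
  have h3 := c.start_lt (show i + 1 < j + 1 by omega) hi
  rw [Fin.lt_def]
  omega

lemma gap_injective {i j : ℕ} (hi : i + 1 < c.len) (hj : j + 1 < c.len)
    (h : c.gap i hi = c.gap j hj) : i = j := by
  rcases Nat.lt_trichotomy i j with h1 | h1 | h1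
  · exact absurd h (c.gap_lt_gap hi hj h1).ne
  · exact h1
  · exact absurd h (c.gap_lt_gap hj hi h1).ne'

/-- Two neighbouring positions are in the same block unless the second one starts a block; this
trades block indices for partial sums. -/
lemma mem_parabolicSubset {j : Fin n} : j ∈ c.parabolicSubset ↔
    ∀ m, m + 1 < c.len → c.start (m + 1) ≠ j + 1 := by
  have h1 := c.seq.lt_sizeUpTo_index_succ j.castSucc
  have h2 := c.seq.sizeUpTo_index_le j.castSucc
  have h3 := c.seq.lt_sizeUpTo_index_succ j.succ
  have h4 := c.seq.sizeUpTo_index_le j.succ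
  have h5 := (c.seq.index j.succ).2
  change _ < c.len at h5
  simp only [Fin.val_castSucc, Fin.val_succ] at h1 h2 h3 h4
  change _ < c.start _ at h1
  change c.start _ ≤ _ at h2
  change _ < c.start _ at h3
  change c.start _ ≤ _ at h4
  rw [LabelSeq.parabolicSubset, Set.mem_ofPred_eq, Fin.ext_iff]
  generalize (c.seq.index j.castSucc : ℕ) = p at *
  generalize (c.seq.index j.succ : ℕ) = q at *
  constructor
  · rintro rfl m hm hs
    rcases Nat.lt_or_ge m p with h6 | h6
    · have := c.start_mono (show m + 1 ≤ p from h6)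
      omega
    · have := c.start_mono (show p + 1 ≤ m + 1 by omega)
      omega
  · intro h
    by_contra hne
    rcases Nat.lt_or_ge p q with h6 | h6
    · have := c.start_mono (show p + 1 ≤ q from h6)
      exact h p (by omega) (by omega)
    · have := c.start_mono (show q + 1 ≤ p by omega)
      omega

lemma notMem_parabolicSubset {j : Fin n} : j ∉ c.parabolicSubset ↔
    ∃ m, ∃ hm : m + 1 < c.len, c.gap m hm = j := by
  rw [mem_parabolicSubset]
  push Not
  refine exists_congr fun m => ?_
  constructor
  · rintro ⟨hm, e⟩
    refine ⟨hm, Fin.ext ?_⟩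
    have := c.gap_add_one m hm
    omega
  · rintro ⟨hm, rfl⟩
    exact ⟨hm, (c.gap_add_one m hm).symm⟩

lemma gap_notMem (i : ℕ) (hi : i + 1 < c.len) : c.gap i hi ∉ c.parabolicSubset :=
  c.notMem_parabolicSubset.2 ⟨i, hi, rfl⟩

lemma ncard_gap (i : ℕ) (hi : i + 1 < c.len) :
    {j | j ∉ c.parabolicSubset ∧ j < c.gap i hi}.ncard = i := by
  have h1 : {j | j ∉ c.parabolicSubset ∧ j < c.gap i hi} =
      Set.range fun m : Fin i => c.gap m (by have := m.2; omega) := by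
    ext j
    simp only [Set.mem_ofPred_eq, Set.mem_range, notMem_parabolicSubset]
    constructor
    · rintro ⟨⟨m, hm, rfl⟩, hj⟩
      refine ⟨⟨m, ?_⟩, rfl⟩
      by_contra hc
      rcases Nat.lt_or_ge i m with h | h
      · exact absurd hj (c.gap_lt_gap hi hm h).asymm
      · obtain rfl : i = m := by omega
        exact hj.ne rfl
    · rintro ⟨m, rfl⟩
      exact ⟨⟨m, _, rfl⟩, c.gap_lt_gap _ hi m.2⟩
  rw [h1, ← Set.image_univ, Set.ncard_image_of_injective]
  · simp
  · intro a b h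
    exact Fin.ext (c.gap_injective _ _ h)

/-- A composition is determined by its boundaries, and these are `0`, `n + 1` and the `j + 1` for
`s_j` outside the subset. -/
lemma parabolicSubset_injective :
    Function.Injective (LabelSeq.parabolicSubset : LabelSeq n → Set (Fin n)) := by
  have key : ∀ c : LabelSeq n, ∀ x : Fin (n + 1 + 1), x ∈ c.seq.boundaries ↔
      (x : ℕ) = 0 ∨ (x : ℕ) = n + 1 ∨ ∃ j : Fin n, j ∉ c.parabolicSubset ∧ (x : ℕ) = j + 1 := by
    intro c x
    have : x ∈ c.seq.boundaries ↔ ∃ m : Fin (c.len + 1), c.start m = x := by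
      simp only [Composition.boundaries, Finset.mem_map, Finset.mem_univ, true_and]
      exact exists_congr fun m => Fin.ext_iff
    rw [this]
    constructor
    · rintro ⟨⟨m, hm⟩, e⟩
      rcases m with _ | m
      · left; simpa using e.symm
      rcases Nat.lt_or_ge (m + 1) c.len with h | h
      · right; right
        exact ⟨c.gap m h, c.gap_notMem m h, by rw [c.gap_add_one]; exact e.symm⟩
      · right; left
        have : m + 1 = c.len := by omega
        simp only [this, start_len] at e
        exact e.symm
    · rintro (e | e | ⟨j, hj, e⟩)
      · exact ⟨0, by simp [e]⟩
      · exact ⟨Fin.last _, by simp [e, start_len]⟩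
      · obtain ⟨m, hm, rfl⟩ := c.notMem_parabolicSubset.1 hj
        exact ⟨⟨m + 1, by omega⟩, by rw [e, c.gap_add_one]⟩
  intro c c' h
  have hb : c.seq.boundaries = c'.seq.boundaries := by
    ext x
    rw [key, key, h]
  apply LabelSeq.ext
  apply (compositionEquiv (n + 1)).injective
  exact CompositionAsSet.ext hb

/-- Injectivity suffices, since both sides have `2 ^ n` elements. -/
lemma parabolicSubset_bijective :
    Function.Bijective (LabelSeq.parabolicSubset : LabelSeq n → Set (Fin n)) := by
  have e : LabelSeq n ≃ Composition (n + 1) := ⟨LabelSeq.seq, LabelSeq.mk, fun _ => rfl, fun _ => rfl⟩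
  have : Finite (LabelSeq n) := Finite.of_equiv _ e.symm
  refine parabolicSubset_injective.bijective_of_nat_card_le ?_
  rw [Nat.card_congr e, Nat.card_eq_fintype_card, Nat.card_eq_fintype_card, composition_card,
    Fintype.card_set, Fintype.card_fin]
  simp

lemma act_zero : c.act 0 = c := rfl

lemma act_blocks {i : ℕ} (h : i ≠ 0) : (c.act i).seq.blocks = swapAdj i c.seq.blocks := by
  rw [act, if_neg h]

lemma act_act (i : ℕ) : (c.act i).act i = c := by
  rcases eq_or_ne i 0 with rfl | h
  · rfl
  · apply LabelSeq.ext
    apply Composition.ext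
    rw [act_blocks _ h, act_blocks _ h, swapAdj_swapAdj]

lemma len_act (i : ℕ) : (c.act i).len = c.len := by
  rcases eq_or_ne i 0 with rfl | h
  · rfl
  · rw [len, ← Composition.blocks_length, act_blocks _ h, (swapAdj_perm _ _).length_eq,
      Composition.blocks_length]

lemma start_act {i m : ℕ} (hi : i + 1 < c.len) (h : m ≠ i + 1) : (c.act i).start m = c.start m := by
  rcases eq_or_ne i 0 with rfl | h0
  · rfl
  · simp only [start, Composition.sizeUpTo, act_blocks _ h0]
    exact (sum_take_swapAdj hi m).1.resolve_right h

lemma start_act_self {i : ℕ} (hi : i + 1 < c.len) (h0 : i ≠ 0) :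
    (c.act i).start (i + 1) + c.start (i + 1) = c.start i + c.start (i + 2) := by
  simp only [start, Composition.sizeUpTo, act_blocks _ h0]
  exact (sum_take_swapAdj hi 0).2

lemma mem_insert_gap {i : ℕ} (hi : i + 1 < c.len) {j : Fin n} :
    j ∈ insert (c.gap i hi) c.parabolicSubset ↔
      ∀ m, m + 1 < c.len → m ≠ i → c.start (m + 1) ≠ j + 1 := by
  rw [Set.mem_insert_iff, mem_parabolicSubset]
  constructor
  · rintro (rfl | h) m hm hmi
    · rw [c.gap_add_one]
      intro e
      apply hmi
      apply c.gap_injective hm hi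
      apply Fin.ext
      have := c.gap_add_one m hm
      have := c.gap_add_one i hi
      omega
    · exact h m hm
  · intro h
    by_cases hj : c.start (i + 1) = j + 1
    · left
      apply Fin.ext
      have := c.gap_add_one i hi
      omega
    · right
      intro m hm
      rcases eq_or_ne m i with rfl | hmi
      · exact hj
      · exact h m hm hmi

/-- Adding `d_i` to `J` forgets the start of block `i + 1`, the only one that the exchange can move.
So an arrow and its reverse live in the same `M`. -/
lemma insert_gap_act {i : ℕ} (hi : i + 1 < c.len) (hi' : i + 1 < (c.act i).len) :
    insert ((c.act i).gap i hi') (c.act i).parabolicSubset =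
      insert (c.gap i hi) c.parabolicSubset := by
  ext j
  rw [mem_insert_gap, mem_insert_gap, len_act]
  refine forall_congr' fun m => forall_congr' fun _ => forall_congr' fun hm => ?_
  rw [start_act _ hi (by omega)]

lemma parabolicSubset_act {i : ℕ} (hi : i + 1 < c.len) (hi' : i + 1 < (c.act i).len) :
    (c.act i).parabolicSubset =
      insert (c.gap i hi) c.parabolicSubset \ {(c.act i).gap i hi'} := by
  rw [← insert_gap_act c hi hi', Set.insert_sdiff_self_of_notMem (gap_notMem _ _ _)]

/-- The blocks of a sequence are blocks of its parabolic subset. -/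
lemma isBlock {m b : ℕ} (hm : m < c.len) (hb : b + 1 = c.start (m + 1)) :
    IsBlock c.parabolicSubset (c.start m) b := by
  refine ⟨by have := c.start_le (m + 1); omega, fun j hj => ?_, fun j h1 h2 => ?_⟩
  · rw [mem_parabolicSubset] at hj
    have := j.2
    constructor
    · intro e
      rcases m with _ | m
      · simp at e
      · exact hj m (by omega) e.symm
    · rintro rfl
      rcases Nat.lt_or_ge (m + 1) c.len with h | h
      · exact hj m h hb.symm
      · rw [show m + 1 = c.len by omega, start_len] at hb
        omega
  · rw [mem_parabolicSubset]
    intro m' hm' e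
    rcases Nat.lt_or_ge m' m with h | h
    · have := c.start_mono (show m' + 1 ≤ m from h)
      omega
    · have := c.start_mono (show m + 1 ≤ m' + 1 by omega)
      omega

/-- The blocks of a sequence other than those number `i` and `i + 1` are blocks of `J ∪ {d_i}`. -/
lemma isBlock_insert {i m b : ℕ} (hi : i + 1 < c.len) (hm : m < c.len)
    (hb : b + 1 = c.start (m + 1)) (h1 : m ≠ i) (h2 : m ≠ i + 1) :
    IsBlock (insert (c.gap i hi) c.parabolicSubset) (c.start m) b := by
  have h := c.isBlock hm hb
  refine ⟨h.1, fun j hj => ?_, fun j h3 h4 => .inr (h.2.2 j h3 h4)⟩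
  rcases hj with rfl | hj
  · rw [c.gap_add_one]
    have h3 := c.gap_add_one i hi
    constructor
    · intro e
      rcases Nat.lt_or_ge (i + 1) m with h4 | h4
      · have := c.start_lt h4 hi
        omega
      · have := c.start_lt (show m < i + 1 by omega) hm
        omega
    · intro e
      have e : c.start (i + 1) = c.start (m + 1) := by omega
      rcases Nat.lt_or_ge i m with h4 | h4
      · have := c.start_lt (show i + 1 < m + 1 by omega) hi
        omega
      · have := c.start_lt (show m + 1 < i + 1 by omega) (by omega)
        omega
  · exact h.2.1 j hj

/-- The blocks number `i` and `i + 1` of a sequence are merged in `J ∪ {d_i}`. -/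
lemma isBlock_merged {i b : ℕ} (hi : i + 1 < c.len) (hb : b + 1 = c.start (i + 2)) :
    IsBlock (insert (c.gap i hi) c.parabolicSubset) (c.start i) b := by
  have h1 := c.isBlock (m := i + 1) hi hb
  have h3 := c.gap_add_one i hi
  have h2 := c.isBlock (m := i) (b := c.gap i hi) (by omega) h3
  have h4 := c.start_lt_succ (m := i) (by omega)
  have h5 := c.start_lt_succ (m := i + 1) (by omega)
  rw [show i + 1 + 1 = i + 2 from rfl] at h5
  refine ⟨h1.1, fun j hj => ?_, fun j h6 h7 => ?_⟩
  · rcases hj with rfl | hj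
    · omega
    · exact ⟨(h2.2.1 j hj).1, (h1.2.1 j hj).2⟩
  · rcases Nat.lt_trichotomy j (c.gap i hi) with h | h | h
    · exact .inr (h2.2.2 j h6 h)
    · exact .inl (Fin.ext h)
    · exact .inr (h1.2.2 j (by omega) h7)

lemma exists_block {x : ℕ} (hx : x ≤ n) : ∃ m < c.len, c.start m ≤ x ∧ x < c.start (m + 1) :=
  ⟨_, (c.seq.index ⟨x, by omega⟩).2, c.seq.sizeUpTo_index_le ⟨x, by omega⟩,
    c.seq.lt_sizeUpTo_index_succ ⟨x, by omega⟩⟩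

end LabelSeq

end Labels

end CoxeterB

namespace CoxeterB

section Cross

/-! ### The atomic elements of type `B` -/

variable {n : ℕ} {W : Type*} [Group W] {cs : CoxeterSystem (typeB n) W} [Finite W]

open LabelSeq

variable (cs) in
/-- The core element of the atomic coset `a_i^J`, where `J` is the parabolic subset of `c`. -/
noncomputable def cross (c : LabelSeq n) (i : ℕ) (hi : i + 1 < c.len) : W :=
  wl cs (insert (c.gap i hi) c.parabolicSubset) * wl cs c.parabolicSubset

variable (c : LabelSeq n) {i : ℕ} (hi : i + 1 < c.len)

lemma sgn_cross (x : ℤ) : sgn cs (cross cs c i hi) x =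
    sgn cs (wl cs (insert (c.gap i hi) c.parabolicSubset)) (sgn cs (wl cs c.parabolicSubset) x) :=
  sgn_mul_apply _ _ _

/-- First `w_J` reverses the block, then `w_M` reverses the two merged blocks; the composite of two
reversals is a translation. -/
lemma sgn_cross_left (h0 : i ≠ 0) {x : ℤ} (h1 : c.start i ≤ x) (h2 : x < c.start (i + 1)) :
    sgn cs (cross cs c i hi) x = x + c.start (i + 2) - c.start (i + 1) := by
  have h3 := c.start_pos (m := i) (by omega)
  have h4 := c.start_lt_succ (m := i + 1) hi
  rw [show i + 1 + 1 = i + 2 from rfl] at h4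
  obtain ⟨b, hb⟩ : ∃ b, b + 1 = c.start (i + 1) := ⟨c.start (i + 1) - 1, by omega⟩
  obtain ⟨b', hb'⟩ : ∃ b, b + 1 = c.start (i + 2) := ⟨c.start (i + 2) - 1, by omega⟩
  have e1 := (c.isBlock (m := i) (by omega) hb).sgn_wl (cs := cs) h3 (x := x) (by omega)
  have e2 := (c.isBlock_merged hi hb').sgn_wl (cs := cs) h3 (x := c.start i + b - x) (by omega)
  rw [sgn_cross, e1, e2]
  omega

lemma sgn_cross_right (h0 : i ≠ 0) {x : ℤ} (h1 : c.start (i + 1) ≤ x) (h2 : x < c.start (i + 2)) :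
    sgn cs (cross cs c i hi) x = x + c.start i - c.start (i + 1) := by
  have h3 := c.start_pos (m := i) (by omega)
  have h4 := c.start_lt_succ (m := i) (by omega)
  obtain ⟨b', hb'⟩ : ∃ b, b + 1 = c.start (i + 2) := ⟨c.start (i + 2) - 1, by omega⟩
  have e1 := (c.isBlock (m := i + 1) (by omega) hb').sgn_wl (cs := cs) (by omega) (x := x) (by omega)
  have e2 := (c.isBlock_merged hi hb').sgn_wl (cs := cs) h3 (x := c.start (i + 1) + b' - x)
    (by omega)
  rw [sgn_cross, e1, e2]
  omega

/-- The merged block contains `0`, so `w_M` acts on it as `-1`. After the reversal of block `1` by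
`w_J`, the result is a translation of that block onto its opposite. -/
lemma sgn_cross_zero (hi : 0 + 1 < c.len) {x : ℤ} (h1 : c.start 1 ≤ x) (h2 : x < c.start 2) :
    sgn cs (cross cs c 0 hi) x = x + 1 - c.start 1 - c.start 2 := by
  have h3 := c.start_pos (m := 1) (by omega)
  obtain ⟨b', hb'⟩ : ∃ b, b + 1 = c.start 2 := ⟨c.start 2 - 1, by omega⟩
  have e1 := (c.isBlock (m := 1) (by omega) hb').sgn_wl (cs := cs) (by omega) (x := x) (by omega)
  have hb := c.isBlock_merged hi hb'
  rw [start_zero] at hb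
  have e2 := hb.sgn_wl_zero (cs := cs) (x := c.start 1 + b' - x) (by omega)
  rw [sgn_cross, e1, e2]
  omega

lemma sgn_wl_wl_of_isBlock {A A' : Set (Fin n)} {a b : ℕ} (h : IsBlock A a b) (h' : IsBlock A' a b)
    {x : ℤ} (hx : a ≤ x ∧ x ≤ b) : sgn cs (wl cs A') (sgn cs (wl cs A) x) = x := by
  rcases Nat.eq_zero_or_pos a with rfl | ha
  · rw [h.sgn_wl_zero (by omega), h'.sgn_wl_zero (by omega), neg_neg]
  · rw [h.sgn_wl ha hx, h'.sgn_wl ha (by omega)]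
    omega

lemma sgn_cross_of_lt {x : ℤ} (h0 : 0 ≤ x) (h : x < c.start i) :
    sgn cs (cross cs c i hi) x = x := by
  lift x to ℕ using h0
  have := c.start_le i
  obtain ⟨m, hm, h1, h2⟩ := c.exists_block (x := x) (by omega)
  have hmi : m < i := by
    by_contra hc
    have := c.start_mono (not_lt.1 hc)
    omega
  obtain ⟨b, hb⟩ : ∃ b, b + 1 = c.start (m + 1) := ⟨c.start (m + 1) - 1, by omega⟩
  rw [sgn_cross]
  exact sgn_wl_wl_of_isBlock (c.isBlock hm hb)
    (c.isBlock_insert hi hm hb (by omega) (by omega)) (by omega)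

lemma sgn_cross_of_ge {x : ℤ} (h : c.start (i + 2) ≤ x) :
    sgn cs (cross cs c i hi) x = x := by
  lift x to ℕ using by omega
  rcases Nat.lt_or_ge n x with hx | hx
  · exact sgn_of_gt _ (by omega)
  obtain ⟨m, hm, h1, h2⟩ := c.exists_block (x := x) (by omega)
  have hmi : i + 2 ≤ m := by
    by_contra hc
    have := c.start_mono (show m + 1 ≤ i + 2 by omega)
    omega
  obtain ⟨b, hb⟩ : ∃ b, b + 1 = c.start (m + 1) := ⟨c.start (m + 1) - 1, by omega⟩
  rw [sgn_cross]
  exact sgn_wl_wl_of_isBlock (c.isBlock hm hb)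
    (c.isBlock_insert hi hm hb (by omega) (by omega)) (by omega)

/-- For `i = 0` the block before the cut is the symmetric one, on which `w_J` and `w_M` both act as
`-1` and cancel. -/
lemma sgn_cross_zero_of_lt (hi : 0 + 1 < c.len) {x : ℤ} (h0 : 0 ≤ x) (h : x < c.start 1) :
    sgn cs (cross cs c 0 hi) x = x := by
  have h3 := c.start_lt (show 1 < 2 by omega) hi
  obtain ⟨b, hb⟩ : ∃ b, b + 1 = c.start 1 := ⟨c.start 1 - 1, by omega⟩
  obtain ⟨b', hb'⟩ : ∃ b, b + 1 = c.start 2 := ⟨c.start 2 - 1, by omega⟩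
  have h1 := c.isBlock (m := 0) (by omega) hb
  have h2 := c.isBlock_merged hi hb'
  rw [start_zero] at h1 h2
  rw [sgn_cross, h1.sgn_wl_zero (by omega), h2.sgn_wl_zero (by omega), neg_neg]

/-- Conjugation by the longest element of `J ∪ {d_i}` exchanges `d_i` with the corresponding
element for the sequence obtained by exchanging two entries. -/
lemma wl_mul_gap (hi' : i + 1 < (c.act i).len) :
    wl cs (insert (c.gap i hi) c.parabolicSubset) * cs.simple (c.gap i hi) =
      cs.simple ((c.act i).gap i hi') * wl cs (insert (c.gap i hi) c.parabolicSubset) := by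
  obtain ⟨t, ht, e⟩ := exists_wl_conj (simple_injective_typeB cs) (cs := cs)
    (Set.mem_insert (c.gap i hi) c.parabolicSubset)
  suffices t = (c.act i).gap i hi' by rw [e, this]
  apply Fin.ext
  have g1 := c.gap_add_one i hi
  have g2 := (c.act i).gap_add_one i hi'
  have h4 := c.start_lt_succ (m := i) (by omega)
  have h5 := c.start_lt_succ (m := i + 1) hi
  rw [show i + 1 + 1 = i + 2 from rfl] at h5
  obtain ⟨b', hb'⟩ : ∃ b, b + 1 = c.start (i + 2) := ⟨c.start (i + 2) - 1, by omega⟩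
  have hb := c.isBlock_merged hi hb'
  -- It is known that conjugation by `w_M` gives some simple reflection `s_t`. One value of the
  -- signed permutations, with `w_M` a reversal or `-1` on the merged block, identifies `t`.
  have key : ∀ x : ℤ, sgn cs (wl cs (insert (c.gap i hi) c.parabolicSubset))
      (sgnFun (c.gap i hi) x) =
      sgnFun t (sgn cs (wl cs (insert (c.gap i hi) c.parabolicSubset)) x) := by
    intro x
    rw [← sgn_mul_simple, e, sgn_mul_apply, sgn_simple, sgnPerm_apply]
  generalize c.gap i hi = s at *
  generalize (c.act i).gap i hi' = u at *
  rcases eq_or_ne i 0 with rfl | h0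
  · rw [act_zero] at g2
    have g3 : (s : ℕ) = u := by omega
    rw [← g3]
    rw [start_zero] at hb
    simp only [zero_add] at g1 h5 hb'
    rcases Nat.eq_zero_or_pos (s : ℕ) with hs | hs
    · have := key 1
      rw [hs] at this ⊢
      rw [show sgnFun 0 1 = -1 by decide, hb.sgn_wl_zero (by omega), hb.sgn_wl_zero (by omega)]
        at this
      by_contra hne
      have h6 := sgnFun_spec (Nat.pos_of_ne_zero hne) this.symm
      omega
    · have e1 : sgnFun s (s + 1) = s := by
        rw [sgnFun, if_neg hs.ne']; split_ifs <;> omega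
      have := key (s + 1)
      rw [e1, hb.sgn_wl_zero (by omega), hb.sgn_wl_zero (by omega), sgnFun_neg, neg_inj] at this
      rcases Nat.eq_zero_or_pos (t : ℕ) with ht | ht
      · rw [ht] at this
        have h6 := sgnFun_zero_spec this.symm
        omega
      · have h6 := sgnFun_spec ht this.symm
        omega
  · have g3 := c.start_act_self hi h0
    have hp := c.start_pos (m := i) (by omega)
    have e1 : sgnFun s s = s + 1 := by
      rw [sgnFun, if_neg (by omega), if_pos rfl]
    have := key s
    rw [e1, hb.sgn_wl hp (by omega), hb.sgn_wl hp (by omega)] at this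
    rcases Nat.eq_zero_or_pos (t : ℕ) with ht | ht
    · rw [ht] at this
      have h6 := sgnFun_zero_spec this.symm
      omega
    · have h6 := sgnFun_spec ht this.symm
      omega

lemma isCoreElt_cross :
    IsCoreElt cs (c.act i).parabolicSubset c.parabolicSubset (cross cs c i hi) := by
  have hi' : i + 1 < (c.act i).len := by rwa [len_act]
  rw [c.parabolicSubset_act hi hi']
  exact isCoreElt_atomic (simple_injective_typeB cs) (c.gap_notMem i hi) (wl_mul_gap c hi hi')

lemma cross_descent : cs.length (cross cs c i hi * cs.simple (c.gap i hi)) <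
    cs.length (cross cs c i hi) :=
  atomic_descent (simple_injective_typeB cs) (c.gap_notMem i hi)

lemma length_cross_pos : 0 < cs.length (cross cs c i hi) := by
  have := cross_descent (cs := cs) c hi
  omega

/-- The inverse of `w_M w_J` is `w_J w_M`. By the conjugation rule for `w_J` it equals `w_M w_{J'}`,
with `J'` the exchanged subset and the same `M`. -/
lemma cross_inv (hi' : i + 1 < (c.act i).len) : (cross cs c i hi)⁻¹ = cross cs (c.act i) i hi' := by
  have h := (isCoreElt_cross (cs := cs) c hi).mul_wl
  rw [cross, mul_inv_rev, wl_inv, wl_inv, cross, insert_gap_act c hi hi']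
  rw [cross, mul_assoc, wl_mul_wl, mul_one] at h
  have h2 : wl cs (c.act i).parabolicSubset * wl cs (insert (c.gap i hi) c.parabolicSubset) =
      wl cs (insert (c.gap i hi) c.parabolicSubset) * wl cs c.parabolicSubset := by
    nth_rw 1 [h]
    rw [wl_mul_wl_mul]
  have := congrArg (·⁻¹) h2
  simp only [mul_inv_rev, wl_inv] at this
  exact this.symm

lemma cross_act_mul_cross (hi' : i + 1 < (c.act i).len) :
    cross cs (c.act i) i hi' * cross cs c i hi = 1 := by
  rw [← cross_inv c hi hi', inv_mul_cancel]

/-- A core element with a right descent at `d_i` is a reduced product with `cross c i`. -/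
lemma IsCoreElt.exists_mul_cross {I : Set (Fin n)} {w : W} (h : IsCoreElt cs I c.parabolicSubset w)
    (hd : cs.length (w * cs.simple (c.gap i hi)) < cs.length w) :
    ∃ v, IsCoreElt cs I (c.act i).parabolicSubset v ∧ w = v * cross cs c i hi ∧
      cs.length w = cs.length v + cs.length (cross cs c i hi) := by
  have hi' : i + 1 < (c.act i).len := by rwa [len_act]
  rw [c.parabolicSubset_act hi hi']
  exact h.exists_atomic (simple_injective_typeB cs) hd (wl_mul_gap c hi hi')

/-- A core element with no right descent at the source of `d_i` has a reduced product with the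
atomic element that ends there. -/
lemma IsCoreElt.length_mul_cross {I : Set (Fin n)} {w : W} (hi' : i + 1 < (c.act i).len)
    (h : IsCoreElt cs I (c.act i).parabolicSubset w)
    (hd : cs.length w < cs.length (w * cs.simple ((c.act i).gap i hi'))) :
    cs.length (w * cross cs c i hi) = cs.length w + cs.length (cross cs c i hi) := by
  refine h.length_mul_of_not_descent hd ?_
  rw [insert_gap_act c hi hi']
  exact atomic_mem

end Cross

end CoxeterB

namespace CoxeterB

section Words

/-! ### The relations between atomic elements -/

variable {n : ℕ} {W : Type*} [Group W] {cs : CoxeterSystem (typeB n) W}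

open LabelSeq

lemma eq_of_sgn_eq_of_nonneg {w w' : W} (h : ∀ x : ℤ, 0 ≤ x → sgn cs w x = sgn cs w' x) :
    w = w' := by
  apply sgn_injective cs
  ext x
  rcases le_or_gt 0 x with hx | hx
  · exact h x hx
  · have := h (-x) (by omega)
    rw [sgn_neg, sgn_neg] at this
    omega

variable [Finite W]

/-! ### Block exchanges and block negations as relations of linear arithmetic -/

/-- `y` is the image of `x` under the signed permutation that exchanges the intervals `[p, q)` and
`[q, r)`. -/
def BlockSwap (p q r x y : ℤ) : Prop :=
  (-p < x ∧ x < p ∧ y = x) ∨ (p ≤ x ∧ x < q ∧ y = x + r - q) ∨ (q ≤ x ∧ x < r ∧ y = x + p - q) ∨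
    (r ≤ x ∧ y = x) ∨ (x ≤ -p ∧ -q < x ∧ y = x - r + q) ∨ (x ≤ -q ∧ -r < x ∧ y = x - p + q) ∨
    (x ≤ -r ∧ y = x)

/-- `y` is the image of `x` under the signed permutation that moves the interval `[q, r)` to its
opposite by a translation. -/
def BlockNeg (q r x y : ℤ) : Prop :=
  (-q < x ∧ x < q ∧ y = x) ∨ (q ≤ x ∧ x < r ∧ y = x + 1 - q - r) ∨ (r ≤ x ∧ y = x) ∨
    (x ≤ -q ∧ -r < x ∧ y = x - 1 + q + r) ∨ (x ≤ -r ∧ y = x)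

section

variable {p q r x y : ℤ}

lemma BlockSwap.inner (h : BlockSwap p q r x y)
    (hx : 0 < p ∧ p < q ∧ q < r ∧ -p < x ∧ x < p) : y = x := by
  unfold BlockSwap at h; omega

lemma BlockSwap.left (h : BlockSwap p q r x y)
    (hx : 0 < p ∧ p < q ∧ q < r ∧ p ≤ x ∧ x < q) : y = x + r - q := by
  unfold BlockSwap at h; omega

lemma BlockSwap.right (h : BlockSwap p q r x y)
    (hx : 0 < p ∧ p < q ∧ q < r ∧ q ≤ x ∧ x < r) : y = x + p - q := by
  unfold BlockSwap at h; omega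

lemma BlockSwap.outer (h : BlockSwap p q r x y)
    (hx : 0 < p ∧ p < q ∧ q < r ∧ r ≤ x) : y = x := by
  unfold BlockSwap at h; omega

lemma BlockSwap.neg_left (h : BlockSwap p q r x y)
    (hx : 0 < p ∧ p < q ∧ q < r ∧ x ≤ -p ∧ -q < x) : y = x - r + q := by
  unfold BlockSwap at h; omega

lemma BlockSwap.neg_right (h : BlockSwap p q r x y)
    (hx : 0 < p ∧ p < q ∧ q < r ∧ x ≤ -q ∧ -r < x) : y = x - p + q := by
  unfold BlockSwap at h; omega

lemma BlockSwap.lt (h : BlockSwap p q r x y) (hx : 0 < p ∧ p < q ∧ q < r ∧ -r < x ∧ x < r) :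
    -r < y ∧ y < r := by
  unfold BlockSwap at h; omega

lemma BlockSwap.ge (h : BlockSwap p q r x y) {s : ℤ}
    (hx : 0 < p ∧ p < q ∧ q < r ∧ 0 < s ∧ s ≤ p ∧ s ≤ x) : s ≤ y := by
  unfold BlockSwap at h; omega

lemma BlockSwap.unique (h : BlockSwap p q r x y) {y' : ℤ} (hx : 0 < p ∧ p < q ∧ q < r)
    (h' : BlockSwap p q r x y') : y = y' := by
  unfold BlockSwap at h h'
  rcases h with h | h | h | h | h | h | h <;> omega

lemma BlockNeg.lt (h : BlockNeg q r x y) (hx : 0 < q ∧ q < r ∧ -r < x ∧ x < r) :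
    -r < y ∧ y < r := by
  unfold BlockNeg at h; omega

lemma BlockNeg.unique (h : BlockNeg q r x y) {y' : ℤ} (hx : 0 < q ∧ q < r)
    (h' : BlockNeg q r x y') : y = y' := by
  unfold BlockNeg at h h'
  rcases h with h | h | h | h | h <;> omega

lemma BlockSwap.neg (h : BlockSwap p q r x y) : BlockSwap p q r (-x) (-y) := by
  unfold BlockSwap at *
  rcases h with h | h | h | h | h | h | h
  · exact .inl (by omega)
  · exact .inr (.inr (.inr (.inr (.inl (by omega)))))
  · exact .inr (.inr (.inr (.inr (.inr (.inl (by omega))))))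
  · exact .inr (.inr (.inr (.inr (.inr (.inr (by omega))))))
  · exact .inr (.inl (by omega))
  · exact .inr (.inr (.inl (by omega)))
  · exact .inr (.inr (.inr (.inl (by omega))))

lemma BlockNeg.neg (h : BlockNeg q r x y) : BlockNeg q r (-x) (-y) := by
  unfold BlockNeg at *
  rcases h with h | h | h | h | h
  · exact .inl (by omega)
  · exact .inr (.inr (.inr (.inl (by omega))))
  · exact .inr (.inr (.inr (.inr (by omega))))
  · exact .inr (.inl (by omega))
  · exact .inr (.inr (.inl (by omega)))

lemma BlockNeg.inner (h : BlockNeg q r x y) (hx : 0 < q ∧ q < r ∧ -q < x ∧ x < q) : y = x := by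
  unfold BlockNeg at h; omega

lemma BlockNeg.mid (h : BlockNeg q r x y) (hx : 0 < q ∧ q < r ∧ q ≤ x ∧ x < r) :
    y = x + 1 - q - r := by
  unfold BlockNeg at h; omega

lemma BlockNeg.outer (h : BlockNeg q r x y) (hx : 0 < q ∧ q < r ∧ r ≤ x) : y = x := by
  unfold BlockNeg at h; omega

lemma BlockNeg.neg_outer (h : BlockNeg q r x y) (hx : 0 < q ∧ q < r ∧ x ≤ -r) : y = x := by
  unfold BlockNeg at h; omega

end

lemma blockSwap_cross (c : LabelSeq n) {i : ℕ} (hi : i + 1 < c.len) (h0 : i ≠ 0) (x : ℤ) :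
    BlockSwap (c.start i) (c.start (i + 1)) (c.start (i + 2)) x (sgn cs (cross cs c i hi) x) := by
  have h1 := c.start_lt_succ (m := i) (by omega)
  have h2 : c.start (i + 1) < c.start (i + 2) := c.start_lt_succ hi
  have h3 := c.start_pos (m := i) (by omega)
  have key : ∀ x : ℤ, 0 ≤ x → BlockSwap (c.start i) (c.start (i + 1)) (c.start (i + 2)) x
      (sgn cs (cross cs c i hi) x) := by
    intro x hx
    have a1 := fun h => sgn_cross_of_lt (cs := cs) c hi hx h
    have a2 := sgn_cross_left (cs := cs) c hi h0 (x := x)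
    have a3 := sgn_cross_right (cs := cs) c hi h0 (x := x)
    have a4 := sgn_cross_of_ge (cs := cs) c hi (x := x)
    rcases lt_or_ge x (c.start i) with h | h
    · exact .inl ⟨by omega, h, a1 h⟩
    rcases lt_or_ge x (c.start (i + 1)) with h' | h'
    · exact .inr (.inl ⟨h, h', a2 h h'⟩)
    rcases lt_or_ge x (c.start (i + 2)) with h'' | h''
    · exact .inr (.inr (.inl ⟨h', h'', a3 h' h''⟩))
    · exact .inr (.inr (.inr (.inl ⟨h'', a4 h''⟩)))
  rcases le_or_gt 0 x with hx | hx
  · exact key x hx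
  · have := (key (-x) (by omega)).neg
    rwa [sgn_neg, neg_neg, neg_neg] at this

lemma blockNeg_cross (c : LabelSeq n) (hi : 0 + 1 < c.len) (x : ℤ) :
    BlockNeg (c.start 1) (c.start 2) x (sgn cs (cross cs c 0 hi) x) := by
  have h2 : c.start 1 < c.start 2 := c.start_lt_succ hi
  have h3 := c.start_pos (m := 1) (by omega)
  have key : ∀ x : ℤ, 0 ≤ x → BlockNeg (c.start 1) (c.start 2) x
      (sgn cs (cross cs c 0 hi) x) := by
    intro x hx
    have a1 := fun h => sgn_cross_zero_of_lt (cs := cs) c hi hx h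
    have a2 := sgn_cross_zero (cs := cs) c hi (x := x)
    have a4 := sgn_cross_of_ge (cs := cs) c hi (x := x)
    rw [zero_add] at a4
    rcases lt_or_ge x (c.start 1) with h | h
    · exact .inl ⟨by omega, h, a1 h⟩
    rcases lt_or_ge x (c.start 2) with h' | h'
    · exact .inr (.inl ⟨h, h', a2 h h'⟩)
    · exact .inr (.inr (.inl ⟨h', a4 h'⟩))
  rcases le_or_gt 0 x with hx | hx
  · exact key x hx
  · have := (key (-x) (by omega)).neg
    rwa [sgn_neg, neg_neg, neg_neg] at this

/-! ### Arrows and their core elements -/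

variable {a b c d : LabelSeq n}

lemma arrow_lt (e : c ⟶ d) : idx e + 1 < c.len := e.2.1

lemma arrow_eq (e : c ⟶ d) : d = c.act (idx e) := e.2.2

lemma arrow_eq' (e : c ⟶ d) : c = d.act (idx e) := by
  nth_rw 2 [arrow_eq e]
  rw [act_act]

lemma arrow_len (e : c ⟶ d) : d.len = c.len :=
  (congrArg LabelSeq.len (arrow_eq e)).trans (len_act _ _)

lemma arrow_lt' (e : c ⟶ d) : idx e + 1 < d.len := by
  rw [arrow_len e]; exact arrow_lt e

/-- The arrow of index `i` with a given target. -/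
def arrowTo (d : LabelSeq n) (i : ℕ) (hi : i + 1 < d.len) : d.act i ⟶ d :=
  ⟨i, by rw [← len, len_act]; exact hi, (d.act_act i).symm⟩

lemma idx_arrowTo (d : LabelSeq n) (i : ℕ) (hi : i + 1 < d.len) : idx (arrowTo d i hi) = i := rfl

lemma start_arrow (e : c ⟶ d) {m : ℕ} (h : m ≠ idx e + 1) : d.start m = c.start m := by
  rw [congrArg LabelSeq.start (arrow_eq e), start_act _ (arrow_lt e) h]

lemma start_arrow_self (e : c ⟶ d) (h : idx e ≠ 0) :
    d.start (idx e + 1) + c.start (idx e + 1) = c.start (idx e) + c.start (idx e + 2) := by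
  rw [congrArg LabelSeq.start (arrow_eq e)]
  exact start_act_self c (arrow_lt e) h

lemma start_arrow_of_idx_zero (e : c ⟶ d) (h : idx e = 0) (m : ℕ) : d.start m = c.start m := by
  rw [congrArg LabelSeq.start (arrow_eq e), h, act_zero]

variable (cs) in
/-- The element of `W` of an arrow `c ⟶ d`; it is a core element from `d` to `c`. -/
noncomputable def arrowElt (e : c ⟶ d) : W := cross cs d (idx e) (arrow_lt' e)

lemma isCoreElt_arrowElt (e : c ⟶ d) :
    IsCoreElt cs c.parabolicSubset d.parabolicSubset (arrowElt cs e) := by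
  have := isCoreElt_cross (cs := cs) d (arrow_lt' e)
  rwa [← arrow_eq' e] at this

lemma arrowElt_descent (e : c ⟶ d) :
    cs.length (arrowElt cs e * cs.simple (d.gap (idx e) (arrow_lt' e))) <
      cs.length (arrowElt cs e) :=
  cross_descent d _

lemma length_arrowElt_pos (e : c ⟶ d) : 0 < cs.length (arrowElt cs e) := length_cross_pos d _

lemma blockSwap_arrow (e : c ⟶ d) {i : ℕ} (hi : idx e = i) (h0 : i ≠ 0) (x : ℤ) :
    BlockSwap (d.start i) (d.start (i + 1)) (d.start (i + 2)) x (sgn cs (arrowElt cs e) x) := by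
  subst hi
  exact blockSwap_cross d _ h0 x

lemma blockNeg_arrow (e : c ⟶ d) (hi : idx e = 0) (x : ℤ) :
    BlockNeg (d.start 1) (d.start 2) x (sgn cs (arrowElt cs e) x) := by
  unfold arrowElt
  generalize_proofs h
  revert h
  rw [hi]
  exact fun h => blockNeg_cross d h x

/-- The criterion for a product of a core element with the element of an arrow to be reduced. -/
lemma IsCoreElt.length_mul_arrowElt {I : Set (Fin n)} {w : W} (h : IsCoreElt cs I c.parabolicSubset w)
    (e : c ⟶ d) (hd : cs.length w < cs.length (w * cs.simple (c.gap (idx e) (arrow_lt e)))) :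
    cs.length (w * arrowElt cs e) = cs.length w + cs.length (arrowElt cs e) := by
  have hc := arrow_eq' e
  have hi' : idx e + 1 < (d.act (idx e)).len := by rw [len_act]; exact arrow_lt' e
  refine IsCoreElt.length_mul_cross d (arrow_lt' e) hi' (I := I) (by rwa [← hc]) ?_
  convert hd using 6
  exact hc.symm

lemma IsCoreElt.length_mul_arrowElt_of_sgn {I : Set (Fin n)} {w : W}
    (h : IsCoreElt cs I c.parabolicSubset w) (e : c ⟶ d) {i : ℕ} (hi : idx e = i)
    (hd : ∀ x : ℤ, x + 1 = c.start (i + 1) → sgn cs w x < sgn cs w (x + 1)) :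
    cs.length (w * arrowElt cs e) = cs.length w + cs.length (arrowElt cs e) := by
  subst hi
  refine h.length_mul_arrowElt e ?_
  rw [noDescent_iff]
  apply hd
  have := c.gap_add_one (idx e) (arrow_lt e)
  omega

/-- The supports are separated by `r ≤ p'`: on each side of `r` one of the two permutations is the
identity. -/
lemma blockSwap_comm {p q r p' q' r' x y z u v : ℤ} (hp : 0 < p) (hpq : p < q) (hqr : q < r)
    (hr : r ≤ p') (hpq' : p' < q') (hqr' : q' < r') (h1 : BlockSwap p q r x y)
    (h2 : BlockSwap p' q' r' y z) (h3 : BlockSwap p' q' r' x u) (h4 : BlockSwap p q r u v)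
    (hx : 0 ≤ x) : z = v := by
  rcases lt_or_ge x r with h | h
  · have := h1.lt (by omega)
    obtain rfl := h2.inner (by omega)
    obtain rfl := h3.inner (by omega)
    exact h1.unique (by omega) h4
  · obtain rfl := h1.outer (by omega)
    obtain rfl := h2.unique (by omega) h3
    have := h2.ge (s := r) (by omega)
    exact (h4.outer (by omega)).symm

lemma blockNeg_comm {q r p' q' r' x y z u v : ℤ} (hp : 0 < q) (hqr : q < r)
    (hr : r ≤ p') (hpq' : p' < q') (hqr' : q' < r') (h1 : BlockNeg q r x y)
    (h2 : BlockSwap p' q' r' y z) (h3 : BlockSwap p' q' r' x u) (h4 : BlockNeg q r u v)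
    (hx : 0 ≤ x) : z = v := by
  rcases lt_or_ge x r with h | h
  · have := h1.lt (by omega)
    obtain rfl := h2.inner (by omega)
    obtain rfl := h3.inner (by omega)
    exact h1.unique (by omega) h4
  · obtain rfl := h1.outer (by omega)
    obtain rfl := h2.unique (by omega) h3
    have := h2.ge (s := r) (by omega)
    exact (h4.outer (by omega)).symm

/-- Both sides put the three blocks `[p, q)`, `[q, r)`, `[r, t)` in the opposite order, each by a
translation. Arguments such as `p + r - q` are the block boundaries after the exchanges made so far.
-/
lemma blockSwap_braid {p q r t x y₁ y₂ y₃ z₁ z₂ z₃ : ℤ} (hp : 0 < p) (hpq : p < q) (hqr : q < r)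
    (hr : r < t) (h1 : BlockSwap p q r x y₁) (h2 : BlockSwap (p + r - q) r t y₁ y₂)
    (h3 : BlockSwap p (p + r - q) (p + t - q) y₂ y₃) (h4 : BlockSwap q r t x z₁)
    (h5 : BlockSwap p q (q + t - r) z₁ z₂) (h6 : BlockSwap (p + t - r) (q + t - r) t z₂ z₃)
    (hx : 0 ≤ x) : y₃ = z₃ := by
  rcases lt_or_ge x p with h | h
  · obtain rfl := h1.inner (by omega)
    obtain rfl := h2.inner (by omega)
    obtain rfl := h3.inner (by omega)
    obtain rfl := h4.inner (by omega)
    obtain rfl := h5.inner (by omega)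
    exact (h6.inner (by omega)).symm
  rcases lt_or_ge x q with h' | h'
  · obtain rfl := h1.left (by omega)
    obtain rfl := h2.left (by omega)
    obtain rfl := h3.outer (by omega)
    obtain rfl := h4.inner (by omega)
    obtain rfl := h5.left (by omega)
    have := h6.left (by omega)
    omega
  rcases lt_or_ge x r with h'' | h''
  · obtain rfl := h1.right (by omega)
    obtain rfl := h2.inner (by omega)
    obtain rfl := h3.left (by omega)
    obtain rfl := h4.left (by omega)
    obtain rfl := h5.outer (by omega)
    have := h6.right (by omega)
    omega
  rcases lt_or_ge x t with h₃ | h₃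
  · obtain rfl := h1.outer (by omega)
    obtain rfl := h2.right (by omega)
    obtain rfl := h3.right (by omega)
    obtain rfl := h4.right (by omega)
    obtain rfl := h5.right (by omega)
    have := h6.inner (by omega)
    omega
  · obtain rfl := h1.outer (by omega)
    obtain rfl := h2.outer (by omega)
    obtain rfl := h3.outer (by omega)
    obtain rfl := h4.outer (by omega)
    obtain rfl := h5.outer (by omega)
    exact (h6.outer (by omega)).symm

/-- Both sides translate each of the blocks `[p, q)` and `[q, r)` onto its own opposite; the middle
boundary is `p + r - q` while the blocks are exchanged. -/
lemma block_four {p q r x y₁ y₂ y₃ y₄ z₁ z₂ z₃ z₄ : ℤ} (hp : 0 < p) (hpq : p < q) (hqr : q < r)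
    (h1 : BlockNeg p q x y₁) (h2 : BlockSwap p q r y₁ y₂) (h3 : BlockNeg p (p + r - q) y₂ y₃)
    (h4 : BlockSwap p (p + r - q) r y₃ y₄) (h5 : BlockSwap p q r x z₁)
    (h6 : BlockNeg p (p + r - q) z₁ z₂) (h7 : BlockSwap p (p + r - q) r z₂ z₃)
    (h8 : BlockNeg p q z₃ z₄) (hx : 0 ≤ x) : y₄ = z₄ := by
  rcases lt_or_ge x p with h | h
  · obtain rfl := h1.inner (by omega)
    obtain rfl := h2.inner (by omega)
    obtain rfl := h3.inner (by omega)
    obtain rfl := h4.inner (by omega)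
    obtain rfl := h5.inner (by omega)
    obtain rfl := h6.inner (by omega)
    obtain rfl := h7.inner (by omega)
    exact (h8.inner (by omega)).symm
  rcases lt_or_ge x q with h' | h'
  · obtain rfl := h1.mid (by omega)
    obtain rfl := h2.neg_left (by omega)
    obtain rfl := h3.neg_outer (by omega)
    obtain rfl := h4.neg_right (by omega)
    obtain rfl := h5.left (by omega)
    obtain rfl := h6.outer (by omega)
    obtain rfl := h7.right (by omega)
    have := h8.mid (by omega)
    omega
  rcases lt_or_ge x r with h'' | h''
  · obtain rfl := h1.outer (by omega)
    obtain rfl := h2.right (by omega)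
    obtain rfl := h3.mid (by omega)
    obtain rfl := h4.neg_left (by omega)
    obtain rfl := h5.right (by omega)
    obtain rfl := h6.mid (by omega)
    obtain rfl := h7.neg_left (by omega)
    have := h8.neg_outer (by omega)
    omega
  · obtain rfl := h1.outer (by omega)
    obtain rfl := h2.outer (by omega)
    obtain rfl := h3.outer (by omega)
    obtain rfl := h4.outer (by omega)
    obtain rfl := h5.outer (by omega)
    obtain rfl := h6.outer (by omega)
    obtain rfl := h7.outer (by omega)
    exact (h8.outer (by omega)).symm

end Words

end CoxeterB

namespace CoxeterB

section PathElements

/-! ### The elements of paths -/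

variable {n : ℕ} {W : Type*} [Group W] {cs : CoxeterSystem (typeB n) W} [Finite W]

open LabelSeq

/-- On nonnegative positions the permutation is a translation piece by piece, and the only break at
which it descends is `q`. This makes two arrows of different indices compose reducedly. -/
lemma BlockSwap.lt_succ {p q r x y y' : ℤ} (h : BlockSwap p q r x y)
    (h' : BlockSwap p q r (x + 1) y') (hx : 0 < p ∧ p < q ∧ q < r ∧ 0 ≤ x ∧ x + 1 ≠ q) : y < y' := by
  unfold BlockSwap at h h'
  rcases h with h | h | h | h | h | h | h <;> omega

lemma BlockNeg.lt_succ {q r x y y' : ℤ} (h : BlockNeg q r x y)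
    (h' : BlockNeg q r (x + 1) y') (hx : 0 < q ∧ q < r ∧ 0 ≤ x ∧ x + 1 ≠ q) : y < y' := by
  unfold BlockNeg at h h'
  rcases h with h | h | h | h | h <;> omega

variable (cs) in
/-- The element of `W` of a path from `c` to `d`; it is a core element from `d` to `c`. -/
noncomputable def pathElt {c : LabelSeq n} : ∀ {d : LabelSeq n}, Quiver.Path c d → W
  | _, .nil => 1
  | _, .cons p e => pathElt p * arrowElt cs e

variable (cs) in
/-- The sum of the lengths of the elements of the arrows of a path. -/
noncomputable def pathLen {c : LabelSeq n} : ∀ {d : LabelSeq n}, Quiver.Path c d → ℕ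
  | _, .nil => 0
  | _, .cons p e => pathLen p + cs.length (arrowElt cs e)

variable (cs) in
/-- A path is reduced if lengths add up along it. -/
def IsRed {c d : LabelSeq n} (p : Quiver.Path c d) : Prop :=
  cs.length (pathElt cs p) = pathLen cs p

variable {a a' b b₁ b₂ b₃ c c₁ c₂ c₃ d : LabelSeq n}

lemma pathElt_cons (p : Quiver.Path c b) (e : b ⟶ d) :
    pathElt cs (p.cons e) = pathElt cs p * arrowElt cs e := rfl

lemma pathElt_nil : pathElt cs (.nil : Quiver.Path c c) = 1 := rfl

lemma pathLen_cons (p : Quiver.Path c b) (e : b ⟶ d) :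
    pathLen cs (p.cons e) = pathLen cs p + cs.length (arrowElt cs e) := rfl

lemma pathElt_comp (p : Quiver.Path c b) (q : Quiver.Path b d) :
    pathElt cs (p.comp q) = pathElt cs p * pathElt cs q := by
  induction q with
  | nil => simp [pathElt_nil]
  | cons q e ih => rw [Quiver.Path.comp_cons, pathElt_cons, pathElt_cons, ih, mul_assoc]

lemma pathLen_comp (p : Quiver.Path c b) (q : Quiver.Path b d) :
    pathLen cs (p.comp q) = pathLen cs p + pathLen cs q := by
  induction q with
  | nil => rfl
  | cons q e ih => rw [Quiver.Path.comp_cons, pathLen_cons, pathLen_cons, ih, add_assoc]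

lemma isCoreElt_pathElt (p : Quiver.Path c d) :
    IsCoreElt cs c.parabolicSubset d.parabolicSubset (pathElt cs p) := by
  induction p with
  | nil => exact isCoreElt_one _
  | cons p e ih => exact ih.mul (isCoreElt_arrowElt e)

lemma length_pathElt_le (p : Quiver.Path c d) : cs.length (pathElt cs p) ≤ pathLen cs p := by
  induction p with
  | nil => simp [pathElt_nil]
  | cons p e ih =>
    rw [pathElt_cons, pathLen_cons]
    have := cs.length_mul_le (pathElt cs p) (arrowElt cs e)
    omega

/-- Length is subadditive at every arrow, so equality for the whole path forces equality for the
prefix and for the last step. -/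
lemma isRed_cons_iff (p : Quiver.Path c b) (e : b ⟶ d) : IsRed cs (p.cons e) ↔ IsRed cs p ∧
    cs.length (pathElt cs p * arrowElt cs e) =
      cs.length (pathElt cs p) + cs.length (arrowElt cs e) := by
  have h1 := length_pathElt_le (cs := cs) p
  have h2 := cs.length_mul_le (pathElt cs p) (arrowElt cs e)
  rw [IsRed, IsRed, pathElt_cons, pathLen_cons]
  omega

lemma isRed_nil : IsRed cs (.nil : Quiver.Path c c) := by
  rw [IsRed, pathElt_nil, cs.length_one]; rfl

lemma IsRed.cons_of_sgn {p : Quiver.Path c b} (h : IsRed cs p) (e : b ⟶ d) {i : ℕ} (hi : idx e = i)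
    (hd : ∀ x : ℤ, x + 1 = b.start (i + 1) →
      sgn cs (pathElt cs p) x < sgn cs (pathElt cs p) (x + 1)) : IsRed cs (p.cons e) :=
  (isRed_cons_iff p e).2 ⟨h, (isCoreElt_pathElt p).length_mul_arrowElt_of_sgn e hi hd⟩

lemma isRed_single (e : c ⟶ d) : IsRed cs (Quiver.Path.nil.cons e) := by
  rw [isRed_cons_iff]
  exact ⟨isRed_nil, by simp [pathElt_nil]⟩

lemma pathElt_two (e₁ : a ⟶ b) (e₂ : b ⟶ d) : pathElt cs ((Quiver.Path.nil.cons e₁).cons e₂) =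
    arrowElt cs e₁ * arrowElt cs e₂ := by
  simp only [pathElt_cons, pathElt_nil, one_mul]

lemma IsRed.descent {p : Quiver.Path c b} {e : b ⟶ d} (h : IsRed cs (p.cons e)) {i : ℕ}
    (hi : idx e = i) (hi' : i + 1 < d.len) :
    cs.length (pathElt cs (p.cons e) * cs.simple (d.gap i hi')) <
      cs.length (pathElt cs (p.cons e)) := by
  subst hi
  rw [pathElt_cons, ((isRed_cons_iff p e).1 h).2]
  exact length_mul_simple_mul_lt (arrowElt_descent e) _

lemma blockSwap_arrow' (e : c ⟶ d) {i : ℕ} (hi : idx e = i) (h0 : i ≠ 0) {p q r : ℤ}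
    (hp : (d.start i : ℤ) = p) (hq : (d.start (i + 1) : ℤ) = q) (hr : (d.start (i + 2) : ℤ) = r)
    (x : ℤ) : BlockSwap p q r x (sgn cs (arrowElt cs e) x) := by
  subst hp hq hr
  exact blockSwap_arrow e hi h0 x

lemma blockNeg_arrow' (e : c ⟶ d) (hi : idx e = 0) {q r : ℤ}
    (hq : (d.start 1 : ℤ) = q) (hr : (d.start 2 : ℤ) = r)
    (x : ℤ) : BlockNeg q r x (sgn cs (arrowElt cs e) x) := by
  subst hq hr
  exact blockNeg_arrow e hi x

lemma arrow_starts (e : c ⟶ d) {i : ℕ} (hi : idx e = i) :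
    (∀ m, m ≠ i + 1 → d.start m = c.start m) ∧
      (i ≠ 0 → d.start (i + 1) + c.start (i + 1) = c.start i + c.start (i + 2)) ∧
      (i = 0 → d.start (i + 1) = c.start (i + 1)) := by
  subst hi
  exact ⟨fun m => start_arrow e, start_arrow_self e, fun h => start_arrow_of_idx_zero e h _⟩

/-- The element of an arrow of index `j` is increasing at the positions of the other indices. -/
lemma arrowElt_sgn_lt (e : c ⟶ d) {i j : ℕ} (hj : idx e = j) (hij : i ≠ j) (hi : i + 1 < d.len)
    (x : ℤ) (hx : x + 1 = d.start (i + 1)) :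
    sgn cs (arrowElt cs e) x < sgn cs (arrowElt cs e) (x + 1) := by
  have hl := arrow_lt' e
  rw [hj] at hl
  have h1 : d.start (j + 1) < d.start (j + 2) := d.start_lt_succ hl
  have h2 := d.start_pos (m := i + 1) (by omega)
  have h3 : d.start (i + 1) ≠ d.start (j + 1) := by
    rcases Nat.lt_or_ge i j with h | h
    · exact (d.start_lt (show i + 1 < j + 1 by omega) hi).ne
    · exact (d.start_lt (show j + 1 < i + 1 by omega) hl).ne'
  rcases eq_or_ne j 0 with rfl | h0
  · have h4 := d.start_pos (m := 1) (by omega)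
    simp only [zero_add] at *
    exact (blockNeg_arrow e hj x).lt_succ (blockNeg_arrow e hj (x + 1)) (by omega)
  · have h4 := d.start_pos (m := j) (by omega)
    have h5 := d.start_lt_succ (m := j) (by omega)
    exact (blockSwap_arrow e hj h0 x).lt_succ (blockSwap_arrow e hj h0 (x + 1)) (by omega)

lemma isRed_two (e₁ : a ⟶ b) (e₂ : b ⟶ d) (h : idx e₁ ≠ idx e₂) :
    IsRed cs ((Quiver.Path.nil.cons e₁).cons e₂) := by
  refine (isRed_single e₁).cons_of_sgn e₂ rfl fun x hx => ?_
  simp only [pathElt_cons, pathElt_nil, one_mul]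
  exact arrowElt_sgn_lt e₁ rfl h.symm (arrow_lt e₂) x hx

lemma cross_congr {i j : ℕ} (h : c = d) (hij : i = j) (hi : i + 1 < c.len) (hj : j + 1 < d.len) :
    cross cs c i hi = cross cs d j hj := by
  subst h hij; rfl

/-- Equal indices make the two arrows mutually reverse, so their elements multiply to `1` although
both have positive length. -/
lemma not_isRed_two (e₁ : a ⟶ b) (e₂ : b ⟶ d) (h : idx e₁ = idx e₂) :
    ¬ IsRed cs ((Quiver.Path.nil.cons e₁).cons e₂) := by
  rw [isRed_cons_iff]
  rintro ⟨-, h1⟩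
  have h2 := length_arrowElt_pos (cs := cs) e₁
  have h3 : idx e₂ + 1 < (d.act (idx e₂)).len := by rw [len_act]; exact arrow_lt' e₂
  have : arrowElt cs e₁ * arrowElt cs e₂ = 1 := by
    rw [← cross_act_mul_cross d (arrow_lt' e₂) h3]
    exact congrArg (· * _) (cross_congr (arrow_eq' e₂) h _ _)
  simp only [pathElt_cons, pathElt_nil, one_mul, this, cs.length_one] at h1
  omega

/-- The sources `a` and `a'` are independent: the identity needs only the common target, and the
equality of sources is deduced from it afterwards. -/
lemma elt_comm_of_lt {i j : ℕ} (hij : i + 1 < j) {e₁ : a ⟶ b} {e₂ : b ⟶ d} {f₁ : a' ⟶ c}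
    {f₂ : c ⟶ d} (he₁ : idx e₁ = j) (he₂ : idx e₂ = i) (hf₁ : idx f₁ = i) (hf₂ : idx f₂ = j) :
    arrowElt cs e₁ * arrowElt cs e₂ = arrowElt cs f₁ * arrowElt cs f₂ := by
  refine eq_of_sgn_eq_of_nonneg (cs := cs) fun x hx => ?_
  have hl := arrow_lt' f₂
  rw [hf₂] at hl
  have b1 := (arrow_starts e₂ he₂).1
  have c1 := (arrow_starts f₂ hf₂).1
  have l1 : d.start (i + 1) < d.start (i + 2) := d.start_lt_succ (by omega)
  have l2 : d.start (i + 2) ≤ d.start j := d.start_mono (by omega)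
  have l3 : d.start j < d.start (j + 1) := d.start_lt_succ (by omega)
  have l4 : d.start (j + 1) < d.start (j + 2) := d.start_lt_succ (by omega)
  have b2 := b1 j (by omega)
  have b3 := b1 (j + 1) (by omega)
  have b4 := b1 (j + 2) (by omega)
  have c2 := c1 i (by omega)
  have c3 := c1 (i + 1) (by omega)
  have c4 := c1 (i + 2) (by omega)
  rw [sgn_mul_apply, sgn_mul_apply]
  have h2 := blockSwap_arrow' (cs := cs) e₁ he₁ (by omega) (p := d.start j) (q := d.start (j + 1))
    (r := d.start (j + 2)) (by omega) (by omega) (by omega) (sgn cs (arrowElt cs e₂) x)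
  have h3 := blockSwap_arrow' (cs := cs) f₂ hf₂ (by omega) rfl rfl rfl x
  rcases eq_or_ne i 0 with rfl | h0
  · simp only [zero_add] at *
    have h1 := blockNeg_arrow' (cs := cs) e₂ he₂ rfl rfl x
    have h4 := blockNeg_arrow' (cs := cs) f₁ hf₁ (q := d.start 1) (r := d.start 2)
      (by omega) (by omega) (sgn cs (arrowElt cs f₂) x)
    have := d.start_pos (m := 1) (by omega)
    exact blockNeg_comm (by omega) (by omega) (by omega) (by omega) (by omega) h1 h2 h3 h4 hx
  · have h1 := blockSwap_arrow' (cs := cs) e₂ he₂ h0 rfl rfl rfl x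
    have h4 := blockSwap_arrow' (cs := cs) f₁ hf₁ h0 (p := d.start i) (q := d.start (i + 1))
      (r := d.start (i + 2)) (by omega) (by omega) (by omega) (sgn cs (arrowElt cs f₂) x)
    have := d.start_pos (m := i) (by omega)
    have l0 : d.start i < d.start (i + 1) := d.start_lt_succ (by omega)
    exact blockSwap_comm (by omega) (by omega) (by omega) (by omega) (by omega) (by omega)
      h1 h2 h3 h4 hx

lemma elt_comm {i j : ℕ} (hij : i + 1 < j ∨ j + 1 < i) {e₁ : a ⟶ b} {e₂ : b ⟶ d} {f₁ : a' ⟶ c}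
    {f₂ : c ⟶ d} (he₁ : idx e₁ = j) (he₂ : idx e₂ = i) (hf₁ : idx f₁ = i) (hf₂ : idx f₂ = j) :
    arrowElt cs e₁ * arrowElt cs e₂ = arrowElt cs f₁ * arrowElt cs f₂ := by
  rcases hij with h | h
  · exact elt_comm_of_lt h he₁ he₂ hf₁ hf₂
  · exact (elt_comm_of_lt h hf₁ hf₂ he₁ he₂).symm

lemma elt_braid {i : ℕ} (h0 : i ≠ 0) {e₁ : a ⟶ b₁} {e₂ : b₁ ⟶ b₂} {e₃ : b₂ ⟶ d}
    {f₁ : a' ⟶ c₁} {f₂ : c₁ ⟶ c₂} {f₃ : c₂ ⟶ d}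
    (he₁ : idx e₁ = i) (he₂ : idx e₂ = i + 1) (he₃ : idx e₃ = i)
    (hf₁ : idx f₁ = i + 1) (hf₂ : idx f₂ = i) (hf₃ : idx f₃ = i + 1) :
    arrowElt cs e₁ * arrowElt cs e₂ * arrowElt cs e₃ =
      arrowElt cs f₁ * arrowElt cs f₂ * arrowElt cs f₃ := by
  refine eq_of_sgn_eq_of_nonneg (cs := cs) fun x hx => ?_
  have hl := arrow_lt' f₃
  rw [hf₃] at hl
  have l0 : d.start i < d.start (i + 1) := d.start_lt_succ (by omega)
  have l1 : d.start (i + 1) < d.start (i + 2) := d.start_lt_succ (by omega)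
  have l2 : d.start (i + 2) < d.start (i + 3) := d.start_lt_succ (by omega)
  have hp := d.start_pos (m := i) (by omega)
  -- The block starts of all intermediate sequences are expressed through those of `d`, so that the
  -- two sides become instances of `blockSwap_braid`.
  obtain ⟨s1, s2, -⟩ := arrow_starts e₃ he₃
  obtain ⟨t1, t2, -⟩ := arrow_starts e₂ he₂
  obtain ⟨u1, u2, -⟩ := arrow_starts f₃ hf₃
  obtain ⟨v1, v2, -⟩ := arrow_starts f₂ hf₂
  have s3 := s2 h0
  have t3 := t2 (by omega)
  have u3 := u2 (by omega)
  have v3 := v2 h0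
  have s4 := s1 i (by omega)
  have s5 := s1 (i + 2) (by omega)
  have s6 := s1 (i + 3) (by omega)
  have t4 := t1 i (by omega)
  have t5 := t1 (i + 1) (by omega)
  have u4 := u1 i (by omega)
  have u5 := u1 (i + 1) (by omega)
  have u6 := u1 (i + 3) (by omega)
  have t6 := t1 (i + 3) (by omega)
  have v4 := v1 i (by omega)
  have v5 := v1 (i + 2) (by omega)
  have v6 := v1 (i + 3) (by omega)
  simp only [add_assoc, Nat.reduceAdd] at t3 u3
  simp only [sgn_mul_apply]
  have h1 := blockSwap_arrow' (cs := cs) e₃ he₃ h0 rfl rfl rfl x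
  have h4 := blockSwap_arrow' (cs := cs) f₃ hf₃ (by omega) (p := d.start (i + 1))
    (q := d.start (i + 2)) (r := d.start (i + 3)) (by omega)
    (by simp only [add_assoc, Nat.reduceAdd])
    (by simp only [add_assoc, Nat.reduceAdd]) x
  refine blockSwap_braid (p := d.start i) (q := d.start (i + 1)) (r := d.start (i + 2))
    (t := d.start (i + 3)) (by omega) (by omega) (by omega) (by omega) h1
    (blockSwap_arrow' e₂ he₂ (by omega) ?_ ?_ ?_ _) (blockSwap_arrow' e₁ he₁ h0 ?_ ?_ ?_ _) h4
    (blockSwap_arrow' f₂ hf₂ h0 ?_ ?_ ?_ _) (blockSwap_arrow' f₁ hf₁ (by omega) ?_ ?_ ?_ _) hx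
  all_goals
    try simp only [add_assoc, Nat.reduceAdd]
    omega

/-- Two arrows of different indices are always reduced; it remains to see that their product is
increasing at the boundary crossed by the third arrow. -/
lemma isRed_braid {i : ℕ} (h0 : i ≠ 0) {e₁ : a ⟶ b₁} {e₂ : b₁ ⟶ b₂} {e₃ : b₂ ⟶ d}
    (he₁ : idx e₁ = i) (he₂ : idx e₂ = i + 1) (he₃ : idx e₃ = i) :
    IsRed cs (((Quiver.Path.nil.cons e₁).cons e₂).cons e₃) := by
  refine (isRed_two e₁ e₂ (by omega)).cons_of_sgn e₃ he₃ fun x hx => ?_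
  have hl := arrow_lt' e₂
  rw [he₂] at hl
  have l0 : b₂.start i < b₂.start (i + 1) := b₂.start_lt_succ (by omega)
  have l1 : b₂.start (i + 1) < b₂.start (i + 2) := b₂.start_lt_succ (by omega)
  have l2 : b₂.start (i + 2) < b₂.start (i + 3) := b₂.start_lt_succ (by omega)
  have hp := b₂.start_pos (m := i) (by omega)
  obtain ⟨t1, t2, -⟩ := arrow_starts e₂ he₂
  have t3 := t2 (by omega)
  have t4 := t1 i (by omega)
  have t5 := t1 (i + 1) (by omega)
  have t6 := t1 (i + 3) (by omega)
  simp only [add_assoc, Nat.reduceAdd] at t3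
  simp only [pathElt_two, sgn_mul_apply]
  have k1 := blockSwap_arrow' (cs := cs) e₂ he₂ (by omega) (p := b₂.start (i + 1))
    (q := b₂.start (i + 2)) (r := b₂.start (i + 3)) (by omega)
    (by simp only [add_assoc, Nat.reduceAdd])
    (by simp only [add_assoc, Nat.reduceAdd])
  -- The last boundary is the start of block `i + 2` in `b₁`, written in terms of `b₂`.
  have k2 := blockSwap_arrow' (cs := cs) e₁ he₁ h0 (p := b₂.start i) (q := b₂.start (i + 1))
    (r := b₂.start (i + 1) + b₂.start (i + 3) - b₂.start (i + 2)) (by omega) (by omega) (by omega)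
  rw [(k1 x).inner (by omega), (k1 (x + 1)).left (by omega), (k2 x).left (by omega),
    (k2 _).outer (by omega)]
  omega

lemma isRed_braid' {i : ℕ} (h0 : i ≠ 0) {e₁ : a ⟶ b₁} {e₂ : b₁ ⟶ b₂} {e₃ : b₂ ⟶ d}
    (he₁ : idx e₁ = i + 1) (he₂ : idx e₂ = i) (he₃ : idx e₃ = i + 1) :
    IsRed cs (((Quiver.Path.nil.cons e₁).cons e₂).cons e₃) := by
  refine (isRed_two e₁ e₂ (by omega)).cons_of_sgn e₃ he₃ fun x hx => ?_
  simp only [add_assoc, Nat.reduceAdd] at hx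
  have hl := arrow_lt e₃
  rw [he₃] at hl
  have l0 : b₂.start i < b₂.start (i + 1) := b₂.start_lt_succ (by omega)
  have l1 : b₂.start (i + 1) < b₂.start (i + 2) := b₂.start_lt_succ (by omega)
  have l2 : b₂.start (i + 2) < b₂.start (i + 3) := b₂.start_lt_succ (by omega)
  have hp := b₂.start_pos (m := i) (by omega)
  obtain ⟨t1, t2, -⟩ := arrow_starts e₂ he₂
  have t3 := t2 h0
  have t4 := t1 i (by omega)
  have t5 := t1 (i + 2) (by omega)
  have t6 := t1 (i + 3) (by omega)
  simp only [pathElt_two, sgn_mul_apply]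
  have k1 := blockSwap_arrow' (cs := cs) e₂ he₂ h0 (p := b₂.start i)
    (q := b₂.start (i + 1)) (r := b₂.start (i + 2)) (by omega) (by omega) (by omega)
  have k2 := blockSwap_arrow' (cs := cs) e₁ he₁ (by omega)
    (p := b₂.start i + b₂.start (i + 2) - b₂.start (i + 1)) (q := b₂.start (i + 2))
    (r := b₂.start (i + 3)) (by omega) (by simp only [add_assoc, Nat.reduceAdd]; omega)
    (by simp only [add_assoc, Nat.reduceAdd]; omega)
  rw [(k1 x).right (by omega), (k1 (x + 1)).outer (by omega), (k2 _).inner (by omega),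
    (k2 (x + 1)).right (by omega)]
  omega

lemma elt_four {e₁ : a ⟶ b₁} {e₂ : b₁ ⟶ b₂} {e₃ : b₂ ⟶ b₃} {e₄ : b₃ ⟶ d}
    {f₁ : a' ⟶ c₁} {f₂ : c₁ ⟶ c₂} {f₃ : c₂ ⟶ c₃} {f₄ : c₃ ⟶ d}
    (he₁ : idx e₁ = 1) (he₂ : idx e₂ = 0) (he₃ : idx e₃ = 1) (he₄ : idx e₄ = 0)
    (hf₁ : idx f₁ = 0) (hf₂ : idx f₂ = 1) (hf₃ : idx f₃ = 0) (hf₄ : idx f₄ = 1) :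
    arrowElt cs e₁ * arrowElt cs e₂ * arrowElt cs e₃ * arrowElt cs e₄ =
      arrowElt cs f₁ * arrowElt cs f₂ * arrowElt cs f₃ * arrowElt cs f₄ := by
  refine eq_of_sgn_eq_of_nonneg (cs := cs) fun x hx => ?_
  have hl := arrow_lt' f₄
  rw [hf₄] at hl
  have l1 : d.start 1 < d.start 2 := d.start_lt_succ (by omega)
  have l2 : d.start 2 < d.start 3 := d.start_lt_succ (by omega)
  have hp := d.start_pos (m := 1) (by omega)
  have z1 := start_arrow_of_idx_zero e₄ he₄
  have z2 := start_arrow_of_idx_zero e₂ he₂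
  have z3 := start_arrow_of_idx_zero f₃ hf₃
  obtain ⟨s1, s2, -⟩ := arrow_starts e₃ he₃
  obtain ⟨t1, t2, -⟩ := arrow_starts f₄ hf₄
  obtain ⟨u1, u2, -⟩ := arrow_starts f₂ hf₂
  have s3 := s2 (by omega)
  have t3 := t2 (by omega)
  have u3 := u2 (by omega)
  have s4 := s1 1 (by omega)
  have s5 := s1 3 (by omega)
  have t4 := t1 1 (by omega)
  have t5 := t1 3 (by omega)
  have u4 := u1 1 (by omega)
  have u5 := u1 3 (by omega)
  have z11 := z1 1
  have z12 := z1 2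
  have z13 := z1 3
  have z21 := z2 1
  have z22 := z2 2
  have z23 := z2 3
  have z31 := z3 1
  have z32 := z3 2
  have z33 := z3 3
  simp only [Nat.reduceAdd] at s3 t3 u3
  simp only [sgn_mul_apply]
  refine block_four (p := d.start 1) (q := d.start 2) (r := d.start 3)
    (by omega) (by omega) (by omega)
    (blockNeg_arrow' e₄ he₄ ?_ ?_ _) (blockSwap_arrow' e₃ he₃ (by omega) ?_ ?_ ?_ _)
    (blockNeg_arrow' e₂ he₂ ?_ ?_ _) (blockSwap_arrow' e₁ he₁ (by omega) ?_ ?_ ?_ _)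
    (blockSwap_arrow' f₄ hf₄ (by omega) ?_ ?_ ?_ _) (blockNeg_arrow' f₃ hf₃ ?_ ?_ _)
    (blockSwap_arrow' f₂ hf₂ (by omega) ?_ ?_ ?_ _) (blockNeg_arrow' f₁ hf₁ ?_ ?_ _) hx
  all_goals first
    | rfl
    | (simp only [Nat.reduceAdd]; omega)
    | omega

lemma isRed_four {e₁ : a ⟶ b₁} {e₂ : b₁ ⟶ b₂} {e₃ : b₂ ⟶ b₃} {e₄ : b₃ ⟶ d}
    (he₁ : idx e₁ = 1) (he₂ : idx e₂ = 0) (he₃ : idx e₃ = 1) (he₄ : idx e₄ = 0) :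
    IsRed cs ((((Quiver.Path.nil.cons e₁).cons e₂).cons e₃).cons e₄) := by
  have hl := arrow_lt e₃
  rw [he₃] at hl
  have l1 : b₂.start 1 < b₂.start 2 := b₂.start_lt_succ (by omega)
  have l2 : b₂.start 2 < b₂.start 3 := b₂.start_lt_succ (by omega)
  have hp := b₂.start_pos (m := 1) (by omega)
  have z2 := start_arrow_of_idx_zero e₂ he₂
  have z21 := z2 1
  have z22 := z2 2
  have z23 := z2 3
  have k2 := blockNeg_arrow' (cs := cs) e₂ he₂ (q := b₂.start 1) (r := b₂.start 2) (by omega)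
    (by omega)
  have k1 := blockSwap_arrow' (cs := cs) e₁ he₁ (by omega) (p := b₂.start 1) (q := b₂.start 2)
    (r := b₂.start 3) (by omega) (by simp only [Nat.reduceAdd]; omega)
    (by simp only [Nat.reduceAdd]; omega)
  refine ((isRed_two e₁ e₂ (by omega)).cons_of_sgn e₃ he₃ fun x hx => ?_).cons_of_sgn e₄ he₄
    fun x hx => ?_
  · simp only [Nat.reduceAdd] at hx
    simp only [pathElt_two, sgn_mul_apply]
    rw [(k2 x).mid (by omega), (k2 (x + 1)).outer (by omega), (k1 _).neg_left (by omega),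
      (k1 (x + 1)).right (by omega)]
    omega
  · simp only [zero_add] at hx
    obtain ⟨s1, s2, -⟩ := arrow_starts e₃ he₃
    have s3 := s2 (by omega)
    have s4 := s1 1 (by omega)
    have s5 := s1 3 (by omega)
    simp only [Nat.reduceAdd] at s3
    have k3 := blockSwap_arrow' (cs := cs) e₃ he₃ (by omega) (p := b₂.start 1)
      (q := b₂.start 1 + b₂.start 3 - b₂.start 2)
      (r := b₂.start 3) (by omega) (by simp only [Nat.reduceAdd]; omega)
      (by simp only [Nat.reduceAdd]; omega)
    rw [pathElt_cons, pathElt_two]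
    simp only [sgn_mul_apply]
    rw [(k3 x).inner (by omega), (k3 (x + 1)).left (by omega), (k2 x).inner (by omega),
      (k2 _).outer (by omega), (k1 x).inner (by omega), (k1 _).right (by omega)]
    omega

lemma isRed_four' {e₁ : a ⟶ b₁} {e₂ : b₁ ⟶ b₂} {e₃ : b₂ ⟶ b₃} {e₄ : b₃ ⟶ d}
    (he₁ : idx e₁ = 0) (he₂ : idx e₂ = 1) (he₃ : idx e₃ = 0) (he₄ : idx e₄ = 1) :
    IsRed cs ((((Quiver.Path.nil.cons e₁).cons e₂).cons e₃).cons e₄) := by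
  have hl := arrow_lt' e₂
  rw [he₂] at hl
  have l1 : b₂.start 1 < b₂.start 2 := b₂.start_lt_succ (by omega)
  have l2 : b₂.start 2 < b₂.start 3 := b₂.start_lt_succ (by omega)
  have hp := b₂.start_pos (m := 1) (by omega)
  obtain ⟨s1, s2, -⟩ := arrow_starts e₂ he₂
  have s3 := s2 (by omega)
  have s4 := s1 1 (by omega)
  have s5 := s1 3 (by omega)
  simp only [Nat.reduceAdd] at s3
  have k2 := blockSwap_arrow' (cs := cs) e₂ he₂ (by omega) (p := b₂.start 1) (q := b₂.start 2)
    (r := b₂.start 3) (by omega) (by simp only [Nat.reduceAdd])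
    (by simp only [Nat.reduceAdd])
  have k1 := blockNeg_arrow' (cs := cs) e₁ he₁ (q := b₂.start 1)
    (r := b₂.start 1 + b₂.start 3 - b₂.start 2) (by omega) (by omega)
  refine ((isRed_two e₁ e₂ (by omega)).cons_of_sgn e₃ he₃ fun x hx => ?_).cons_of_sgn e₄ he₄
    fun x hx => ?_
  · simp only [zero_add] at hx
    simp only [pathElt_two, sgn_mul_apply]
    rw [(k2 x).inner (by omega), (k2 (x + 1)).left (by omega), (k1 x).inner (by omega),
      (k1 _).outer (by omega)]
    omega
  · have z3 := start_arrow_of_idx_zero e₃ he₃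
    have z31 := z3 1
    have z32 := z3 2
    simp only [Nat.reduceAdd] at hx
    have k3 := blockNeg_arrow' (cs := cs) e₃ he₃ (q := b₂.start 1) (r := b₂.start 2) (by omega)
      (by omega)
    rw [pathElt_cons, pathElt_two]
    simp only [sgn_mul_apply]
    rw [(k3 x).mid (by omega), (k3 (x + 1)).outer (by omega), (k2 _).neg_left (by omega),
      (k2 (x + 1)).right (by omega), (k1 _).neg_outer (by omega), (k1 _).mid (by omega)]
    omega

end PathElements

end CoxeterB

namespace CoxeterB

section Matsumoto

/-! ### Reduced paths -/

variable {n : ℕ} {a a' b b' b₁ b₂ b₃ c c₁ c₂ c₃ d : LabelSeq n}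

open LabelSeq

/-- The morphism of the labeled nilCoxeter algebroid of a path. -/
noncomputable def pathMor (p : Quiver.Path c d) : NilCoxB.of c ⟶ NilCoxB.of d :=
  (Quotient.functor NilRel).map ((Free.embedding ℤ (Paths (LabelSeq n))).map
    (show (show Paths (LabelSeq n) from c) ⟶ (show Paths (LabelSeq n) from d) from p))

lemma pathMor_comp (p : Quiver.Path c b) (q : Quiver.Path b d) :
    pathMor (p.comp q) = pathMor p ≫ pathMor q := by
  unfold pathMor
  erw [← Functor.map_comp, ← Functor.map_comp]
  rfl

/-- The morphism of the labeled nilCoxeter algebroid of an arrow. -/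
noncomputable def arrowMor (e : c ⟶ d) : NilCoxB.of c ⟶ NilCoxB.of d :=
  (Quotient.functor NilRel).map (FreeCat.gen e)

lemma pathMor_cons (p : Quiver.Path c b) (e : b ⟶ d) :
    pathMor (p.cons e) = pathMor p ≫ arrowMor e :=
  pathMor_comp p (Quiver.Path.nil.cons e)

lemma pathMor_single (e : c ⟶ d) : pathMor (Quiver.Path.nil.cons e) = arrowMor e := rfl

lemma arrowMor_comp_self (e₁ : a ⟶ b) (e₂ : b ⟶ d) (h : idx e₁ = idx e₂) :
    arrowMor e₁ ≫ arrowMor e₂ = 0 :=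
  ((Quotient.functor NilRel).map_comp _ _).symm.trans
    (CategoryTheory.Quotient.sound _ (.nil e₁ e₂ h))

lemma pathMor_comm {i j : ℕ} (hij : i + 1 < j ∨ j + 1 < i) {e₁ : a ⟶ b} {e₂ : b ⟶ d} {f₁ : a ⟶ c}
    {f₂ : c ⟶ d} (he₁ : idx e₁ = j) (he₂ : idx e₂ = i) (hf₁ : idx f₁ = i) (hf₂ : idx f₂ = j) :
    pathMor ((Quiver.Path.nil.cons e₁).cons e₂) = pathMor ((Quiver.Path.nil.cons f₁).cons f₂) := by
  simp only [pathMor_cons _ e₂, pathMor_cons _ f₂, pathMor_single]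
  exact ((Quotient.functor NilRel).map_comp _ _).symm.trans ((CategoryTheory.Quotient.sound _
    (.comm i j hij e₁ e₂ f₁ f₂ ⟨he₁, he₂⟩ ⟨hf₁, hf₂⟩)).trans
      ((Quotient.functor NilRel).map_comp _ _))

lemma map_comp_three {C D : Type*} [Category C] [Category D] (F : C ⥤ D) {X₁ X₂ X₃ X₄ : C}
    (f : X₁ ⟶ X₂) (g : X₂ ⟶ X₃) (h : X₃ ⟶ X₄) :
    F.map (f ≫ g ≫ h) = F.map f ≫ F.map g ≫ F.map h := by
  simp

lemma map_comp_four {C D : Type*} [Category C] [Category D] (F : C ⥤ D) {X₁ X₂ X₃ X₄ X₅ : C}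
    (f : X₁ ⟶ X₂) (g : X₂ ⟶ X₃) (h : X₃ ⟶ X₄) (k : X₄ ⟶ X₅) :
    F.map (f ≫ g ≫ h ≫ k) = F.map f ≫ F.map g ≫ F.map h ≫ F.map k := by
  simp

lemma pathMor_braid {i : ℕ} (h0 : 1 ≤ i) {e₁ : a ⟶ b₁} {e₂ : b₁ ⟶ b₂} {e₃ : b₂ ⟶ d}
    {f₁ : a ⟶ c₁} {f₂ : c₁ ⟶ c₂} {f₃ : c₂ ⟶ d}
    (he₁ : idx e₁ = i) (he₂ : idx e₂ = i + 1) (he₃ : idx e₃ = i)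
    (hf₁ : idx f₁ = i + 1) (hf₂ : idx f₂ = i) (hf₃ : idx f₃ = i + 1) :
    pathMor (((Quiver.Path.nil.cons e₁).cons e₂).cons e₃) =
      pathMor (((Quiver.Path.nil.cons f₁).cons f₂).cons f₃) := by
  simp only [pathMor_cons _ e₂, pathMor_cons _ f₂, pathMor_cons _ e₃, pathMor_cons _ f₃,
    pathMor_single, Category.assoc]
  exact (map_comp_three (Quotient.functor NilRel) _ _ _).symm.trans
    ((CategoryTheory.Quotient.sound _
      (.braid i h0 e₁ e₂ e₃ f₁ f₂ f₃ ⟨he₁, he₂, he₃⟩ ⟨hf₁, hf₂, hf₃⟩)).trans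
      (map_comp_three (Quotient.functor NilRel) _ _ _))

lemma pathMor_four {e₁ : a ⟶ b₁} {e₂ : b₁ ⟶ b₂} {e₃ : b₂ ⟶ b₃} {e₄ : b₃ ⟶ d}
    {f₁ : a ⟶ c₁} {f₂ : c₁ ⟶ c₂} {f₃ : c₂ ⟶ c₃} {f₄ : c₃ ⟶ d}
    (he₁ : idx e₁ = 1) (he₂ : idx e₂ = 0) (he₃ : idx e₃ = 1) (he₄ : idx e₄ = 0)
    (hf₁ : idx f₁ = 0) (hf₂ : idx f₂ = 1) (hf₃ : idx f₃ = 0) (hf₄ : idx f₄ = 1) :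
    pathMor ((((Quiver.Path.nil.cons e₁).cons e₂).cons e₃).cons e₄) =
      pathMor ((((Quiver.Path.nil.cons f₁).cons f₂).cons f₃).cons f₄) := by
  simp only [pathMor_cons _ e₂, pathMor_cons _ f₂, pathMor_cons _ e₃, pathMor_cons _ f₃,
    pathMor_cons _ e₄, pathMor_cons _ f₄, pathMor_single, Category.assoc]
  exact (map_comp_four (Quotient.functor NilRel) _ _ _ _).symm.trans
    ((CategoryTheory.Quotient.sound _
      (.four e₁ e₂ e₃ e₄ f₁ f₂ f₃ f₄ ⟨he₁, he₂, he₃, he₄⟩ ⟨hf₁, hf₂, hf₃, hf₄⟩)).trans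
      (map_comp_four (Quotient.functor NilRel) _ _ _ _))

/-! ### Rank-two parabolic subsets and their two words -/

/-- The union of the parabolic subset with the elements number `i` and `j` of its complement. -/
def span (i j : ℕ) (c : LabelSeq n) : Set (Fin n) :=
  {x | ∀ m, m + 1 < c.len → m ≠ i → m ≠ j → c.start (m + 1) ≠ x + 1}

lemma insert_gap_subset_span (c : LabelSeq n) {k i j : ℕ} (hk : k + 1 < c.len) (h : k = i ∨ k = j) :
    insert (c.gap k hk) c.parabolicSubset ⊆ span i j c := fun x hx m hm hi hj =>
  (c.mem_insert_gap hk).1 hx m hm (by rcases h with rfl | rfl <;> assumption)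

lemma span_subset (c : LabelSeq n) {i j : ℕ} (hi : i + 1 < c.len) (hj : j + 1 < c.len) :
    span i j c ⊆ insert (c.gap i hi) (insert (c.gap j hj) c.parabolicSubset) := by
  intro x hx
  by_cases h : x ∈ c.parabolicSubset
  · exact .inr (.inr h)
  obtain ⟨m, hm, rfl⟩ := c.notMem_parabolicSubset.1 h
  by_cases h1 : m = i
  · subst h1; exact .inl rfl
  by_cases h2 : m = j
  · subst h2; exact .inr (.inl rfl)
  exact absurd (c.gap_add_one m hm).symm (hx m hm h1 h2)

/-- An arrow of index `i` or `j` can move only the start that this subset ignores. Hence a whole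
path with these indices stays in one rank-two parabolic subgroup. -/
lemma span_arrow {i j : ℕ} (e : c ⟶ d) (h : idx e = i ∨ idx e = j) : span i j c = span i j d := by
  ext x
  refine forall_congr' fun m => ?_
  rw [arrow_len e]
  refine forall_congr' fun hm => forall_congr' fun hi => forall_congr' fun hj => ?_
  rw [start_arrow e (m := m + 1)]
  rcases h with h | h <;> omega

variable {W : Type*} [Group W] {cs : CoxeterSystem (typeB n) W} [Finite W]

lemma pathElt_cons_mem {i j : ℕ} {p : Quiver.Path c b} (h : pathElt cs p ∈ parabolic cs (span i j b))
    (e : b ⟶ d) (he : idx e = i ∨ idx e = j) :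
    pathElt cs (p.cons e) ∈ parabolic cs (span i j d) := by
  rw [span_arrow e he] at h
  have h1 := insert_gap_subset_span d (arrow_lt' e) he
  refine mul_mem h (parabolic_mono h1 (mul_mem (wl_mem _) ?_))
  exact parabolic_mono (Set.subset_insert _ _) (wl_mem _)

lemma pathElt_nil_mem {i j : ℕ} :
    pathElt cs (.nil : Quiver.Path c c) ∈ parabolic cs (span i j c) := one_mem _

lemma exists_arrowTo (d : LabelSeq n) {i : ℕ} (hi : i + 1 < d.len) :
    ∃ (b : LabelSeq n) (e : b ⟶ d), idx e = i ∧ b.len = d.len :=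
  ⟨_, arrowTo d i hi, rfl, len_act _ _⟩

/-- The source subset is the conjugate of the target subset by the element. -/
lemma eq_of_pathElt_eq {p : Quiver.Path a d} {q : Quiver.Path a' d}
    (h : pathElt cs p = pathElt cs q) : a = a' :=
  parabolicSubset_injective ((isCoreElt_pathElt p).left_unique (h ▸ isCoreElt_pathElt q)
    (simple_injective_typeB cs))

/-- Two reduced paths with the given last indices `i` and `j`, in rank two, that are identified by
a defining relation. -/
lemma exists_rank_two_of_lt (d : LabelSeq n) {i j : ℕ} (hij : i < j) (hj : j + 1 < d.len) :
    ∃ (a b b' : LabelSeq n) (p : Quiver.Path a b) (e : b ⟶ d) (q : Quiver.Path a b') (f : b' ⟶ d),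
      idx e = i ∧ idx f = j ∧ IsRed cs (p.cons e) ∧ IsRed cs (q.cons f) ∧
      pathElt cs (p.cons e) = pathElt cs (q.cons f) ∧
      pathElt cs (p.cons e) ∈ parabolic cs (span i j d) ∧
      pathMor (p.cons e) = pathMor (q.cons f) := by
  have hi : i + 1 < d.len := by omega
  rcases Nat.lt_or_ge (i + 1) j with h | h
  · obtain ⟨b, e₂, he₂, hb⟩ := exists_arrowTo d hi
    obtain ⟨a, e₁, he₁, -⟩ := exists_arrowTo b (i := j) (by omega)
    obtain ⟨c, f₂, hf₂, hc⟩ := exists_arrowTo d hj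
    obtain ⟨a', f₁, hf₁, -⟩ := exists_arrowTo c (i := i) (by omega)
    have key : pathElt cs ((Quiver.Path.nil.cons e₁).cons e₂) =
        pathElt cs ((Quiver.Path.nil.cons f₁).cons f₂) := by
      rw [pathElt_two, pathElt_two]
      exact elt_comm (.inl h) he₁ he₂ hf₁ hf₂
    -- Both words are built backwards from `d`; only the equality of their elements shows that they
    -- start at the same sequence, as the defining relation requires.
    obtain rfl := eq_of_pathElt_eq key
    exact ⟨a, b, c, Quiver.Path.nil.cons e₁, e₂, Quiver.Path.nil.cons f₁, f₂, he₂, hf₂,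
      isRed_two _ _ (by omega), isRed_two _ _ (by omega), key,
      pathElt_cons_mem (pathElt_cons_mem pathElt_nil_mem _ (.inr he₁)) _ (.inl he₂),
      pathMor_comm (.inl h) he₁ he₂ hf₁ hf₂⟩
  obtain rfl : j = i + 1 := by omega
  obtain ⟨b₂, e₃, he₃, hb₂⟩ := exists_arrowTo d hi
  obtain ⟨b₁, e₂, he₂, hb₁⟩ := exists_arrowTo b₂ (i := i + 1) (by omega)
  obtain ⟨a, e₁, he₁, ha⟩ := exists_arrowTo b₁ (i := i) (by omega)
  obtain ⟨c₂, f₃, hf₃, hc₂⟩ := exists_arrowTo d hj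
  obtain ⟨c₁, f₂, hf₂, hc₁⟩ := exists_arrowTo c₂ (i := i) (by omega)
  obtain ⟨a', f₁, hf₁, ha'⟩ := exists_arrowTo c₁ (i := i + 1) (by omega)
  rcases Nat.eq_zero_or_pos i with rfl | h0
  · rw [zero_add] at *
    -- The indices `0` and `1` satisfy the relation of order four, so each word needs one more
    -- letter in front.
    obtain ⟨a₀, e₀, he₀, -⟩ := exists_arrowTo a (i := 1) (by omega)
    obtain ⟨a₀', f₀, hf₀, -⟩ := exists_arrowTo a' (i := 0) (by omega)
    have key : pathElt cs ((((Quiver.Path.nil.cons e₀).cons e₁).cons e₂).cons e₃) =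
        pathElt cs ((((Quiver.Path.nil.cons f₀).cons f₁).cons f₂).cons f₃) := by
      simp only [pathElt_cons, pathElt_nil, one_mul]
      exact elt_four he₀ he₁ he₂ he₃ hf₀ hf₁ hf₂ hf₃
    obtain rfl := eq_of_pathElt_eq key
    exact ⟨_, _, _, _, e₃, _, f₃, he₃, hf₃, isRed_four he₀ he₁ he₂ he₃, isRed_four' hf₀ hf₁ hf₂ hf₃,
      key, pathElt_cons_mem (pathElt_cons_mem (pathElt_cons_mem (pathElt_cons_mem pathElt_nil_mem
        _ (.inr he₀)) _ (.inl he₁)) _ (.inr he₂)) _ (.inl he₃),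
      pathMor_four he₀ he₁ he₂ he₃ hf₀ hf₁ hf₂ hf₃⟩
  · have key : pathElt cs (((Quiver.Path.nil.cons e₁).cons e₂).cons e₃) =
        pathElt cs (((Quiver.Path.nil.cons f₁).cons f₂).cons f₃) := by
      simp only [pathElt_cons, pathElt_nil, one_mul]
      exact elt_braid (by omega) he₁ he₂ he₃ hf₁ hf₂ hf₃
    obtain rfl := eq_of_pathElt_eq key
    exact ⟨_, _, _, _, e₃, _, f₃, he₃, hf₃, isRed_braid (by omega) he₁ he₂ he₃,
      isRed_braid' (by omega) hf₁ hf₂ hf₃, key,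
      pathElt_cons_mem (pathElt_cons_mem (pathElt_cons_mem pathElt_nil_mem
        _ (.inl he₁)) _ (.inr he₂)) _ (.inl he₃),
      pathMor_braid h0 he₁ he₂ he₃ hf₁ hf₂ hf₃⟩

lemma span_comm (i j : ℕ) : span i j d = span j i d := by
  ext x
  exact forall_congr' fun m => forall_congr' fun _ => ⟨fun h a b => h b a, fun h a b => h b a⟩

lemma exists_rank_two (d : LabelSeq n) {i j : ℕ} (hij : i ≠ j) (hi : i + 1 < d.len)
    (hj : j + 1 < d.len) :
    ∃ (a b b' : LabelSeq n) (p : Quiver.Path a b) (e : b ⟶ d) (q : Quiver.Path a b') (f : b' ⟶ d),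
      idx e = i ∧ idx f = j ∧ IsRed cs (p.cons e) ∧ IsRed cs (q.cons f) ∧
      pathElt cs (p.cons e) = pathElt cs (q.cons f) ∧
      pathElt cs (p.cons e) ∈ parabolic cs (span i j d) ∧
      pathMor (p.cons e) = pathMor (q.cons f) := by
  rcases Nat.lt_or_gt_of_ne hij with h | h
  · exact exists_rank_two_of_lt d h hj
  · obtain ⟨a, b, b', p, e, q, f, he, hf, hp, hq, h1, h2, h3⟩ :=
      exists_rank_two_of_lt (cs := cs) d h hi
    exact ⟨a, b', b, q, f, p, e, hf, he, hq, hp, h1.symm, span_comm (d := d) i j ▸ h1 ▸ h2, h3.symm⟩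

/-! ### Existence of reduced paths, Matsumoto's theorem, vanishing of other paths -/

/-- Every core element is the element of a reduced path. -/
lemma IsCoreElt.exists_path {c d : LabelSeq n} {w : W}
    (h : IsCoreElt cs c.parabolicSubset d.parabolicSubset w) :
    ∃ p : Quiver.Path c d, IsRed cs p ∧ pathElt cs p = w := by
  induction hN : cs.length w using Nat.strong_induction_on generalizing d w with
  | _ N ih =>
  by_cases hw : w = 1
  · subst hw
    obtain rfl := parabolicSubset_injective (h.eq_of_one (simple_injective_typeB cs))
    exact ⟨.nil, isRed_nil, rfl⟩
  obtain ⟨s, hs⟩ := cs.exists_rightDescent_of_ne_one hw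
  -- A core element has no descent inside `J`, so this one is some `d_i`, and the atomic element of
  -- index `i` can be split off.
  have hsd : s ∉ d.parabolicSubset := fun hsd => (h.noDescent s hsd).not_gt hs
  obtain ⟨i, hi, rfl⟩ := d.notMem_parabolicSubset.1 hsd
  obtain ⟨v, hv, rfl, hl⟩ := h.exists_mul_cross d hi hs
  have := length_arrowElt_pos (cs := cs) (arrowTo d i hi)
  obtain ⟨p, hp, rfl⟩ := ih _ (by rw [← hN, hl]; exact Nat.lt_add_of_pos_right this) hv rfl
  exact ⟨p.cons (arrowTo d i hi), (isRed_cons_iff _ _).2 ⟨hp, hl⟩, rfl⟩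

lemma exists_eq_of_idx_eq {e : b ⟶ d} {f : b' ⟶ d} (h : idx e = idx f) (q : Quiver.Path c b') :
    ∃ q' : Quiver.Path c b, q.cons f = q'.cons e := by
  obtain rfl : b = b' := by rw [arrow_eq' e, arrow_eq' f, h]
  obtain rfl : e = f := Subtype.ext h
  exact ⟨q, rfl⟩

/-- Matsumoto's theorem for reduced paths. -/
lemma pathMor_eq_of_pathElt_eq {c d : LabelSeq n} {p q : Quiver.Path c d} (hp : IsRed cs p)
    (hq : IsRed cs q) (h : pathElt cs p = pathElt cs q) : pathMor p = pathMor q := by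
  induction hN : pathLen cs p using Nat.strong_induction_on generalizing d with
  | _ N ih =>
  have hlen : pathLen cs p = pathLen cs q := by rw [← hp, ← hq, h]
  cases p with
  | nil =>
    cases q with
    | nil => rfl
    | cons q f =>
      have := length_arrowElt_pos (cs := cs) f
      rw [pathLen_cons] at hlen
      simp only [pathLen] at hlen
      omega
  | @cons b _ p e =>
  -- For equal last indices the last arrows coincide and can be cancelled, so the induction
  -- hypothesis applies to the prefixes.
  have same : ∀ {b b' : LabelSeq n} {p : Quiver.Path c b} {e : b ⟶ d} {q : Quiver.Path c b'}
      {f : b' ⟶ d}, pathLen cs (p.cons e) = N → IsRed cs (p.cons e) → IsRed cs (q.cons f) →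
      pathElt cs (p.cons e) = pathElt cs (q.cons f) → idx e = idx f →
      pathMor (p.cons e) = pathMor (q.cons f) := by
    intro b b' p e q f hN hp hq h hi
    obtain ⟨q, hq'⟩ := exists_eq_of_idx_eq hi q
    rw [hq'] at h hq ⊢
    have := length_arrowElt_pos (cs := cs) e
    rw [pathMor_cons, pathMor_cons, ih (pathLen cs p) (by rw [pathLen_cons] at hN; omega)
      ((isRed_cons_iff p e).1 hp).1 ((isRed_cons_iff q e).1 hq).1 (mul_right_cancel h) rfl]
  cases q with
  | nil =>
    have := length_arrowElt_pos (cs := cs) e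
    rw [pathLen_cons] at hlen
    simp only [pathLen] at hlen
    omega
  | @cons b' _ q f =>
  by_cases hi : idx e = idx f
  · exact same hN hp hq h hi
  -- The element has two distinct descents, hence is divisible by the rank-two element. A reduced
  -- path `t` of the quotient, followed by either rank-two word, gives two intermediate paths: each
  -- shares its last index with one of the given paths, and a defining relation joins them.
  obtain ⟨a, b₁, b₂, r, e', s, f', he, hf, hr, hs, hrs, hm, hQ⟩ :=
    exists_rank_two (cs := cs) d hi (arrow_lt' e) (arrow_lt' f)
  obtain ⟨v, hv, hw, hl⟩ := (isCoreElt_pathElt (p.cons e)).exists_of_two_descents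
    (hp.descent rfl (arrow_lt' e)) (h ▸ hq.descent rfl (arrow_lt' f))
    (isCoreElt_pathElt (r.cons e')) (parabolic_mono (span_subset d (arrow_lt' e) (arrow_lt' f)) hm)
    (hr.descent he (arrow_lt' e)) (hrs ▸ hs.descent hf (arrow_lt' f))
  obtain ⟨t, ht, rfl⟩ := hv.exists_path
  have h1 : IsRed cs (t.comp (r.cons e')) := by
    rw [IsRed, pathElt_comp, pathLen_comp, ← ht, ← hr, ← hl, hw]
  have h2 : IsRed cs (t.comp (s.cons f')) := by
    rw [IsRed, pathElt_comp, pathLen_comp, ← ht, ← hs, ← hrs, ← hl, hw]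
  calc pathMor (p.cons e) = pathMor (t.comp (r.cons e')) :=
        same hN hp h1 (by rw [← Quiver.Path.comp_cons, pathElt_comp, hw]) he.symm
    _ = pathMor (t.comp (s.cons f')) := by rw [pathMor_comp, pathMor_comp, hQ]
    _ = pathMor (q.cons f) := (same (hlen ▸ hN) hq h2 (by
        rw [← Quiver.Path.comp_cons, pathElt_comp, ← h, ← hrs, hw]) hf.symm).symm

/-- The morphism of a path that is not reduced vanishes. -/
lemma pathMor_eq_zero {p : Quiver.Path c d} (hp : ¬ IsRed cs p) : pathMor p = 0 := by
  induction p with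
  | nil => exact absurd isRed_nil hp
  | @cons b d p e ih =>
    rw [pathMor_cons]
    by_cases h : IsRed cs p
    · have hd : cs.length (pathElt cs p * cs.simple (b.gap (idx e) (arrow_lt e))) <
          cs.length (pathElt cs p) := by
        by_contra hc
        refine hp ((isRed_cons_iff p e).2 ⟨h, (isCoreElt_pathElt p).length_mul_arrowElt e ?_⟩)
        exact (length_mul_simple_lt_or _ _).resolve_left hc
      -- Failure of additivity means that `p` has a descent at the boundary crossed by `e`. By
      -- Matsumoto, `p` may be replaced by a path whose last arrow has the index of `e`, and the
      -- square of an index is zero.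
      obtain ⟨v, hv, hw, hl⟩ := (isCoreElt_pathElt p).exists_mul_cross b (arrow_lt e) hd
      obtain ⟨q, hq, rfl⟩ := hv.exists_path
      have hq' : IsRed cs (q.cons (arrowTo b (idx e) (arrow_lt e))) :=
        (isRed_cons_iff _ _).2 ⟨hq, hw ▸ hl⟩
      rw [pathMor_eq_of_pathElt_eq h hq' hw, pathMor_cons, Category.assoc,
        arrowMor_comp_self _ _ (idx_arrowTo _ _ _), Limits.comp_zero]
    · rw [ih h, Limits.zero_comp]

end Matsumoto

end CoxeterB

namespace CoxeterB

section FreeLift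

/-! ### The functor -/

/-- A functor from `C` to a preadditive category extends to the free `ℤ`-linear category on `C`. -/
noncomputable def freeLift {C D : Type*} [Category C] [Category D] [Preadditive D] (F : C ⥤ D) :
    Free ℤ C ⥤ D where
  obj X := F.obj X
  map {X Y} f := Finsupp.liftAddHom (fun p : (show C from X) ⟶ (show C from Y) =>
    (zmultiplesHom _ (F.map p))) f
  map_id X := by
    refine (Finsupp.liftAddHom_apply_single _ _ _).trans ?_
    exact (one_zsmul _).trans (F.map_id X)
  map_comp {X Y Z} f g := by
    induction f using Finsupp.induction_linear with
    | zero =>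
      rw [Limits.zero_comp]
      erw [map_zero, map_zero]
      rw [Limits.zero_comp]
    | add f₁ f₂ h₁ h₂ =>
      rw [Preadditive.add_comp]
      erw [map_add, map_add]
      rw [Preadditive.add_comp, h₁, h₂]
    | single p r =>
      induction g using Finsupp.induction_linear with
      | zero =>
        rw [Limits.comp_zero]
        erw [map_zero, map_zero]
        rw [Limits.comp_zero]
      | add f₁ f₂ h₁ h₂ =>
        rw [Preadditive.comp_add]
        erw [map_add, map_add]
        rw [Preadditive.comp_add, h₁, h₂]
      | single q s =>
        erw [Free.single_comp_single]
        erw [Finsupp.liftAddHom_apply_single, Finsupp.liftAddHom_apply_single,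
          Finsupp.liftAddHom_apply_single]
        simp only [zmultiplesHom_apply, Preadditive.zsmul_comp, Preadditive.comp_zsmul, mul_smul]
        rw [smul_comm]
        exact congrArg (fun x => s • r • x) (F.map_comp p q)

variable {C D : Type*} [Category C] [Category D] [Preadditive D] (F : C ⥤ D)

lemma freeLift_map_embedding {X Y : C} (f : X ⟶ Y) :
    (freeLift F).map ((Free.embedding ℤ C).map f) = F.map f := by
  refine (Finsupp.liftAddHom_apply_single _ _ _).trans ?_
  exact one_zsmul _

lemma freeLift_map_add {X Y : Free ℤ C} (f g : X ⟶ Y) :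
    (freeLift F).map (f + g) = (freeLift F).map f + (freeLift F).map g :=
  map_add _ _ _

lemma freeLift_map_zero {X Y : Free ℤ C} : (freeLift F).map (0 : X ⟶ Y) = 0 :=
  map_zero _

lemma basis_comp {B W : Type*} [Group W] {M : CoxeterMatrix B}
    {cs : CoxeterSystem M W} {I J K : Finitary cs} (p : Coset I J) (q : Coset J K) :
    NilD.basis q ≫ NilD.basis p = basisMul p q :=
  (mulLin_single p q 1 1).trans (by simp)

end FreeLift

/-! ### Images of paths in the nilCoxeter algebroid -/

section PathBasis

variable {n : ℕ} {W : Type*} [Group W] {cs : CoxeterSystem (typeB n) W} [Finite W]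

open LabelSeq

variable (cs) in
/-- The parabolic subset of a sequence as an object of the atomic category. -/
def toAD (c : LabelSeq n) : AD cs := ⟨fin cs c.parabolicSubset⟩

lemma toAD_bijective : Function.Bijective (toAD cs : LabelSeq n → AD cs) := by
  constructor
  · intro c d h
    exact parabolicSubset_injective (congrArg (fun X : AD cs => X.subset.carrier) h)
  · rintro ⟨⟨A, hA⟩⟩
    obtain ⟨c, rfl⟩ := parabolicSubset_bijective.2 A
    exact ⟨c, rfl⟩

variable {a b c d : LabelSeq n}

variable (cs c d) in
/-- The coset of the inverse of a core element from `d` to `c`. -/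
noncomputable def invCoset (w : W) : Coset (toAD cs d).subset (toAD cs c).subset :=
  coset (toAD cs d).subset (toAD cs c).subset w⁻¹

/-- Passing to the inverse replaces the atomic element at the target by the one at the source,
namely `w_M w_J`, which differs from `w_M` by an element of `W_J`. -/
lemma invCoset_arrow (e : c ⟶ d) : invCoset cs c d (arrowElt cs e) =
    coset (toAD cs d).subset (toAD cs c).subset
      (wl cs (insert (c.gap (idx e) (arrow_lt e)) c.parabolicSubset)) := by
  have h : (arrowElt cs e)⁻¹ = cross cs c (idx e) (arrow_lt e) := by
    have hi' : idx e + 1 < (c.act (idx e)).len := by rw [len_act]; exact arrow_lt e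
    rw [inv_eq_iff_eq_inv, cross_inv c (arrow_lt e) hi']
    exact cross_congr (arrow_eq e) rfl _ _
  rw [invCoset, h]
  refine coset_eq.2 ⟨1, one_mem _, wl cs c.parabolicSubset, wl_mem _, ?_⟩
  rw [cross, one_mul, mul_assoc, wl_mul_wl, mul_one]

lemma isAtomicAt_invCoset (e : c ⟶ d) : IsAtomicAt (idx e) (invCoset cs c d (arrowElt cs e)) := by
  obtain ⟨i, hi, rfl⟩ := e
  have hi' : i + 1 < (c.act i).len := by rw [len_act]; exact hi
  set e : c ⟶ c.act i := ⟨i, hi, rfl⟩ with he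
  set M : Finitary cs := fin cs (insert (c.gap i hi) c.parabolicSubset) with hM
  have hM' : M.carrier = insert ((c.act i).gap i hi') (c.act i).parabolicSubset :=
    (insert_gap_act c hi hi').symm
  have hr : (invCoset cs c (c.act i) (arrowElt cs e)).HasReducedExpr M :=
    hasReducedExpr_iff.2 ⟨⟨by rw [hM']; exact Set.subset_insert _ _, Set.subset_insert _ _⟩,
      invCoset_arrow e⟩
  refine ⟨⟨(isCoreElt_arrowElt e).inv.isCore_coset, _, _, M, gap_notMem _ i hi',
    gap_notMem _ i hi, hM', rfl, hr⟩, c.gap i hi, (c.act i).gap i hi', M, gap_notMem _ i hi,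
    ncard_gap c i hi, rfl, ?_, parabolicSubset_act c hi hi', hr⟩
  change _ = wl cs (insert (c.gap i hi) c.parabolicSubset) * cs.simple (c.gap i hi) *
    wl cs (insert (c.gap i hi) c.parabolicSubset)
  rw [wl_mul_gap c hi hi', mul_assoc, wl_mul_wl, mul_one]

open Classical in
variable (cs) in
/-- The image of a path in the nilCoxeter algebroid: the basis element of its coset if the path is
reduced, and `0` otherwise. -/
noncomputable def pathBasis (p : Quiver.Path c d) :
    (show NilD cs from (toAD cs c).subset) ⟶ (show NilD cs from (toAD cs d).subset) :=
  if IsRed cs p then NilD.basis (invCoset cs c d (pathElt cs p)) else 0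

lemma pathBasis_nil : pathBasis cs (.nil : Quiver.Path c c) = 𝟙 _ := by
  rw [pathBasis, if_pos isRed_nil, pathElt_nil, invCoset, inv_one]
  rfl

/-- Path elements multiply in the order of the arrows, while `∂` composes from right to left; this
is why inverses appear. A path extension is reduced exactly when the corresponding composition of
cosets is. -/
lemma pathBasis_cons (p : Quiver.Path c b) (e : b ⟶ d) : pathBasis cs (p.cons e) =
    pathBasis cs p ≫ NilD.basis (invCoset cs b d (arrowElt cs e)) := by
  have h1 := (isCoreElt_arrowElt (cs := cs) e).inv
  have h2 := (isCoreElt_pathElt (cs := cs) p).inv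
  by_cases hp : IsRed cs p
  · have key := IsCoreElt.isReduced_coset_iff (I := (toAD cs d).subset) (J := (toAD cs b).subset)
      (K := (toAD cs c).subset) h1 h2
    rw [← mul_inv_rev, cs.length_inv, cs.length_inv, cs.length_inv, add_comm] at key
    change (invCoset cs b d (arrowElt cs e)).IsReduced (invCoset cs c b (pathElt cs p)) ↔ _ at key
    rw [pathBasis, pathBasis, if_pos hp, basis_comp, basisMul]
    by_cases hl : cs.length (pathElt cs p * arrowElt cs e) =
      cs.length (pathElt cs p) + cs.length (arrowElt cs e)
    · rw [if_pos ((isRed_cons_iff p e).2 ⟨hp, hl⟩), if_pos (key.2 hl)]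
      have hs := IsCoreElt.star_coset (I := (toAD cs d).subset) (J := (toAD cs b).subset)
        (K := (toAD cs c).subset) h1 h2 (by
          rwa [← mul_inv_rev, cs.length_inv, cs.length_inv, cs.length_inv, add_comm])
      have hs' : (invCoset cs b d (arrowElt cs e)).star (invCoset cs c b (pathElt cs p)) =
          invCoset cs c d (pathElt cs (p.cons e)) :=
        hs.trans (by rw [invCoset, pathElt_cons, mul_inv_rev])
      exact congrArg (fun x => Finsupp.single x (1 : ℤ)) hs'.symm
    · rw [if_neg (fun h => hl ((isRed_cons_iff p e).1 h).2), if_neg (fun h => hl (key.1 h))]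
  · rw [pathBasis, pathBasis, if_neg hp, if_neg (fun h => hp ((isRed_cons_iff p e).1 h).1),
      Limits.zero_comp]

lemma pathBasis_congr {p q : Quiver.Path c d} (hp : IsRed cs p) (hq : IsRed cs q)
    (h : pathElt cs p = pathElt cs q) : pathBasis cs p = pathBasis cs q := by
  rw [pathBasis, pathBasis, if_pos hp, if_pos hq, h]

variable (cs) in
/-- The generating arrows in the atomic category. -/
noncomputable def arrowPrefunctor : LabelSeq n ⥤q AD cs where
  obj := toAD cs
  map e := AD.ofAtomic (invCoset cs _ _ (arrowElt cs e)) (isAtomicAt_invCoset e).1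

variable (cs) in
/-- The functor on the free `ℤ`-linear category. -/
noncomputable def freeFunctor : FreeCat n ⥤ AD cs := freeLift (Paths.lift (arrowPrefunctor cs))

/-- A path as a morphism of the free `ℤ`-linear category. -/
noncomputable def freeMor (p : Quiver.Path c d) :
    (show FreeCat n from c) ⟶ (show FreeCat n from d) :=
  (Free.embedding ℤ (Paths (LabelSeq n))).map
    (show (show Paths (LabelSeq n) from c) ⟶ (show Paths (LabelSeq n) from d) from p)

lemma freeMor_cons (p : Quiver.Path c b) (e : b ⟶ d) :
    freeMor (p.cons e) = freeMor p ≫ FreeCat.gen e :=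
  (Free.embedding ℤ (Paths (LabelSeq n))).map_comp (X := c) (Y := b) (Z := d) p e.toPath

lemma freeFunctor_map (p : Quiver.Path c d) :
    ((freeFunctor cs).map (freeMor p)).1 = pathBasis cs p := by
  refine (congrArg Subtype.val (freeLift_map_embedding (Paths.lift (arrowPrefunctor cs))
    (X := c) (Y := d) p)).trans ?_
  induction p with
  | nil => exact pathBasis_nil.symm
  | cons p e ih =>
    rw [pathBasis_cons, ← ih]
    rfl

lemma map_eq_of_pathBasis_eq {p q : Quiver.Path c d} (h : pathBasis cs p = pathBasis cs q) :
    (freeFunctor cs).map (freeMor p) = (freeFunctor cs).map (freeMor q) :=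
  Subtype.ext ((freeFunctor_map p).trans (h.trans (freeFunctor_map q).symm))

lemma freeMor_single (e : c ⟶ d) : freeMor (Quiver.Path.nil.cons e) = FreeCat.gen e := rfl

lemma freeMor_three {e₁ : a ⟶ b} {e₂ : b ⟶ c} {e₃ : c ⟶ d} :
    freeMor (((Quiver.Path.nil.cons e₁).cons e₂).cons e₃) =
      FreeCat.gen e₁ ≫ FreeCat.gen e₂ ≫ FreeCat.gen e₃ := by
  rw [freeMor_cons, freeMor_cons, freeMor_single]
  exact Category.assoc _ _ _

lemma freeMor_four {a' : LabelSeq n} {e₁ : a ⟶ a'} {e₂ : a' ⟶ b} {e₃ : b ⟶ c} {e₄ : c ⟶ d} :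
    freeMor ((((Quiver.Path.nil.cons e₁).cons e₂).cons e₃).cons e₄) =
      FreeCat.gen e₁ ≫ FreeCat.gen e₂ ≫ FreeCat.gen e₃ ≫ FreeCat.gen e₄ := by
  rw [freeMor_cons, freeMor_three]
  exact (Category.assoc _ _ _).trans (congrArg (_ ≫ ·) (Category.assoc _ _ _))

/-- In the commutation, braid and four-term relations both sides are reduced paths with the same
element, hence give the same basis morphism; in `∂_i ∂_i = 0` the path is not reduced. -/
lemma freeFunctor_map_eq {X Y : FreeCat n} {f g : X ⟶ Y} (h : NilRel f g) :
    (freeFunctor cs).map f = (freeFunctor cs).map g := by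
  induction h with
  | four e₁ e₂ e₃ e₄ f₁ f₂ f₃ f₄ he hf =>
    obtain ⟨he₁, he₂, he₃, he₄⟩ := he
    obtain ⟨hf₁, hf₂, hf₃, hf₄⟩ := hf
    have := map_eq_of_pathBasis_eq (pathBasis_congr (isRed_four (cs := cs) he₁ he₂ he₃ he₄)
      (isRed_four' hf₁ hf₂ hf₃ hf₄) (by
        simp only [pathElt_cons, pathElt_nil, one_mul]
        exact elt_four he₁ he₂ he₃ he₄ hf₁ hf₂ hf₃ hf₄))
    rwa [freeMor_four, freeMor_four] at this
  | braid i hi e₁ e₂ e₃ f₁ f₂ f₃ he hf =>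
    obtain ⟨he₁, he₂, he₃⟩ := he
    obtain ⟨hf₁, hf₂, hf₃⟩ := hf
    have := map_eq_of_pathBasis_eq (pathBasis_congr (isRed_braid (cs := cs) (by omega) he₁ he₂ he₃)
      (isRed_braid' (by omega) hf₁ hf₂ hf₃) (by
        simp only [pathElt_cons, pathElt_nil, one_mul]
        exact elt_braid (by omega) he₁ he₂ he₃ hf₁ hf₂ hf₃))
    rwa [freeMor_three, freeMor_three] at this
  | comm i j hij e₁ e₂ f₁ f₂ he hf =>
    have := map_eq_of_pathBasis_eq (pathBasis_congr (isRed_two (cs := cs) e₁ e₂ (by omega))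
      (isRed_two f₁ f₂ (by omega)) (by
        rw [pathElt_two, pathElt_two]
        exact elt_comm hij he.1 he.2 hf.1 hf.2))
    simpa only [freeMor_cons _ e₂, freeMor_cons _ f₂, freeMor_single] using this
  | nil e₁ e₂ h =>
    have : (freeFunctor cs).map (freeMor ((Quiver.Path.nil.cons e₁).cons e₂)) = 0 := by
      refine Subtype.ext ((freeFunctor_map _).trans ?_)
      rw [pathBasis, if_neg (not_isRed_two e₁ e₂ h)]
      rfl
    rw [freeMor_cons, freeMor_single] at this
    exact this.trans (freeLift_map_zero _).symm
  | refl f => rfl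
  | symm f g h ih => exact ih.symm
  | trans f g h h₁ h₂ ih₁ ih₂ => exact ih₁.trans ih₂
  | comp_left f g g' h ih => rw [Functor.map_comp, Functor.map_comp, ih]
  | comp_right f f' g h ih => rw [Functor.map_comp, Functor.map_comp, ih]
  | add f f' g g' h₁ h₂ ih₁ ih₂ =>
    exact (freeLift_map_add _ _ _).trans
      ((congrArg₂ (· + ·) ih₁ ih₂).trans (freeLift_map_add _ _ _).symm)

end PathBasis

end CoxeterB

namespace CoxeterB

section Isomorphism

/-! ### The isomorphism of categories -/

variable {n : ℕ} {W : Type*} [Group W] {cs : CoxeterSystem (typeB n) W} [Finite W]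

open LabelSeq

variable (cs) in
/-- The functor from the labeled nilCoxeter algebroid to the atomic category. -/
noncomputable def nilFunctor : NilCoxB n ⥤ AD cs :=
  CategoryTheory.Quotient.lift NilRel (freeFunctor cs) fun _ _ _ _ h => freeFunctor_map_eq h

instance : (nilFunctor cs).Additive where
  map_add {X Y f g} := by
    obtain ⟨f, rfl⟩ := (Quotient.functor NilRel).map_surjective (X := X.as) (Y := Y.as) f
    obtain ⟨g, rfl⟩ := (Quotient.functor NilRel).map_surjective (X := X.as) (Y := Y.as) g
    exact freeLift_map_add _ f g

lemma nilFunctor_obj_bijective : Function.Bijective (nilFunctor cs).obj :=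
  toAD_bijective.comp (CategoryTheory.Quotient.equiv (NilRel (n := n))).bijective

variable {b c d : LabelSeq n}

lemma nilFunctor_map_pathMor (p : Quiver.Path c d) :
    ((nilFunctor cs).map (pathMor p)).1 = pathBasis cs p :=
  freeFunctor_map p

lemma nilFunctor_map_arrowMor (e : c ⟶ d) : (nilFunctor cs).map (arrowMor e) =
    AD.ofAtomic (J := toAD cs c) (I := toAD cs d) (invCoset cs c d (arrowElt cs e))
      (isAtomicAt_invCoset e).1 := by
  refine Subtype.ext ((nilFunctor_map_pathMor (Quiver.Path.nil.cons e)).trans ?_)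
  rw [pathBasis, if_pos (isRed_single e), pathElt_cons, pathElt_nil, one_mul]
  rfl

/-- Paths form a basis of the free category and the projection to the quotient is surjective on
morphisms. Additive statements about morphisms thus need checking on paths only. -/
lemma closure_range_pathMor :
    AddSubgroup.closure (Set.range (pathMor : Quiver.Path c d → _)) = ⊤ := by
  refine AddSubgroup.eq_top_iff' _ |>.2 fun f => ?_
  obtain ⟨f, rfl⟩ := (Quotient.functor (NilRel (n := n))).map_surjective
    (X := (show FreeCat n from c)) (Y := (show FreeCat n from d)) f
  induction f using Finsupp.induction_linear with
  | zero => exact zero_mem _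
  | add f g hf hg => exact add_mem hf hg
  | single p k =>
    have h1 := AddSubgroup.zsmul_mem _ (AddSubgroup.subset_closure (Set.mem_range_self
      (f := (pathMor : Quiver.Path c d → _)) p)) k
    have h2 : (Quotient.functor (NilRel (n := n))).Additive := Quotient.functor_additive _ _
    have h3 := (Quotient.functor (NilRel (n := n))).map_zsmul (f := freeMor p) (r := k)
    have h4 : k • freeMor p = (Finsupp.single p k : Quiver.Path c d →₀ ℤ) :=
      (Finsupp.smul_single k p (1 : ℤ)).trans (by simp)
    rw [h4] at h3
    exact h3 ▸ h1

/-! ### Faithfulness through a left inverse, and fullness -/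

open Classical in
variable (cs) in
/-- The inverse of the functor on the basis of the morphisms. -/
noncomputable def basisInv (c d : LabelSeq n) (x : Coset (toAD cs d).subset (toAD cs c).subset) :
    NilCoxB.of c ⟶ NilCoxB.of d :=
  if h : ∃ p : Quiver.Path c d, IsRed cs p ∧ invCoset cs c d (pathElt cs p) = x then
    pathMor h.choose else 0

/-- The choice of path is immaterial: the coset determines the core element, and Matsumoto's theorem
identifies the morphisms of its reduced paths. -/
lemma basisInv_invCoset {p : Quiver.Path c d} (hp : IsRed cs p) :
    basisInv cs c d (invCoset cs c d (pathElt cs p)) = pathMor p := by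
  have h : ∃ q : Quiver.Path c d, IsRed cs q ∧
      invCoset cs c d (pathElt cs q) = invCoset cs c d (pathElt cs p) := ⟨p, hp, rfl⟩
  rw [basisInv, dif_pos h]
  refine pathMor_eq_of_pathElt_eq h.choose_spec.1 hp (inv_injective ?_)
  exact IsCoreElt.coset_injective (isCoreElt_pathElt _).inv (isCoreElt_pathElt _).inv
    h.choose_spec.2

variable (cs) in
/-- The inverse of the functor on morphisms. -/
noncomputable def homInv (c d : LabelSeq n) :
    (Coset (toAD cs d).subset (toAD cs c).subset →₀ ℤ) →+ (NilCoxB.of c ⟶ NilCoxB.of d) :=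
  Finsupp.liftAddHom fun x => zmultiplesHom _ (basisInv cs c d x)

/-- On reduced paths this is the preceding computation; on the other paths both the morphism and its
image vanish. This is where the defining relations are seen to suffice. -/
lemma homInv_map (f : NilCoxB.of c ⟶ NilCoxB.of d) :
    homInv cs c d ((nilFunctor cs).map f).1 = f := by
  have hf : f ∈ AddSubgroup.closure (Set.range (pathMor : Quiver.Path c d → _)) := by
    rw [closure_range_pathMor]; trivial
  induction hf using AddSubgroup.closure_induction with
  | mem f hf =>
    obtain ⟨p, rfl⟩ := hf
    rw [nilFunctor_map_pathMor, pathBasis]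
    split_ifs with hp
    · refine (Finsupp.liftAddHom_apply_single _ _ _).trans ?_
      exact (one_zsmul _).trans (basisInv_invCoset hp)
    · rw [pathMor_eq_zero hp]
      exact map_zero _
  | zero =>
    rw [Functor.map_zero]
    exact map_zero _
  | add f g _ _ hf hg =>
    rw [Functor.map_add]
    exact (map_add _ _ _).trans (congrArg₂ (· + ·) hf hg)
  | neg f _ hf =>
    rw [Functor.map_neg]
    exact (map_neg _ _).trans (congrArg _ hf)

instance : (nilFunctor cs).Faithful where
  map_injective {X Y} f g h := by
    have h1 := congrArg (fun k => homInv cs X.as Y.as k.1) h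
    exact (homInv_map (c := X.as) (d := Y.as) f).symm.trans (h1.trans (homInv_map _))

/-- The objects are tied to sequences by equations because induction on membership in the atomic
subcategory needs arbitrary ends. -/
lemma exists_map_eq {J I : NilD cs} {f : J ⟶ I} (hf : InAD f) :
    ∀ (hJ : J = (toAD cs c).subset) (hI : I = (toAD cs d).subset),
      ∃ g : NilCoxB.of c ⟶ NilCoxB.of d, ((nilFunctor cs).map g).1 = hI ▸ hJ ▸ f := by
  induction hf generalizing c d with
  | @atomic I J p hp =>
    intro hJ hI
    change J = _ at hJ
    change I = _ at hI
    subst hJ hI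
    obtain ⟨s, t, hs, hst, hI, rfl⟩ := hp.exists_eq (simple_injective_typeB cs)
    obtain ⟨i, hi, rfl⟩ := c.notMem_parabolicSubset.1 hs
    have hi' : i + 1 < (c.act i).len := by rw [len_act]; exact hi
    -- The reflection `s` fixes `M`, and `t` is its conjugate by `w_M`; so the source and `s` alone
    -- determine the other end, which must be `c.act i`.
    have ht : t = (c.act i).gap i hi' := simple_injective_typeB cs
      (mul_right_cancel (hst.symm.trans (wl_mul_gap c hi hi')))
    rw [ht] at hI
    have hd : d = c.act i := parabolicSubset_injective
      (hI.trans (parabolicSubset_act c hi hi').symm)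
    subst hd
    refine ⟨arrowMor ⟨i, hi, rfl⟩, ?_⟩
    rw [nilFunctor_map_arrowMor]
    exact congrArg NilD.basis (invCoset_arrow _)
  | id I =>
    rintro rfl hI
    obtain rfl : c = d := toAD_bijective.1 (AD.ext hI)
    exact ⟨𝟙 _, congrArg Subtype.val ((nilFunctor cs).map_id _)⟩
  | @comp K J I f g _ _ hf hg =>
    rintro rfl rfl
    -- The intermediate object also comes from a sequence, since every subset of `S` does.
    obtain ⟨b, hb⟩ := toAD_bijective.2 ⟨J⟩
    obtain rfl : (toAD cs b).subset = J := congrArg AD.subset hb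
    obtain ⟨f, rfl⟩ := hf rfl rfl
    obtain ⟨g, rfl⟩ := hg rfl rfl
    refine ⟨f ≫ g, ?_⟩
    rw [Functor.map_comp]
    rfl
  | zero J I =>
    rintro rfl rfl
    refine ⟨0, ?_⟩
    rw [Functor.map_zero]
    rfl
  | add f g _ _ hf hg =>
    rintro rfl rfl
    obtain ⟨f, rfl⟩ := hf rfl rfl
    obtain ⟨g, rfl⟩ := hg rfl rfl
    refine ⟨f + g, ?_⟩
    rw [Functor.map_add]
    rfl
  | neg f _ hf =>
    rintro rfl rfl
    obtain ⟨f, rfl⟩ := hf rfl rfl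
    refine ⟨-f, ?_⟩
    rw [Functor.map_neg]
    rfl

instance : (nilFunctor cs).Full where
  map_surjective {X Y} f := by
    obtain ⟨g, hg⟩ := exists_map_eq (c := X.as) (d := Y.as) f.2 rfl rfl
    exact ⟨g, Subtype.ext hg⟩

end Isomorphism

end CoxeterB

theorem mainTheorem8 (n : ℕ) {W : Type*} [Group W] (cs : CoxeterSystem (typeB n) W) :
    ∃ ψ : NilCoxB n ⥤ AD cs,
      -- an isomorphism of `ℤ`-linear categories
      ψ.Additive ∧ Function.Bijective ψ.obj ∧ ψ.Full ∧ ψ.Faithful ∧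
      -- sequences are identified with parabolic subsets
      (∀ c : LabelSeq n, (ψ.obj (NilCoxB.of c)).subset.carrier = c.parabolicSubset) ∧
      -- `∂_i^J ↦ ∂_p`, where `p` is the atomic coset `a_i^J`
      ∀ (c : LabelSeq n) (i : ℕ) (hi : i + 1 < c.seq.length),
        ∃ (p : Coset (ψ.obj (NilCoxB.of (c.act i))).subset (ψ.obj (NilCoxB.of c)).subset)
          (hp : IsAtomicAt i p),
          ψ.map (NilCoxB.gen c i hi) = AD.ofAtomic p hp.1 := by
  -- Finiteness makes every subset of `S` finitary, so that all longest elements `w_A` exist.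
  have := finite_typeB cs
  exact ⟨nilFunctor cs, inferInstance, nilFunctor_obj_bijective, inferInstance, inferInstance,
    fun c => rfl, fun c i hi => ⟨_, isAtomicAt_invCoset ⟨i, hi, rfl⟩, nilFunctor_map_arrowMor _⟩⟩
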